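/- **Setting.** Let $A\in\mathbb{R}^{n\times d}$ have rank $d$, where $1\le d\le n$ and $n\ge 2$, with thin SVD $A=U\Sigma V^T$. The statistical leverage scores of $A$ are $\ell_i=\|U_{(i)}\|_2^2$, where $U_{(i)}$ is the $i$-th row of $U$ and $1\le i\le n$; the coherence is $\gamma=\max_i\ell_i$. Let $\epsilon\in(0,1/2]$. **Algorithm.** Let $N$ be the least power of two with $N\ge n$, let $H$ be the normalized $N\times N$ Hadamard matrix, and let $r_1,r_2$ be positive integers that depend only on $n,d,\epsilon$ and satisfy $$r_1=\Theta\!\left(\tfrac{d\ln n}{\epsilon^2}\ln\tfrac{d\ln n}{\epsilon^2}\right),\qquad r_2=\Theta\!\left(\epsilon^{-2}\ln n\right).$$ 1. Draw the subsampled randomized Hadamard transform $\Pi_1=S^THD\in\mathbb{R}^{r_1\times N}$. Here $D$ is a diagonal matrix of independent uniform signs, and $S^T$ samples $r_1$ rows independently, uniformly and with replacement, and rescales them by $\sqrt{N/r_1}$. Compute $\Pi_1A$, where $A$ is padded by $N-n$ zero rows. 2. Compute a matrix $R^{-1}\in\mathbb{R}^{d\times d}$ such that $\Pi_1AR^{-1}$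 has orthonormal columns whenever $\Pi_1A$ has rank $d$ (for example by a QR factorization). 3. Draw $\Pi_2\in\mathbb{R}^{d\times r_2}$, independently of $\Pi_1$, with independent entries that equal $+\sqrt{3/r_2}$ and $-\sqrt{3/r_2}$ with probability $1/6$ each, and $0$ with probability $2/3$. 4. Return $\tilde\ell_i=\|(AR^{-1}\Pi_2)_{(i)}\|_2^2$ for all $i$, and $\tilde\gamma=\max_i\tilde\ell_i$. **Theorem.** One can choose $r_1$, $r_2$ (with absolute constants in $\Theta$) and the rule for $R^{-1}$ so that a single program implements this algorithm for all inputs $(A,\epsilon)$ as above and has the properties below. The program is written for a randomized real RAM with unit-cost exact real arithmetic and square roots, unit-cost addition, subtraction and comparison of natural numbers, and unit-cost uniform draws from $\{0,\dots,m-1\}$. (a) For every such $A$ and $\epsilon$, with probability at least $0.8$, $$|\ell_i-\tilde\ell_i|\le\epsilon\,\ell_i\quad\text{for all }i\in\{1,\dots,n\},\qquad\text{and}\qquad|\gamma-\tilde\gamma|\le\epsilon\,\gamma.$$ (b) Every run halts, within a number of steps $T(n,d,\epsilon)$ that depends only on $n,d,\epsilon$. If $n\le e^d$, then, with an absolute constant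 in $O(\cdot)$, $$T(n,d,\epsilon)=O\!\left(nd\ln(d\epsilon^{-1})+nd\,\epsilon^{-2}\ln n+d^3\epsilon^{-2}(\ln n)\ln(d\epsilon^{-1})\right).$$ (c) For fixed $\epsilon$ and any sequences $n=n_k$, $d=d_k$ of sizes as above with $d\ln d=o(n/\ln n)$ and $\ln n=o(d)$, we have $T(n,d,\epsilon)=o(nd^2)$. -/

import Mathlib

open scoped ENNReal Matrix

/-! ## A randomized real RAM

Memory consists of finitely many named two-dimensional arrays (only the names that occur in the
program matter) of natural numbers and of real numbers.  One step executes one elementary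
statement or one test.  Natural numbers support constants, addition, truncated subtraction,
comparison and indirect addressing; real numbers support exact field operations, square roots
and comparison.  There are no real constants other than those obtained from natural numbers, and
there is no rounding from real to natural numbers.  Randomness is a statement that draws a
uniformly distributed element of `{0, …, m - 1}`. -/

namespace RealRAM

/-- Natural-number valued expressions. -/
inductive NExpr where
  | lit (k : ℕ)
  | get (a : ℕ) (i j : NExpr)
  | plus (x y : NExpr)
  | minus (x y : NExpr)

/-- Real valued expressions. -/
inductive RExpr where
  | ofNat (x : NExpr)
  | get (a : ℕ) (i j : NExpr)
  | plus (x y : RExpr)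
  | minus (x y : RExpr)
  | times (x y : RExpr)
  | quot (x y : RExpr)
  | root (x : RExpr)

/-- Tests. -/
inductive Test where
  | natLt (x y : NExpr)
  | realLt (x y : RExpr)

/-- Programs. -/
inductive Prog where
  | skip
  | setNat (a : ℕ) (i j : NExpr) (x : NExpr)
  | setReal (a : ℕ) (i j : NExpr) (x : RExpr)
  | draw (a : ℕ) (i j : NExpr) (m : NExpr)
  | seq (p q : Prog)
  | branch (t : Test) (p q : Prog)
  | loop (t : Test) (p : Prog)

/-- The memory: entry `(i, j)` of the array named `a`, for each of the two sorts. -/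
structure Memory where
  nat : ℕ → ℕ → ℕ → ℕ
  real : ℕ → ℕ → ℕ → ℝ

/-- Overwrite one cell of a family of arrays. -/
def write {α : Type} (M : ℕ → ℕ → ℕ → α) (a i j : ℕ) (v : α) : ℕ → ℕ → ℕ → α :=
  fun a' i' j' => if a' = a ∧ i' = i ∧ j' = j then v else M a' i' j'

def NExpr.eval (s : Memory) : NExpr → ℕ
  | .lit k => k
  | .get a i j => s.nat a (i.eval s) (j.eval s)
  | .plus x y => x.eval s + y.eval s
  | .minus x y => x.eval s - y.eval s

noncomputable def RExpr.eval (s : Memory) : RExpr → ℝ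
  | .ofNat x => (x.eval s : ℝ)
  | .get a i j => s.real a (i.eval s) (j.eval s)
  | .plus x y => x.eval s + y.eval s
  | .minus x y => x.eval s - y.eval s
  | .times x y => x.eval s * y.eval s
  | .quot x y => x.eval s / y.eval s
  | .root x => Real.sqrt (x.eval s)

def Test.Holds (s : Memory) : Test → Prop
  | .natLt x y => x.eval s < y.eval s
  | .realLt x y => x.eval s < y.eval s

/-- The uniform distribution on `{0, …, m - 1}` (and the value `0` if `m = 0`). -/
noncomputable def uniformBelow : ℕ → PMF ℕ
  | 0 => PMF.pure 0
  | m + 1 => (PMF.uniformOfFintype (Fin (m + 1))).map (fun x => (x : ℕ))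

/-- A configuration: the memory and the stack of programs that remain to be executed. -/
structure Config where
  mem : Memory
  todo : List Prog

open Classical in
/-- One step of the machine; a configuration with nothing left to do has halted. -/
noncomputable def step (c : Config) : PMF Config :=
  match c.todo with
  | [] => PMF.pure c
  | .skip :: k => PMF.pure ⟨c.mem, k⟩
  | .setNat a i j x :: k =>
      PMF.pure ⟨{ c.mem with
        nat := write c.mem.nat a (i.eval c.mem) (j.eval c.mem) (x.eval c.mem) }, k⟩
  | .setReal a i j x :: k =>
      PMF.pure ⟨{ c.mem with
        real := write c.mem.real a (i.eval c.mem) (j.eval c.mem) (x.eval c.mem) }, k⟩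
  | .draw a i j m :: k =>
      (uniformBelow (m.eval c.mem)).map fun v =>
        ⟨{ c.mem with nat := write c.mem.nat a (i.eval c.mem) (j.eval c.mem) v }, k⟩
  | .seq p q :: k => PMF.pure ⟨c.mem, p :: q :: k⟩
  | .branch t p q :: k => PMF.pure ⟨c.mem, (if t.Holds c.mem then p else q) :: k⟩
  | .loop t p :: k => PMF.pure ⟨c.mem, if t.Holds c.mem then p :: .loop t p :: k else k⟩

/-- The distribution of the configuration after `T` steps. -/
noncomputable def runFor (c : Config) : ℕ → PMF Config
  | 0 => PMF.pure c
  | T + 1 => (runFor c T).bind step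

/-- Every possible run from `c` halts after at most `T` steps. -/
def HaltsWithin (c : Config) (T : ℕ) : Prop :=
  ∀ c' ∈ (runFor c T).support, c'.todo = []

/-- The initial configuration on input `(A, ε)`: the sizes `n`, `d` are in the natural-number
arrays `0`, `1`, the matrix `A` is in the real array `0`, and `ε` is in the real array `1`. -/
noncomputable def start (p : Prog) {n d : ℕ} (A : Matrix (Fin n) (Fin d) ℝ) (ε : ℝ) : Config where
  mem :=
    { nat := fun a i j =>
        if a = 0 ∧ i = 0 ∧ j = 0 then n else if a = 1 ∧ i = 0 ∧ j = 0 then d else 0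
      real := fun a i j =>
        if a = 0 then (if h : i < n ∧ j < d then A ⟨i, h.1⟩ ⟨j, h.2⟩ else 0)
        else if a = 1 ∧ i = 0 ∧ j = 0 then ε else 0 }
  todo := [p]

/-- The output of a run: a vector of length `n` (first column of the real array `2`) and a number
(entry `(0, 0)` of the real array `3`). -/
def output (n : ℕ) (c : Config) : (Fin n → ℝ) × ℝ :=
  (fun i => c.mem.real 2 i 0, c.mem.real 3 0 0)

end RealRAM

namespace Leverage

/-- A thin singular value decomposition `A = U Σ Vᵀ` of an `n × d` matrix of rank `d`. -/
structure ThinSVD {n d : ℕ} (A : Matrix (Fin n) (Fin d) ℝ) where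
  U : Matrix (Fin n) (Fin d) ℝ
  σ : Fin d → ℝ
  V : Matrix (Fin d) (Fin d) ℝ
  orthU : Uᵀ * U = 1
  orthV : Vᵀ * V = 1
  pos : ∀ j, 0 < σ j
  eq : A = U * Matrix.diagonal σ * Vᵀ

/-- The statistical leverage scores: squared Euclidean norms of the rows of the matrix of left
singular vectors. -/
def ThinSVD.score {n d : ℕ} {A : Matrix (Fin n) (Fin d) ℝ} (S : ThinSVD A) (i : Fin n) : ℝ :=
  ∑ j, S.U i j ^ 2

/-- The coherence: the largest leverage score. -/
noncomputable def ThinSVD.coherence {n d : ℕ} {A : Matrix (Fin n) (Fin d) ℝ} (S : ThinSVD A) : ℝ :=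
  ⨆ i, S.score i

/-- Entries of the unnormalized Hadamard matrix `Ĥ` of size `2 ^ k`, by the block recursion
`Ĥ_{2m} = [Ĥ_m, Ĥ_m; Ĥ_m, -Ĥ_m]`. -/
def hadamardEntry : ℕ → ℕ → ℕ → ℝ
  | 0, _, _ => 1
  | k + 1, i, j =>
      (if 2 ^ k ≤ i ∧ 2 ^ k ≤ j then -1 else 1) * hadamardEntry k (i % 2 ^ k) (j % 2 ^ k)

/-- The normalized Hadamard matrix of size `2 ^ k`. -/
noncomputable def hadamard (k : ℕ) : Matrix (Fin (2 ^ k)) (Fin (2 ^ k)) ℝ :=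
  Matrix.of fun i j => hadamardEntry k i j / Real.sqrt (2 ^ k)

/-- The rescaled operator that samples the rows `s 0, …, s (r - 1)` out of `N` rows. -/
noncomputable def samplingMatrix {N r : ℕ} (s : Fin r → Fin N) : Matrix (Fin r) (Fin N) ℝ :=
  Matrix.of fun t a => if s t = a then Real.sqrt (N / r) else 0

/-- The diagonal matrix of signs. -/
def signMatrix {N : ℕ} (b : Fin N → Bool) : Matrix (Fin N) (Fin N) ℝ :=
  Matrix.diagonal fun a => if b a then 1 else -1

/-- The operator that appends `N - n` zeros to a vector of length `n`. -/
def padMatrix (n N : ℕ) : Matrix (Fin N) (Fin n) ℝ :=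
  Matrix.of fun a i => if (a : ℕ) = (i : ℕ) then 1 else 0

/-- The subsampled randomized Hadamard transform `Π₁ = Sᵀ H D` for given outcomes of the sampled
rows `s` and the signs `b`.  Vectors of length `n` are padded by zeros to the least power of two
`2 ^ ⌈log₂ n⌉` (no padding takes place if `n` is a power of two). -/
noncomputable def srht (n : ℕ) {r : ℕ} (b : Fin (2 ^ Nat.clog 2 n) → Bool)
    (s : Fin r → Fin (2 ^ Nat.clog 2 n)) : Matrix (Fin r) (Fin n) ℝ :=
  samplingMatrix s * hadamard (Nat.clog 2 n) * signMatrix b * padMatrix n (2 ^ Nat.clog 2 n)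

/-- The sparse sign matrix `Π₂`: for `x` uniform on six elements an entry is `±√(3/r)` with
probability `1/6` each and `0` with probability `2/3`. -/
noncomputable def sparseSign {d r : ℕ} (x : Fin d → Fin r → Fin 6) : Matrix (Fin d) (Fin r) ℝ :=
  Matrix.of fun j t =>
    if x j t = 0 then Real.sqrt (3 / r) else if x j t = 1 then -Real.sqrt (3 / r) else 0

/-- A rule that computes from every matrix `B` of full column rank a square matrix `R⁻¹` for which
`B R⁻¹` has orthonormal columns (for instance from a QR factorization or an SVD of `B`). -/
def IsOrthogonalizer
    (orth : (r d : ℕ) → Matrix (Fin r) (Fin d) ℝ → Matrix (Fin d) (Fin d) ℝ) : Prop :=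
  ∀ (r d : ℕ) (B : Matrix (Fin r) (Fin d) ℝ), B.rank = d →
    (B * orth r d B)ᵀ * (B * orth r d B) = 1

/-- The outcomes of the random choices: signs, sampled rows (independent, with replacement), and
the entries of the sparse sign matrix. -/
abbrev Draws (N r₁ d r₂ : ℕ) : Type :=
  (Fin N → Bool) × (Fin r₁ → Fin N) × (Fin d → Fin r₂ → Fin 6)

/-- The estimates for given outcomes of the random choices: the squared row norms of
`Ω = A R⁻¹ Π₂`, where `R⁻¹` is the orthogonalizer of `Π₁ A`. -/
noncomputable def estimates
    (orth : (r d : ℕ) → Matrix (Fin r) (Fin d) ℝ → Matrix (Fin d) (Fin d) ℝ)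
    {n d : ℕ} (A : Matrix (Fin n) (Fin d) ℝ) (r₁ r₂ : ℕ)
    (ω : Draws (2 ^ Nat.clog 2 n) r₁ d r₂) (i : Fin n) : ℝ :=
  ∑ t, (A * orth r₁ d (srht n ω.1 ω.2.1 * A) * sparseSign ω.2.2) i t ^ 2

/-- The distribution of the vector of estimates: all random choices are independent and uniform. -/
noncomputable def estimatesLaw
    (orth : (r d : ℕ) → Matrix (Fin r) (Fin d) ℝ → Matrix (Fin d) (Fin d) ℝ)
    {n d : ℕ} (A : Matrix (Fin n) (Fin d) ℝ) (r₁ r₂ : ℕ) : PMF (Fin n → ℝ) :=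
  (PMF.uniformOfFintype (Draws (2 ^ Nat.clog 2 n) r₁ d r₂)).map (estimates orth A r₁ r₂)

/-- The bound `nd ln(d/ε) + nd ε⁻² ln n + d³ ε⁻² (ln n) ln(d/ε)`. -/
noncomputable def timeBound (n d : ℕ) (ε : ℝ) : ℝ :=
  n * d * Real.log (d / ε) + n * d * (1 / ε ^ 2) * Real.log n
    + d ^ 3 * (1 / ε ^ 2) * Real.log n * Real.log (d / ε)

end Leverage

/-!
# Fast approximation of statistical leverage scores

Write `A = U Σ Vᵀ` and let `R⁻¹` orthogonalize the sketch `Π₁ A`. The leverage score of row `i` is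
the squared length of row `i` of `U`, and it does not change if `U` is replaced by any other matrix
with orthonormal columns and the same range. If the columns of `Π₁ U` are nearly orthonormal, then
`A R⁻¹` is nearly such a matrix, so its row lengths are accurate; the sparse sign matrix `Π₂`
preserves the lengths of these `n` rows. Hence the estimates are accurate (`abs_row_sub_score_le`,
`probability_estimates`).

*The sketch.* The randomized Hadamard transform spreads out the rows of `U`: by Hoeffding's
inequality all entries of `H D U` are small with high probability (`probability_mixedRow`). The
Gram matrix of `Π₁ U` is then an average of `r₁` independent uniformly chosen bounded matrices of
rank one, whose mean is the identity. Symmetrization and the noncommutative Khintchine inequality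
bound the expected deviation (`sq_expect_norm_signedSum_le`, `probability_norm_sum_vecMulVec_le`);
the inequality comes from the trace of an even power of the signed sum, whose exponent is a
power of two that is at least logarithmic in `d`. This is where the second logarithm in `r₁` is
used. Since the random choices are uniform on a finite type, all expectations are finite averages.

*The projection.* The squared length of a projected row is an average of `r₂` independent squares of
sums of sparse signs. Such a square has exponential moments (`expect_exp_sparseSum_sq_le`), so a
Chernoff bound and a union bound give all `n` lengths up to a factor `1 ± ε / 8`
(`probability_sparseSign`).

*The program.* `leverageProg` computes the sizes with additions, subtractions and comparisons only
(`ends_sizeProg`), draws all random numbers in advance (`yields_drawProg`), and then runs a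
deterministic computation (`ends_computeProg`): a fast Hadamard transform in `⌈log₂ n⌉` passes over
the data (`fast_hadamard`), the Gram matrix of the sketch, Gram–Schmidt on the standard basis with
respect to this form (`gs`), and the row norms, multiplied from right to left. `⌈log₂ ·⌉` and
`⌈ε⁻²⌉` replace the logarithms and `ε⁻²` in the sizes, as they can be found by doubling and by
counting. Counting steps bounds the running time by a multiple of
`n d E K + d³ E K L`, with `K`, `E`, `L` the discrete versions of `ln n`, `ε⁻²` and
`ln (d ε⁻² ln n)` (`runTime_le_nat`); for `ln n ≤ d` this is the claimed bound.
-/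

/-! ### Deterministic execution on the machine -/

namespace RealRAM

/-- `Exec p s t s'`: the program `p`, none of whose executed statements is a draw, leads from the
memory `s` to the memory `s'` in exactly `t` steps. -/
inductive Exec : Prog → Memory → ℕ → Memory → Prop
  | skip (s : Memory) : Exec .skip s 1 s
  | setNat (s : Memory) (a : ℕ) (i j x : NExpr) :
      Exec (.setNat a i j x) s 1 { s with nat := write s.nat a (i.eval s) (j.eval s) (x.eval s) }
  | setReal (s : Memory) (a : ℕ) (i j : NExpr) (x : RExpr) :
      Exec (.setReal a i j x) s 1
        { s with real := write s.real a (i.eval s) (j.eval s) (x.eval s) }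
  | seq {p q : Prog} {s s₁ s₂ : Memory} {t u : ℕ} :
      Exec p s t s₁ → Exec q s₁ u s₂ → Exec (.seq p q) s (1 + t + u) s₂
  | branch_pos {c : Test} {p : Prog} (q : Prog) {s s' : Memory} {t : ℕ} :
      c.Holds s → Exec p s t s' → Exec (.branch c p q) s (1 + t) s'
  | branch_neg {c : Test} (p : Prog) {q : Prog} {s s' : Memory} {t : ℕ} :
      ¬ c.Holds s → Exec q s t s' → Exec (.branch c p q) s (1 + t) s'
  | loop_done {c : Test} (p : Prog) {s : Memory} : ¬ c.Holds s → Exec (.loop c p) s 1 s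
  | loop_step {c : Test} {p : Prog} {s s₁ s₂ : Memory} {t u : ℕ} :
      c.Holds s → Exec p s t s₁ → Exec (.loop c p) s₁ u s₂ → Exec (.loop c p) s (1 + t + u) s₂

theorem runFor_add (c : Config) (t u : ℕ) :
    runFor c (t + u) = (runFor c t).bind fun c' => runFor c' u := by
  induction u with
  | zero => simp [runFor]
  | succ u ih => rw [← add_assoc, runFor, ih, PMF.bind_bind]; rfl

theorem runFor_halted (s : Memory) (t : ℕ) : runFor ⟨s, []⟩ t = PMF.pure ⟨s, []⟩ := by
  induction t with
  | zero => rfl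
  | succ t ih => rw [runFor, ih, PMF.pure_bind]; rfl

theorem runFor_one (c : Config) : runFor c 1 = step c := by
  simp [runFor]

theorem runFor_succ_of_step {c c' : Config} (h : step c = PMF.pure c') (t : ℕ) :
    runFor c (1 + t) = runFor c' t := by
  rw [runFor_add, runFor_one, h, PMF.pure_bind]

theorem Exec.runFor {p : Prog} {s s' : Memory} {t : ℕ} (h : Exec p s t s') (k : List Prog) :
    runFor ⟨s, p :: k⟩ t = PMF.pure ⟨s', k⟩ := by
  induction h generalizing k with
  | skip | setNat | setReal => rw [runFor_one]; rfl
  | seq _ _ ih₁ ih₂ =>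
    rw [add_assoc, runFor_succ_of_step rfl, runFor_add, ih₁, PMF.pure_bind, ih₂]
  | branch_pos q hc _ ih => rw [runFor_succ_of_step rfl, if_pos hc, ih]
  | branch_neg q hc _ ih => rw [runFor_succ_of_step rfl, if_neg hc, ih]
  | loop_done p hc =>
    rw [runFor_one]
    simp only [step, if_neg hc]
  | loop_step hc _ _ ih₁ ih₂ =>
    rw [add_assoc, runFor_succ_of_step rfl, if_pos hc, runFor_add, ih₁, PMF.pure_bind, ih₂]

/-- The program does not write to the array `a` of natural numbers. -/
def Prog.KeepsNat (a : ℕ) : Prog → Prop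
  | .skip => True
  | .setNat b _ _ _ => a ≠ b
  | .setReal _ _ _ _ => True
  | .draw b _ _ _ => a ≠ b
  | .seq p q => p.KeepsNat a ∧ q.KeepsNat a
  | .branch _ p q => p.KeepsNat a ∧ q.KeepsNat a
  | .loop _ p => p.KeepsNat a

theorem write_of_ne {α : Type} (M : ℕ → ℕ → ℕ → α) {a a' : ℕ} (h : a' ≠ a) (i j : ℕ) (v : α) :
    write M a i j v a' = M a' := by
  funext x y; simp [write, h]

theorem Exec.nat_eq {p : Prog} {s s' : Memory} {t a : ℕ} (h : Exec p s t s')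
    (ha : p.KeepsNat a) : s'.nat a = s.nat a := by
  induction h with
  | skip | setReal | loop_done => rfl
  | setNat => exact write_of_ne _ ha _ _ _
  | seq _ _ ih₁ ih₂ => rw [ih₂ ha.2, ih₁ ha.1]
  | branch_pos _ _ _ ih => exact ih ha.1
  | branch_neg _ _ _ ih => exact ih ha.2
  | loop_step _ _ _ ih₁ ih₂ => rw [ih₂ ha, ih₁ ha]

/-- Total correctness with a time bound: from the memory `s` the program terminates, without
drawing, after at most `T` steps, in a memory that satisfies `Q`. -/
def Ends (p : Prog) (s : Memory) (T : ℕ) (Q : Memory → Prop) : Prop :=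
  ∃ t ≤ T, ∃ s', Exec p s t s' ∧ Q s'

theorem Ends.mono {p : Prog} {s : Memory} {T T' : ℕ} {Q Q' : Memory → Prop} (h : Ends p s T Q)
    (hT : T ≤ T') (hQ : ∀ s', Q s' → Q' s') : Ends p s T' Q' := by
  obtain ⟨t, ht, s', he, hq⟩ := h
  exact ⟨t, ht.trans hT, s', he, hQ _ hq⟩

/-- Arrays that the program does not write to can be added to the postcondition. -/
theorem Ends.frame {p : Prog} {s : Memory} {T : ℕ} {Q : Memory → Prop} (h : Ends p s T Q) :
    Ends p s T fun s' => Q s' ∧ ∀ a, p.KeepsNat a → s'.nat a = s.nat a := by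
  obtain ⟨t, ht, s', he, hq⟩ := h
  exact ⟨t, ht, s', he, hq, fun a ha => he.nat_eq ha⟩

theorem Ends.seq {p q : Prog} {s : Memory} {T U : ℕ} {P Q : Memory → Prop} (hp : Ends p s T P)
    (hq : ∀ s', P s' → Ends q s' U Q) : Ends (.seq p q) s (T + U + 1) Q := by
  obtain ⟨t, ht, s₁, he₁, h₁⟩ := hp
  obtain ⟨u, hu, s₂, he₂, h₂⟩ := hq _ h₁
  exact ⟨1 + t + u, by omega, s₂, he₁.seq he₂, h₂⟩

theorem ends_setNat (s : Memory) (a : ℕ) (i j x : NExpr) {Q : Memory → Prop}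
    (h : Q { s with nat := write s.nat a (i.eval s) (j.eval s) (x.eval s) }) :
    Ends (.setNat a i j x) s 1 Q := ⟨1, le_rfl, _, .setNat s a i j x, h⟩

theorem ends_setReal (s : Memory) (a : ℕ) (i j : NExpr) (x : RExpr) {Q : Memory → Prop}
    (h : Q { s with real := write s.real a (i.eval s) (j.eval s) (x.eval s) }) :
    Ends (.setReal a i j x) s 1 Q := ⟨1, le_rfl, _, .setReal s a i j x, h⟩

/-- A loop that runs exactly `M` times: the invariant `I k` holds after `k` rounds. -/
theorem ends_loop {c : Test} {p : Prog} (M τ : ℕ) (I : ℕ → Memory → Prop)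
    (hc : ∀ k ≤ M, ∀ s, I k s → (c.Holds s ↔ k < M))
    (hp : ∀ k < M, ∀ s, I k s → Ends p s τ (I (k + 1))) {s : Memory} (h0 : I 0 s) :
    Ends (.loop c p) s (M * (τ + 1) + 1) (I M) := by
  suffices H : ∀ r k, k + r = M → ∀ s, I k s → Ends (.loop c p) s (r * (τ + 1) + 1) (I M) from
    H M 0 (by simp) s h0
  intro r
  induction r with
  | zero =>
    intro k hk s hs
    have : k = M := by omega
    subst this
    refine ⟨1, by omega, s, .loop_done p ?_, hs⟩
    rw [hc k le_rfl s hs]; exact lt_irrefl _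
  | succ r ih =>
    intro k hk s hs
    obtain ⟨t, ht, s₁, he₁, h₁⟩ := hp k (by omega) s hs
    obtain ⟨u, hu, s₂, he₂, h₂⟩ := ih (k + 1) (by omega) s₁ h₁
    refine ⟨1 + t + u, ?_, s₂, .loop_step ((hc k (by omega) s hs).2 (by omega)) he₁ he₂, h₂⟩
    rw [Nat.add_mul]; omega

/-- A variable: the cell `(0, 0)` of an array of natural numbers. -/
abbrev NExpr.var (a : ℕ) : NExpr := .get a (.lit 0) (.lit 0)

/-- A real variable: the cell `(0, 0)` of an array of real numbers. -/
abbrev RExpr.var (a : ℕ) : RExpr := .get a (.lit 0) (.lit 0)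

/-- Assign to a variable. -/
abbrev Prog.letNat (a : ℕ) (x : NExpr) : Prog := .setNat a (.lit 0) (.lit 0) x

/-- Assign to a real variable. -/
abbrev Prog.letReal (a : ℕ) (x : RExpr) : Prog := .setReal a (.lit 0) (.lit 0) x

/-- Repeat `p` while the variable `i` counts from `0` up to the value of `m`. -/
def Prog.forLoop (i : ℕ) (m : NExpr) (p : Prog) : Prog :=
  .seq (.letNat i (.lit 0))
    (.loop (.natLt (.var i) m) (.seq p (.letNat i (.plus (.var i) (.lit 1)))))

/-- The memory after the assignment of `v` to the variable `a`. -/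
def Memory.setVar (s : Memory) (a v : ℕ) : Memory := { s with nat := write s.nat a 0 0 v }

@[simp] theorem Memory.setVar_nat_self (s : Memory) (a v : ℕ) : (s.setVar a v).nat a 0 0 = v := by
  simp [setVar, write]

theorem Memory.setVar_nat_of_ne (s : Memory) {a b : ℕ} (h : b ≠ a) (v : ℕ) :
    (s.setVar a v).nat b = s.nat b := write_of_ne _ h _ _ _

/-- Rule for counting loops.  The invariant `I k` has to be insensitive to the counter. -/
theorem ends_forLoop {i : ℕ} {m : NExpr} {p : Prog} (M τ : ℕ) (I : ℕ → Memory → Prop)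
    (hi : p.KeepsNat i) (hI : ∀ k s v, I k s → I k (s.setVar i v))
    (hm : ∀ k ≤ M, ∀ s, I k s → m.eval s = M)
    (hp : ∀ k < M, ∀ s, I k s → s.nat i 0 0 = k → Ends p s τ (I (k + 1)))
    {s : Memory} (h0 : I 0 s) :
    Ends (.forLoop i m p) s (M * (τ + 3) + 3) (I M) := by
  have hloop := ends_loop (c := .natLt (.var i) m)
    (p := .seq p (.letNat i (.plus (.var i) (.lit 1)))) M (τ + 2)
    (fun k s => I k s ∧ s.nat i 0 0 = k)
    (by
      rintro k hk s ⟨h, hv⟩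
      simp [Test.Holds, NExpr.eval, hv, hm k hk s h])
    (by
      rintro k hk s ⟨h, hv⟩
      refine Ends.mono (Ends.seq (Ends.frame (hp k hk s h hv)) (U := 1)
        (Q := fun s => I (k + 1) s ∧ s.nat i 0 0 = k + 1) ?_) (by omega) fun _ h => h
      rintro s' ⟨h', hn⟩
      refine ends_setNat _ _ _ _ _ ?_
      have hv' : s'.nat i 0 0 = k := by rw [hn i hi, hv]
      simp only [NExpr.eval, hv']
      exact ⟨hI _ _ _ h', Memory.setVar_nat_self s' i (k + 1)⟩)
    (s := s.setVar i 0) ⟨hI _ _ _ h0, by simp⟩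
  have h1 : Ends (.letNat i (.lit 0)) s 1 (fun s' => s' = s.setVar i 0) :=
    ends_setNat _ _ _ _ _ rfl
  refine Ends.mono (Ends.seq h1 (U := M * (τ + 3) + 1) (Q := I M) ?_) (by omega)
    fun _ h => h
  rintro _ rfl
  exact hloop.mono le_rfl fun _ h => h.1

theorem keepsNat_forLoop {a i : ℕ} {m : NExpr} {p : Prog} :
    (Prog.forLoop i m p).KeepsNat a ↔ a ≠ i ∧ p.KeepsNat a := by
  simp [Prog.forLoop, Prog.KeepsNat]; tauto

/-! ### Tables of sums -/

/-- Fill a table: for `i < mi` and `j < mj`, store `∑_{k < mk} term` in the entry `(ri, cj)` of the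
real array `a`.  The counters `i`, `j`, `k` are the variables `20`, `21`, `22`, and the real
variable `20` accumulates the sum. -/
def Prog.table (a : ℕ) (mi mj mk ri cj : NExpr) (term : RExpr) : Prog :=
  .forLoop 20 mi (.forLoop 21 mj
    (.seq (.letReal 20 (.ofNat (.lit 0)))
      (.seq (.forLoop 22 mk (.letReal 20 (.plus (.var 20) term))) (.setReal a ri cj (.var 20)))))

theorem keepsNat_table {b a : ℕ} {mi mj mk ri cj : NExpr} {term : RExpr} :
    (Prog.table a mi mj mk ri cj term).KeepsNat b ↔ b ≠ 20 ∧ b ≠ 21 ∧ b ≠ 22 := by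
  simp [Prog.table, keepsNat_forLoop, Prog.KeepsNat]

/-- The memories `s` and `s'` agree on all that a table computation in the array `a` with target
cells `W` must not change. -/
structure Agree (a : ℕ) (W : ℕ → ℕ → Prop) (s s' : Memory) : Prop where
  nat : ∀ b, b ≠ 20 → b ≠ 21 → b ≠ 22 → s'.nat b = s.nat b
  real : ∀ b, b ≠ 20 → b ≠ a → s'.real b = s.real b
  cell : ∀ x y, ¬ W x y → s'.real a x y = s.real a x y

theorem Agree.refl (a : ℕ) (W : ℕ → ℕ → Prop) (s : Memory) : Agree a W s s :=
  ⟨fun _ _ _ _ => rfl, fun _ _ _ => rfl, fun _ _ _ => rfl⟩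

theorem Agree.setVar {a : ℕ} {W : ℕ → ℕ → Prop} {s s' : Memory} (h : Agree a W s s') {i : ℕ}
    (hi : i = 20 ∨ i = 21 ∨ i = 22) (v : ℕ) : Agree a W s (s'.setVar i v) := by
  refine ⟨fun b h₀ h₁ h₂ => ?_, h.real, h.cell⟩
  rw [Memory.setVar_nat_of_ne _ (by omega), h.nat b h₀ h₁ h₂]

theorem Agree.setAcc {a : ℕ} {W : ℕ → ℕ → Prop} {s s' : Memory} (h : Agree a W s s')
    (ha : a ≠ 20) (x y : ℕ) (v : ℝ) :
    Agree a W s { s' with real := write s'.real 20 x y v } := by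
  refine ⟨h.nat, fun b h₀ h₁ => ?_, fun x y hW => ?_⟩
  · exact (write_of_ne _ h₀ _ _ _).trans (h.real b h₀ h₁)
  · exact (congrFun (congrFun (write_of_ne _ ha _ _ _) x) y).trans (h.cell x y hW)

theorem Agree.setCell {a : ℕ} {W : ℕ → ℕ → Prop} {s s' : Memory} (h : Agree a W s s')
    {x y : ℕ} (hW : W x y) (v : ℝ) :
    Agree a W s { s' with real := write s'.real a x y v } := by
  refine ⟨h.nat, fun b h₀ h₁ => ?_, fun x' y' hW' => ?_⟩
  · exact (write_of_ne _ h₁ _ _ _).trans (h.real b h₀ h₁)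
  · have : ¬ (x' = x ∧ y' = y) := by rintro ⟨rfl, rfl⟩; exact hW' hW
    simpa [write, this] using h.cell x' y' hW'

/-- Correctness and running time of `Prog.table`.  The hypothesis on the expressions is
asked for in every memory that agrees with the initial one outside the cells being written. -/
theorem ends_table {a : ℕ} {mi mj mk ri cj : NExpr} {term : RExpr} {s : Memory}
    (Mi Mj Mk : ℕ) (gi gj : ℕ → ℕ) (f : ℕ → ℕ → ℕ → ℝ) (W : ℕ → ℕ → Prop) (ha : a ≠ 20)
    (hgi : Function.Injective gi) (hgj : Function.Injective gj)
    (hW : ∀ i < Mi, ∀ j < Mj, W (gi i) (gj j))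
    (hmi : ∀ s', Agree a W s s' → mi.eval s' = Mi) (hmj : ∀ s', Agree a W s s' → mj.eval s' = Mj)
    (hmk : ∀ s', Agree a W s s' → mk.eval s' = Mk)
    (hri : ∀ s', Agree a W s s' → ri.eval s' = gi (s'.nat 20 0 0))
    (hcj : ∀ s', Agree a W s s' → cj.eval s' = gj (s'.nat 21 0 0))
    (hterm : ∀ s', Agree a W s s' → s'.nat 20 0 0 < Mi → s'.nat 21 0 0 < Mj →
      s'.nat 22 0 0 < Mk → term.eval s' = f (s'.nat 20 0 0) (s'.nat 21 0 0) (s'.nat 22 0 0)) :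
    Ends (.table a mi mj mk ri cj term) s (Mi * (Mj * (Mk * 4 + 10) + 6) + 3) fun s' =>
      Agree a W s s' ∧
        ∀ i < Mi, ∀ j < Mj, s'.real a (gi i) (gj j) = ∑ k ∈ Finset.range Mk, f i j k := by
  refine ends_forLoop (i := 20) Mi (Mj * (Mk * 4 + 10) + 3)
    (fun k s' => Agree a W s s' ∧ ∀ i < k, ∀ j < Mj,
      s'.real a (gi i) (gj j) = ∑ k ∈ Finset.range Mk, f i j k)
    (by simp [keepsNat_forLoop, Prog.KeepsNat])
    (fun k s' v h => ⟨h.1.setVar (by simp) v, h.2⟩) (fun k _ s' h => hmi s' h.1) ?_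
    ⟨Agree.refl _ _ _, by simp⟩
  rintro i hi s₁ ⟨h₁, h₁'⟩ hv₁
  refine Ends.mono (ends_forLoop (i := 21) Mj (Mk * 4 + 7)
    (fun k s' => (Agree a W s s' ∧ ∀ i' < i, ∀ j < Mj,
        s'.real a (gi i') (gj j) = ∑ k ∈ Finset.range Mk, f i' j k) ∧ s'.nat 20 0 0 = i ∧
      ∀ j < k, s'.real a (gi i) (gj j) = ∑ k ∈ Finset.range Mk, f i j k)
    (by simp [keepsNat_forLoop, Prog.KeepsNat])
    (fun k s' v h => ⟨⟨h.1.1.setVar (by simp) v, h.1.2⟩,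
      by rw [Memory.setVar_nat_of_ne _ (by simp)]; exact h.2.1, h.2.2⟩)
    (fun k _ s' h => hmj s' h.1.1) ?_ ⟨⟨h₁, h₁'⟩, hv₁, by simp⟩) le_rfl ?_
  swap
  · rintro s' ⟨⟨h, h'⟩, -, h''⟩
    refine ⟨h, fun i' hi' j hj => ?_⟩
    rcases Nat.lt_succ_iff_lt_or_eq.1 hi' with h₀ | rfl
    · exact h' i' h₀ j hj
    · exact h'' j hj
  rintro j hj s₂ ⟨⟨h₂, h₂'⟩, hv₂, h₂''⟩ hw₂
  have hstart : Ends (.letReal 20 (.ofNat (.lit 0))) s₂ 1 fun s' => Agree a W s s' ∧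
      s'.nat 20 0 0 = i ∧ s'.nat 21 0 0 = j ∧ s'.real a = s₂.real a ∧ s'.real 20 0 0 = 0 := by
    refine ends_setReal _ _ _ _ _ ⟨h₂.setAcc ha _ _ _, hv₂, hw₂, write_of_ne _ ha _ _ _, ?_⟩
    simp [write, NExpr.eval, RExpr.eval]
  refine Ends.mono (Ends.seq hstart (U := Mk * 4 + 5) (Q := _) ?_) (by omega) fun _ h => h
  rintro s₃ ⟨h₃, hv₃, hw₃, ha₃, hacc⟩
  have hsum := ends_forLoop (i := 22) (m := mk) (p := .letReal 20 (.plus (.var 20) term)) Mk 1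
    (fun k s' => Agree a W s s' ∧ s'.nat 20 0 0 = i ∧ s'.nat 21 0 0 = j ∧
      s'.real a = s₂.real a ∧ s'.real 20 0 0 = ∑ k ∈ Finset.range k, f i j k)
    (by simp [Prog.KeepsNat])
    (fun k s' v h => ⟨h.1.setVar (by simp) v, by
        rw [Memory.setVar_nat_of_ne _ (by simp)]; exact h.2.1, by
        rw [Memory.setVar_nat_of_ne _ (by simp)]; exact h.2.2.1, h.2.2.2⟩)
    (fun k _ s' h => hmk s' h.1)
    (by
      rintro k hk s' ⟨h, hv, hw, ha', hs⟩ hk'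
      refine ends_setReal _ _ _ _ _ ⟨h.setAcc ha _ _ _, hv, hw,
        (write_of_ne _ ha _ _ _).trans ha', ?_⟩
      have := hterm s' h (by omega) (by omega) (by omega)
      rw [hv, hw, hk'] at this
      simp [write, NExpr.eval, RExpr.eval, hs, this, Finset.sum_range_succ])
    (s := s₃) ⟨h₃, hv₃, hw₃, ha₃, by simp [hacc]⟩
  refine Ends.mono (Ends.seq hsum (U := 1) (Q := _) ?_) (by omega) fun _ h => h
  rintro s₄ ⟨h₄, hv₄, hw₄, ha₄, hs₄⟩
  have er := hri s₄ h₄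
  have ec := hcj s₄ h₄
  rw [hv₄] at er
  rw [hw₄] at ec
  refine ends_setReal _ _ _ _ _ ⟨⟨h₄.setCell ?_ _, ?_⟩, hv₄, ?_⟩
  · rw [er, ec]; exact hW i hi j hj
  · intro i' hi' j' hj'
    have hne : gi i' ≠ gi i := fun h => hi'.ne (hgi h)
    simpa [write, er, hne, ha₄] using h₂' i' hi' j' hj'
  · intro j' hj'
    rcases Nat.lt_succ_iff_lt_or_eq.1 hj' with h₀ | rfl
    · have hne : gj j' ≠ gj j := fun h => h₀.ne (hgj h)
      simpa [write, ec, hne, ha₄] using h₂'' j' h₀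
    · simp [write, er, ec, RExpr.eval, NExpr.eval, hs₄]

end RealRAM

/-! ### Random phases of a run -/

namespace RealRAM

theorem uniform_bind_map {α β γ : Type} [Fintype α] [Nonempty α] [Fintype β] [Nonempty β]
    (h : α → β → γ) :
    ((PMF.uniformOfFintype α).bind fun a => (PMF.uniformOfFintype β).map (h a)) =
      (PMF.uniformOfFintype (α × β)).map fun x => h x.1 x.2 := by
  have key : ((PMF.uniformOfFintype α).bind fun a => (PMF.uniformOfFintype β).map (Prod.mk a)) =
      PMF.uniformOfFintype (α × β) := by
    classical
    ext ⟨a, b⟩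
    rw [PMF.bind_apply, tsum_eq_single a, PMF.map_apply, tsum_eq_single b]
    · simp [ENNReal.mul_inv]
    · intro b' hb'
      rw [if_neg]
      simpa using hb'.symm
    · intro a' ha'
      rw [PMF.map_apply]
      simp [ha'.symm]
  rw [← key, PMF.map_bind]
  congr 1
  funext a
  rw [PMF.map_comp]
  rfl

theorem uniform_map_equiv {α β : Type} [Fintype α] [Nonempty α] [Fintype β] [Nonempty β]
    (e : α ≃ β) : (PMF.uniformOfFintype α).map e = PMF.uniformOfFintype β := by
  classical
  ext b
  rw [PMF.map_apply, tsum_eq_single (e.symm b)]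
  · simp [Fintype.card_congr e]
  · intro a ha
    rw [if_neg]
    rintro rfl
    simp at ha

/-- The program takes exactly `t` steps from the memory `s`, and its final memory is determined by
an outcome that is uniformly distributed on `Ω`; for the outcome `ω` it satisfies `Q ω`. -/
def Yields (p : Prog) (s : Memory) (t : ℕ) (Ω : Type) [Fintype Ω] [Nonempty Ω]
    (Q : Ω → Memory → Prop) : Prop :=
  ∃ g : Ω → Memory,
    (∀ k, runFor ⟨s, p :: k⟩ t = (PMF.uniformOfFintype Ω).map fun ω => ⟨g ω, k⟩) ∧
      ∀ ω, Q ω (g ω)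

section Yields

variable {α β : Type} [Fintype α] [Nonempty α] [Fintype β] [Nonempty β]

theorem Yields.mono {p : Prog} {s : Memory} {t : ℕ} {Q Q' : α → Memory → Prop}
    (h : Yields p s t α Q) (hQ : ∀ ω s', Q ω s' → Q' ω s') : Yields p s t α Q' := by
  obtain ⟨g, hg, hq⟩ := h
  exact ⟨g, hg, fun ω => hQ _ _ (hq ω)⟩

theorem Yields.seq {p q : Prog} {s : Memory} {t u : ℕ} {P : α → Memory → Prop}
    {Q : α → β → Memory → Prop} (hp : Yields p s t α P)
    (hq : ∀ a s', P a s' → Yields q s' u β (Q a)) :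
    Yields (.seq p q) s (1 + t + u) (α × β) fun x => Q x.1 x.2 := by
  obtain ⟨g, hg, hP⟩ := hp
  choose g' hg' hQ using fun a => hq a (g a) (hP a)
  refine ⟨fun x => g' x.1 x.2, fun k => ?_, fun x => hQ x.1 x.2⟩
  rw [add_assoc, runFor_succ_of_step rfl, runFor_add, hg, PMF.bind_map]
  simp only [Function.comp_def, hg']
  exact uniform_bind_map fun a b => (⟨g' a b, k⟩ : Config)

theorem Yields.seq_exec {p q : Prog} {s : Memory} {t u : ℕ} {P Q : α → Memory → Prop}
    (hp : Yields p s t α P) (hq : ∀ a s', P a s' → ∃ s'', Exec q s' u s'' ∧ Q a s'') :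
    Yields (.seq p q) s (1 + t + u) α Q := by
  obtain ⟨g, hg, hP⟩ := hp
  choose g' hg' hQ using fun a => hq a (g a) (hP a)
  refine ⟨g', fun k => ?_, hQ⟩
  rw [add_assoc, runFor_succ_of_step rfl, runFor_add, hg, PMF.bind_map]
  simp only [Function.comp_def, fun a => (hg' a).runFor k]
  rfl

theorem Exec.seq_yields {p q : Prog} {s s₁ : Memory} {t u : ℕ} {Q : α → Memory → Prop}
    (hp : Exec p s t s₁) (hq : Yields q s₁ u α Q) : Yields (.seq p q) s (1 + t + u) α Q := by
  obtain ⟨g, hg, hQ⟩ := hq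
  refine ⟨g, fun k => ?_, hQ⟩
  rw [add_assoc, runFor_succ_of_step rfl, runFor_add, hp.runFor, PMF.pure_bind, hg]

theorem uniformBelow_eq (q : ℕ) [NeZero q] :
    uniformBelow q = (PMF.uniformOfFintype (Fin q)).map fun x : Fin q => (x : ℕ) := by
  cases q with
  | zero => exact absurd rfl (NeZero.ne 0)
  | succ q =>
    -- In `uniformBelow` the coercion to `ℕ` is applied by a monadic bind, before a map by the identity.
    exact PMF.map_id _

theorem yields_draw (s : Memory) (a : ℕ) (i j m : NExpr) (q : ℕ) [NeZero q]
    (hm : m.eval s = q) :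
    Yields (.draw a i j m) s 1 (Fin q) fun v s' =>
      s' = { s with nat := write s.nat a (i.eval s) (j.eval s) (v : ℕ) } := by
  refine ⟨fun v => { s with nat := write s.nat a (i.eval s) (j.eval s) (v : ℕ) },
    fun k => ?_, fun _ => rfl⟩
  rw [runFor_one]
  simp only [step, hm, uniformBelow_eq, PMF.map_comp]
  rfl

/-- A loop whose rounds are random: the outcomes of the rounds are independent. -/
theorem yields_loop {c : Test} {p : Prog} (M τ : ℕ) (I : (k : ℕ) → (Fin k → α) → Memory → Prop)
    (hc : ∀ k ≤ M, ∀ f s, I k f s → (c.Holds s ↔ k < M))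
    (hp : ∀ k < M, ∀ f s, I k f s → Yields p s τ α fun a => I (k + 1) (Fin.snoc f a))
    {s : Memory} (h0 : I 0 Fin.elim0 s) :
    Yields (.loop c p) s (M * (τ + 1) + 1) (Fin M → α) (I M) := by
  have H : ∀ k ≤ M, ∃ g : (Fin k → α) → Memory,
      (∀ l, runFor ⟨s, .loop c p :: l⟩ (k * (τ + 1)) =
        (PMF.uniformOfFintype (Fin k → α)).map fun f => ⟨g f, .loop c p :: l⟩) ∧
      ∀ f, I k f (g f) := by
    intro k
    induction k with
    | zero =>
      intro _
      refine ⟨fun _ => s, fun l => ?_, fun f => ?_⟩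
      · rw [Nat.zero_mul]
        exact (PMF.map_const _ _).symm
      · rwa [Subsingleton.elim f Fin.elim0]
    | succ k ih =>
      intro hk
      obtain ⟨g, hg, hI⟩ := ih (by omega)
      choose g' hg' hI' using fun f => hp k (by omega) f (g f) (hI f)
      refine ⟨fun f => g' (Fin.init f) (f (Fin.last k)), fun l => ?_, fun f => ?_⟩
      · have hstep : ∀ f, runFor ⟨g f, .loop c p :: l⟩ (1 + τ) =
            (PMF.uniformOfFintype α).map fun a => ⟨g' f a, .loop c p :: l⟩ := by
          intro f
          rw [runFor_succ_of_step (c' := ⟨g f, p :: .loop c p :: l⟩), hg']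
          simp only [step, if_pos ((hc k (by omega) f _ (hI f)).2 (by omega))]
        rw [Nat.add_mul, one_mul, add_comm τ 1, runFor_add, add_comm 1 τ, hg, PMF.bind_map]
        simp only [Function.comp_def, add_comm τ 1, hstep]
        rw [uniform_bind_map fun f a => (⟨g' f a, .loop c p :: l⟩ : Config),
          ← uniform_map_equiv ((Equiv.prodComm _ _).trans (Fin.snocEquiv fun _ => α)),
          PMF.map_comp]
        congr 1
        funext x
        simp [Fin.snocEquiv]
      · have h : I (k + 1) (Fin.snoc (Fin.init f) (f (Fin.last k))) _ :=
          hI' (Fin.init f) (f (Fin.last k))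
        rwa [Fin.snoc_init_self f] at h
  obtain ⟨g, hg, hI⟩ := H M le_rfl
  refine ⟨g, fun l => ?_, hI⟩
  rw [runFor_add, hg, PMF.bind_map]
  have hlast : ∀ f, runFor ⟨g f, .loop c p :: l⟩ 1 = PMF.pure ⟨g f, l⟩ := by
    intro f
    rw [runFor_one]
    simp only [step, if_neg (fun h => lt_irrefl M ((hc M le_rfl f _ (hI f)).1 h))]
  simp only [Function.comp_def, hlast]
  rfl

theorem yields_forLoop {i : ℕ} {m : NExpr} {p : Prog} (M τ : ℕ)
    (I : (k : ℕ) → (Fin k → α) → Memory → Prop)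
    (hI : ∀ k f s v, I k f s → I k f (s.setVar i v))
    (hm : ∀ k ≤ M, ∀ f s, I k f s → m.eval s = M)
    (hp : ∀ k < M, ∀ f s, I k f s → s.nat i 0 0 = k →
      Yields p s τ α fun a s' => I (k + 1) (Fin.snoc f a) s' ∧ s'.nat i 0 0 = k)
    {s : Memory} (h0 : I 0 Fin.elim0 s) :
    Yields (.forLoop i m p) s (1 + 1 + (M * (1 + τ + 1 + 1) + 1)) (Fin M → α) (I M) := by
  have h1 : Exec (.letNat i (.lit 0)) s 1 (s.setVar i 0) := .setNat s i _ _ _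
  refine h1.seq_yields (Yields.mono (yields_loop M (1 + τ + 1)
    (fun k f s => I k f s ∧ s.nat i 0 0 = k) ?_ ?_ ⟨hI _ _ _ _ h0, by simp⟩) fun _ _ h => h.1)
  · rintro k hk f s ⟨h, hv⟩
    simp [Test.Holds, NExpr.eval, hv, hm k hk f s h]
  · rintro k hk f s ⟨h, hv⟩
    refine (hp k hk f s h hv).seq_exec ?_
    rintro a s' ⟨h', hv'⟩
    refine ⟨_, .setNat s' i _ _ _, ?_⟩
    simp only [NExpr.eval, hv']
    exact ⟨hI _ _ _ _ h', Memory.setVar_nat_self s' i (k + 1)⟩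

end Yields

/-- Fill the entries `(i, j)` with `i < mi` and `j < mj` of the array `a` with independent uniform
elements of `{0, …, m - 1}`. -/
def Prog.drawTable (a : ℕ) (mi mj m : NExpr) : Prog :=
  .forLoop 20 mi (.forLoop 21 mj (.draw a (.var 20) (.var 21) m))

/-- The running time of `Prog.drawTable`. -/
def drawTime (Mi Mj : ℕ) : ℕ :=
  1 + 1 + (Mi * (1 + (1 + 1 + (Mj * (1 + 1 + 1 + 1) + 1)) + 1 + 1) + 1)

theorem yields_drawTable {a : ℕ} {mi mj m : NExpr} {s : Memory} (Mi Mj q : ℕ) [NeZero q]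
    (ha : a ≠ 20 ∧ a ≠ 21)
    (hm : ∀ s' : Memory, (∀ b, b ≠ 20 → b ≠ 21 → b ≠ a → s'.nat b = s.nat b) →
      mi.eval s' = Mi ∧ mj.eval s' = Mj ∧ m.eval s' = q) :
    Yields (.drawTable a mi mj m) s (drawTime Mi Mj) (Fin Mi → Fin Mj → Fin q) fun ω s' =>
      (∀ (i : Fin Mi) (j : Fin Mj), s'.nat a i j = ω i j) ∧
        (∀ b, b ≠ 20 → b ≠ 21 → b ≠ a → s'.nat b = s.nat b) ∧ s'.real = s.real := by
  obtain ⟨ha₀, ha₁⟩ := ha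
  refine yields_forLoop (α := Fin Mj → Fin q) Mi _
    (fun k f s' => (∀ (i : Fin k) (j : Fin Mj), s'.nat a i j = f i j) ∧
        (∀ b, b ≠ 20 → b ≠ 21 → b ≠ a → s'.nat b = s.nat b) ∧ s'.real = s.real) ?_ ?_ ?_ ?_
  · rintro k f s' v ⟨h, h', h''⟩
    refine ⟨fun i j => ?_, fun b h₀ h₁ h₂ => ?_, h''⟩
    · rw [Memory.setVar_nat_of_ne _ ha₀, h]
    · rw [Memory.setVar_nat_of_ne _ h₀, h' b h₀ h₁ h₂]
  · rintro k - f s' ⟨-, h', -⟩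
    exact (hm s' h').1
  · rintro k hk f s₁ ⟨h₁, h₁', h₁''⟩ hv
    refine Yields.mono (yields_forLoop (α := Fin q) Mj 1
      (fun l g s' => ((∀ (i : Fin k) (j : Fin Mj), s'.nat a i j = f i j) ∧
        (∀ b, b ≠ 20 → b ≠ 21 → b ≠ a → s'.nat b = s.nat b) ∧ s'.real = s.real) ∧
        (∀ j : Fin l, s'.nat a k j = g j) ∧ s'.nat 20 0 0 = k) ?_ ?_ ?_ ?_) ?_
    · rintro l g s' v ⟨⟨h, h', h''⟩, hg, hk⟩
      refine ⟨⟨fun i j => ?_, fun b h₀ h₁ h₂ => ?_, h''⟩, fun j => ?_, ?_⟩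
      · rw [Memory.setVar_nat_of_ne _ ha₁, h]
      · rw [Memory.setVar_nat_of_ne _ h₁, h' b h₀ h₁ h₂]
      · rw [Memory.setVar_nat_of_ne _ ha₁, hg]
      · rw [Memory.setVar_nat_of_ne _ (by simp), hk]
    · rintro l - g s' ⟨⟨-, h', -⟩, -⟩
      exact (hm s' h').2.1
    · rintro l hl g s₂ ⟨⟨h₂, h₂', h₂''⟩, hg, hk₂⟩ hl₂
      refine Yields.mono (yields_draw s₂ a _ _ _ q (hm s₂ h₂').2.2) ?_
      rintro v _ rfl
      simp only [NExpr.eval, hk₂, hl₂]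
      refine ⟨⟨⟨fun i j => ?_, fun b h₀ h₁ h₂ => ?_, h₂''⟩, fun j => ?_, ?_⟩, ?_⟩
      · have hi : (i : ℕ) ≠ k := i.isLt.ne
        simp [write, hi, h₂]
      · rw [write_of_ne _ h₂, h₂' b h₀ h₁ h₂]
      · refine Fin.lastCases ?_ (fun j => ?_) j
        · simp [write]
        · have hj : (j : ℕ) ≠ l := j.isLt.ne
          simp [write, hj, hg]
      · rw [write_of_ne _ (Ne.symm ha₀), hk₂]
      · rw [write_of_ne _ (Ne.symm ha₁), hl₂]
    · exact ⟨⟨h₁, h₁', h₁''⟩, fun j => j.elim0, hv⟩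
    · rintro g s' ⟨⟨h, h', h''⟩, hg, hk⟩
      refine ⟨⟨fun i j => ?_, h', h''⟩, hk⟩
      refine Fin.lastCases ?_ (fun i => ?_) i
      · simp [hg]
      · simp [h]
  · exact ⟨fun i => i.elim0, fun _ _ _ _ => rfl, rfl⟩

end RealRAM

/-! ### Gram–Schmidt orthogonalization of the standard basis -/

namespace Leverage

/-- The entries of a matrix, extended by zero to all pairs of natural numbers. -/
noncomputable def entry {r d : ℕ} (B : Matrix (Fin r) (Fin d) ℝ) (i j : ℕ) : ℝ :=
  if h : i < r ∧ j < d then B ⟨i, h.1⟩ ⟨j, h.2⟩ else 0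

@[simp] theorem entry_val {r d : ℕ} (B : Matrix (Fin r) (Fin d) ℝ) (i : Fin r) (j : Fin d) :
    entry B i j = B i j := by
  simp [entry]

/-- The matrix of inner products of the columns of `b`, taken over the first `r` rows. -/
noncomputable def gram (r : ℕ) (b : ℕ → ℕ → ℝ) (i j : ℕ) : ℝ :=
  ∑ t ∈ Finset.range r, b t i * b t j

/-- The inner product, with respect to the form `G`, of column `k` of `T` and the `j`-th standard
basis vector. -/
noncomputable def gsCoeff (d : ℕ) (G T : ℕ → ℕ → ℝ) (j k : ℕ) : ℝ :=
  ∑ i ∈ Finset.range d, T i k * G i j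

/-- The part of the `j`-th standard basis vector that remains after the subtraction of its
components along the first `j` columns of `T`. -/
noncomputable def gsResidual (d : ℕ) (G T : ℕ → ℕ → ℝ) (j i : ℕ) : ℝ :=
  (if i = j then 1 else 0) - ∑ k ∈ Finset.range j, gsCoeff d G T j k * T i k

/-- The squared length of the residual with respect to the form `G`. -/
noncomputable def gsNormSq (d : ℕ) (G T : ℕ → ℕ → ℝ) (j : ℕ) : ℝ :=
  ∑ i ∈ Finset.range d, gsResidual d G T j i *
    ∑ l ∈ Finset.range d, G i l * gsResidual d G T j l

/-- The first `m` columns of the orthonormalization of the standard basis with respect to the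
form `G` on `ℝ ^ d`. -/
noncomputable def gs (d : ℕ) (G : ℕ → ℕ → ℝ) : ℕ → ℕ → ℕ → ℝ
  | 0 => fun _ _ => 0
  | m + 1 => fun i k =>
      if k = m then gsResidual d G (gs d G m) m i / √(gsNormSq d G (gs d G m) m)
      else gs d G m i k

/-- The orthogonalizer that the program computes: Gram–Schmidt on the standard basis with respect
to the form `Bᵀ B`.  Divisions by zero, which occur only if `B` has dependent columns, return
zero. -/
noncomputable def gsOrth (r d : ℕ) (B : Matrix (Fin r) (Fin d) ℝ) : Matrix (Fin d) (Fin d) ℝ :=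
  Matrix.of fun i j => gs d (gram r (entry B)) d i j

/-- The image of the vector `x` under the first `d` columns of `b`. -/
noncomputable def app (d : ℕ) (b : ℕ → ℕ → ℝ) (x : ℕ → ℝ) (t : ℕ) : ℝ :=
  ∑ i ∈ Finset.range d, b t i * x i

/-- The inner product of the images of `x` and `y`. -/
noncomputable def appInner (r d : ℕ) (b : ℕ → ℕ → ℝ) (x y : ℕ → ℝ) : ℝ :=
  ∑ t ∈ Finset.range r, app d b x t * app d b y t

section GramSchmidt

variable (r d : ℕ) (b : ℕ → ℕ → ℝ)

theorem sum_mul_gram (x : ℕ → ℝ) (j : ℕ) :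
    ∑ i ∈ Finset.range d, x i * gram r b i j = ∑ t ∈ Finset.range r, app d b x t * b t j := by
  simp only [gram, app, Finset.mul_sum, Finset.sum_mul]
  rw [Finset.sum_comm]
  exact Finset.sum_congr rfl fun _ _ => Finset.sum_congr rfl fun _ _ => by ring

theorem appInner_eq (x y : ℕ → ℝ) :
    appInner r d b x y =
      ∑ i ∈ Finset.range d, x i * ∑ l ∈ Finset.range d, gram r b i l * y l := by
  have h : ∀ i, x i * ∑ l ∈ Finset.range d, gram r b i l * y l =
      ∑ l ∈ Finset.range d, (x i * gram r b i l) * y l := fun i => by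
    rw [Finset.mul_sum]; exact Finset.sum_congr rfl fun _ _ => by ring
  simp only [h]
  rw [Finset.sum_comm]
  simp only [← Finset.sum_mul, sum_mul_gram]
  simp only [appInner, Finset.sum_mul]
  rw [Finset.sum_comm]
  refine Finset.sum_congr rfl fun t _ => ?_
  conv_lhs => rw [app.eq_def d b y, Finset.mul_sum]
  exact Finset.sum_congr rfl fun _ _ => by ring

theorem appInner_comm (x y : ℕ → ℝ) : appInner r d b x y = appInner r d b y x :=
  Finset.sum_congr rfl fun _ _ => mul_comm _ _

theorem appInner_single (x : ℕ → ℝ) {j : ℕ} (hj : j < d) :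
    appInner r d b x (fun i => if i = j then 1 else 0) =
      ∑ i ∈ Finset.range d, x i * gram r b i j := by
  rw [appInner_eq]
  refine Finset.sum_congr rfl fun i _ => ?_
  simp [hj]

theorem appInner_sub_sum (x y : ℕ → ℝ) (m : ℕ) (c : ℕ → ℝ) (z : ℕ → ℕ → ℝ) :
    appInner r d b x (fun i => y i - ∑ k ∈ Finset.range m, c k * z i k) =
      appInner r d b x y - ∑ k ∈ Finset.range m, c k * appInner r d b x (fun i => z i k) := by
  have h : ∀ t, app d b (fun i => y i - ∑ k ∈ Finset.range m, c k * z i k) t =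
      app d b y t - ∑ k ∈ Finset.range m, c k * app d b (fun i => z i k) t := by
    intro t
    simp only [app, mul_sub, Finset.sum_sub_distrib, Finset.mul_sum]
    congr 1
    rw [Finset.sum_comm]
    exact Finset.sum_congr rfl fun _ _ => Finset.sum_congr rfl fun _ _ => by ring
  simp only [appInner, h, mul_sub, Finset.sum_sub_distrib, Finset.mul_sum]
  congr 1
  rw [Finset.sum_comm]
  exact Finset.sum_congr rfl fun _ _ => Finset.sum_congr rfl fun _ _ => by ring

theorem appInner_div (x y : ℕ → ℝ) (c : ℝ) :
    appInner r d b x (fun i => y i / c) = appInner r d b x y / c := by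
  have h : ∀ t, app d b (fun i => y i / c) t = app d b y t / c := fun t => by
    simp only [app, Finset.sum_div, mul_div_assoc]
  simp only [appInner, h, Finset.sum_div, mul_div_assoc]

/-- The columns computed so far are orthonormal for the form `Bᵀ B` and upper triangular.  The
residual of the `m`-th basis vector has a one in position `m`, so it does not vanish and, as `b` is
injective, has positive length. -/
theorem gs_orthonormal
    (hb : ∀ x : ℕ → ℝ, (∀ t < r, app d b x t = 0) → ∀ i < d, x i = 0) (m : ℕ) (hm : m ≤ d) :
    (∀ k < m, ∀ l < m, appInner r d b (fun i => gs d (gram r b) m i k)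
      (fun i => gs d (gram r b) m i l) = if k = l then 1 else 0) ∧
    ∀ k < m, ∀ i, k < i → gs d (gram r b) m i k = 0 := by
  induction m with
  | zero => simp
  | succ m ih =>
    obtain ⟨ho, ht⟩ := ih (by omega)
    set T := gs d (gram r b) m with hT
    set u := gsResidual d (gram r b) T m with hu
    set ν := gsNormSq d (gram r b) T m with hν
    have hold : ∀ k < m, (fun i => gs d (gram r b) (m + 1) i k) = fun i => T i k := by
      intro k hk
      funext i
      simp [gs, hk.ne, hT]
    have hnew : (fun i => gs d (gram r b) (m + 1) i m) = fun i => u i / √ν := by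
      funext i
      simp [gs, ← hT, hu, hν]
    have hum : u m = 1 := by
      rw [hu, gsResidual, if_pos rfl, Finset.sum_eq_zero, sub_zero]
      intro k hk
      rw [ht k (Finset.mem_range.1 hk) m (Finset.mem_range.1 hk), mul_zero]
    have hui : ∀ i, m < i → u i = 0 := by
      intro i hi
      rw [hu, gsResidual, if_neg hi.ne', Finset.sum_eq_zero, sub_zero]
      intro k hk
      rw [ht k (Finset.mem_range.1 hk) i ((Finset.mem_range.1 hk).trans hi), mul_zero]
    have hνu : ν = appInner r d b u u := (appInner_eq r d b u u).symm
    have hpos : 0 < ν := by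
      have h0 : 0 ≤ ν := by
        rw [hνu]; exact Finset.sum_nonneg fun _ _ => mul_self_nonneg _
      refine lt_of_le_of_ne h0 fun h => ?_
      rw [hνu, eq_comm, appInner, Finset.sum_eq_zero_iff_of_nonneg
        fun _ _ => mul_self_nonneg _] at h
      have := hb u (fun t h' => mul_self_eq_zero.1 (h t (Finset.mem_range.2 h'))) m (by omega)
      rw [hum] at this
      exact one_ne_zero this
    have horth : ∀ l < m, appInner r d b (fun i => T i l) u = 0 := by
      intro l hl
      have : u = fun i => (if i = m then 1 else 0) -
          ∑ k ∈ Finset.range m, gsCoeff d (gram r b) T m k * T i k := rfl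
      rw [this, appInner_sub_sum, appInner_single r d b _ (by omega),
        Finset.sum_eq_single_of_mem l (Finset.mem_range.2 hl)]
      · rw [ho l hl l hl, if_pos rfl, mul_one]
        exact sub_self _
      · intro k hk hkl
        rw [ho l hl k (Finset.mem_range.1 hk), if_neg hkl.symm, mul_zero]
    constructor
    · intro k hk l hl
      rcases Nat.lt_succ_iff_lt_or_eq.1 hk with hk | rfl <;>
        rcases Nat.lt_succ_iff_lt_or_eq.1 hl with hl | rfl
      · rw [hold k hk, hold l hl, ho k hk l hl]
      · rw [hold k hk, hnew, appInner_div, horth k hk, zero_div, if_neg hk.ne]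
      · rw [hold l hl, hnew, appInner_comm, appInner_div, horth l hl, zero_div, if_neg hl.ne']
      · rw [hnew, appInner_div, appInner_comm, appInner_div, ← hνu, if_pos rfl, div_div,
          Real.mul_self_sqrt hpos.le, div_self hpos.ne']
    · intro k hk i hi
      rcases Nat.lt_succ_iff_lt_or_eq.1 hk with hk | rfl
      · rw [congrFun (hold k hk) i, ht k hk i hi]
      · rw [congrFun hnew i, hui i hi, zero_div]

end GramSchmidt

theorem mulVec_eq_zero_of_rank {r d : ℕ} {B : Matrix (Fin r) (Fin d) ℝ} (hB : B.rank = d)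
    {x : Fin d → ℝ} (hx : B *ᵥ x = 0) : x = 0 := by
  have h := LinearMap.finrank_range_add_finrank_ker B.mulVecLin
  have h' : Module.finrank ℝ (LinearMap.range B.mulVecLin) = d := hB
  rw [h', Module.finrank_fin_fun] at h
  have hk : LinearMap.ker B.mulVecLin = ⊥ := Submodule.finrank_eq_zero.1 (by omega)
  exact LinearMap.ker_eq_bot'.1 hk x hx

theorem isOrthogonalizer_gsOrth : IsOrthogonalizer gsOrth := by
  intro r d B hB
  have hb : ∀ x : ℕ → ℝ, (∀ t < r, app d (entry B) x t = 0) → ∀ i < d, x i = 0 := by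
    intro x hx i hi
    have : (fun i : Fin d => x i) = 0 := by
      refine mulVec_eq_zero_of_rank hB ?_
      funext t
      have := hx t t.isLt
      rw [app, Finset.sum_range] at this
      simpa [Matrix.mulVec, dotProduct] using this
    exact congrFun this ⟨i, hi⟩
  have h := (gs_orthonormal r d (entry B) hb d le_rfl).1
  ext k l
  have hkl := h k k.isLt l l.isLt
  simp only [appInner, app, Finset.sum_range, entry_val] at hkl
  rw [Matrix.mul_apply]
  simp only [Matrix.transpose_apply, Matrix.mul_apply, gsOrth, Matrix.of_apply, hkl,
    Matrix.one_apply, Fin.ext_iff]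

end Leverage

/-! ### The Hadamard matrix and its fast transform -/

namespace Leverage

theorem hadamardEntry_sq (k i j : ℕ) : hadamardEntry k i j ^ 2 = 1 := by
  induction k generalizing i j with
  | zero => simp [hadamardEntry]
  | succ k ih =>
    rw [hadamardEntry, mul_pow, ih]
    split_ifs <;> norm_num

theorem hadamardEntry_succ_left (k i : ℕ) {j : ℕ} (hj : j < 2 ^ k) :
    hadamardEntry (k + 1) i j = hadamardEntry k (i % 2 ^ k) j := by
  rw [hadamardEntry, if_neg (by omega), one_mul, Nat.mod_eq_of_lt hj]

theorem hadamardEntry_succ_right (k i : ℕ) {j : ℕ} (hj : j < 2 ^ k) :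
    hadamardEntry (k + 1) i (2 ^ k + j) =
      (if 2 ^ k ≤ i then -1 else 1) * hadamardEntry k (i % 2 ^ k) j := by
  rw [hadamardEntry, Nat.add_mod_left, Nat.mod_eq_of_lt hj]
  simp

theorem sum_hadamardEntry (k : ℕ) {i i' : ℕ} (hi : i < 2 ^ k) (hi' : i' < 2 ^ k) :
    ∑ j ∈ Finset.range (2 ^ k), hadamardEntry k i j * hadamardEntry k i' j =
      if i = i' then 2 ^ k else 0 := by
  induction k generalizing i i' with
  | zero =>
    have h : i = 0 := by simpa using hi
    have h' : i' = 0 := by simpa using hi'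
    simp [h, h', hadamardEntry]
  | succ k ih =>
    have hp : 2 ^ (k + 1) = 2 ^ k + 2 ^ k := by ring
    have hm : i % 2 ^ k < 2 ^ k := Nat.mod_lt _ (by positivity)
    have hm' : i' % 2 ^ k < 2 ^ k := Nat.mod_lt _ (by positivity)
    have e₁ : ∑ j ∈ Finset.range (2 ^ k), hadamardEntry (k + 1) i j * hadamardEntry (k + 1) i' j =
        if i % 2 ^ k = i' % 2 ^ k then 2 ^ k else 0 := by
      rw [← ih hm hm']
      refine Finset.sum_congr rfl fun j hj => ?_
      rw [hadamardEntry_succ_left k i (Finset.mem_range.1 hj),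
        hadamardEntry_succ_left k i' (Finset.mem_range.1 hj)]
    have e₂ : ∑ j ∈ Finset.range (2 ^ k), hadamardEntry (k + 1) i (2 ^ k + j) *
          hadamardEntry (k + 1) i' (2 ^ k + j) =
        (if 2 ^ k ≤ i then -1 else 1) * (if 2 ^ k ≤ i' then -1 else 1) *
          if i % 2 ^ k = i' % 2 ^ k then 2 ^ k else 0 := by
      rw [← ih hm hm', Finset.mul_sum]
      refine Finset.sum_congr rfl fun j hj => ?_
      rw [hadamardEntry_succ_right k i (Finset.mem_range.1 hj),
        hadamardEntry_succ_right k i' (Finset.mem_range.1 hj)]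
      ring
    have hmod : ∀ x, x < 2 ^ (k + 1) → x % 2 ^ k = if 2 ^ k ≤ x then x - 2 ^ k else x := by
      intro x hx
      split_ifs with h
      · rw [Nat.mod_eq_sub_mod h, Nat.mod_eq_of_lt (by omega)]
      · rw [Nat.mod_eq_of_lt (by omega)]
    rw [hp, Finset.sum_range_add, e₁, e₂, hmod i hi, hmod i' hi']
    have hp' : (2 : ℝ) ^ (k + 1) = 2 ^ k + 2 ^ k := by ring
    rw [hp']
    by_cases h : 2 ^ k ≤ i <;> by_cases h' : 2 ^ k ≤ i' <;> simp only [h, h', if_true, if_false]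
    · have : (i - 2 ^ k = i' - 2 ^ k) ↔ i = i' := by omega
      simp only [this]; split_ifs <;> ring
    · have : i ≠ i' := by omega
      rw [if_neg this]; ring
    · have : i ≠ i' := by omega
      rw [if_neg this]; ring
    · split_ifs <;> ring

theorem hadamard_mul_transpose (k : ℕ) : hadamard k * (hadamard k)ᵀ = 1 := by
  ext a b
  have h : ∀ j : Fin (2 ^ k), hadamard k a j * (hadamard k)ᵀ j b =
      hadamardEntry k a j * hadamardEntry k b j / 2 ^ k := by
    intro j
    rw [Matrix.transpose_apply, hadamard, Matrix.of_apply, Matrix.of_apply, div_mul_div_comm,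
      Real.mul_self_sqrt (by positivity)]
  rw [Matrix.mul_apply, Finset.sum_congr rfl fun j _ => h j, ← Finset.sum_div,
    ← Finset.sum_range fun j => hadamardEntry k a j * hadamardEntry k b j,
    sum_hadamardEntry k a.isLt b.isLt, Matrix.one_apply]
  simp only [Fin.ext_iff]
  split_ifs
  · exact div_self (by positivity)
  · exact zero_div _

theorem transpose_hadamard_mul (k : ℕ) : (hadamard k)ᵀ * hadamard k = 1 :=
  mul_eq_one_comm.1 (hadamard_mul_transpose k)

/-- The block recursion for the lowest instead of the highest binary digit. -/
theorem hadamardEntry_bit (k : ℕ) {i j : ℕ} (c e : ℕ) (hi : i < 2 ^ k) (hj : j < 2 ^ k)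
    (hc : c < 2) (he : e < 2) :
    hadamardEntry (k + 1) (2 * i + c) (2 * j + e) =
      (if c = 1 ∧ e = 1 then -1 else 1) * hadamardEntry k i j := by
  induction k generalizing i j with
  | zero =>
    have h : i = 0 := by simpa using hi
    have h' : j = 0 := by simpa using hj
    subst h h'
    have h₁ : (1 ≤ c ∧ 1 ≤ e) ↔ (c = 1 ∧ e = 1) := by omega
    simp [hadamardEntry, h₁]
  | succ k ih =>
    have hmod : ∀ x c, c < 2 → (2 * x + c) % 2 ^ (k + 1) = 2 * (x % 2 ^ k) + c := by
      intro x c hc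
      have h₁ := Nat.div_add_mod x (2 ^ k)
      have h₂ : x % 2 ^ k < 2 ^ k := Nat.mod_lt _ (by positivity)
      have h₃ : 2 * x + c = (2 * (x % 2 ^ k) + c) + 2 ^ (k + 1) * (x / 2 ^ k) := by
        rw [pow_succ]; nlinarith
      rw [h₃, Nat.add_mul_mod_self_left, Nat.mod_eq_of_lt]
      rw [pow_succ]; omega
    have hle : ∀ x c, c < 2 → (2 ^ (k + 1) ≤ 2 * x + c ↔ 2 ^ k ≤ x) := by
      intro x c hc
      rw [pow_succ]; omega
    rw [hadamardEntry, hmod i c hc, hmod j e he,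
      ih (Nat.mod_lt _ (by positivity)) (Nat.mod_lt _ (by positivity)), hadamardEntry]
    simp only [hle i c hc, hle j e he]
    ring

theorem sum_range_two_mul (n : ℕ) (f : ℕ → ℝ) :
    ∑ b ∈ Finset.range (2 * n), f b = ∑ b ∈ Finset.range n, (f (2 * b) + f (2 * b + 1)) := by
  induction n with
  | zero => simp
  | succ n ih =>
    rw [Nat.mul_succ, Finset.sum_range_succ, Finset.sum_range_succ, ih, Finset.sum_range_succ,
      add_assoc]

/-- The fast Hadamard transform with constant geometry: `K + 1` levels of the same butterfly
`y (2 i) = x i + x (i + M)`, `y (2 i + 1) = x i - x (i + M)` with `M = 2 ^ K` multiply a vector by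
the unnormalized Hadamard matrix.  After `l` levels the entry `h * 2 ^ l + a` is the transform of
size `2 ^ l`, at position `a`, of the entries with indices congruent to `h`. -/
theorem fast_hadamard (K : ℕ) (y : ℕ → ℕ → ℝ)
    (h₀ : ∀ l < K + 1, ∀ i < 2 ^ K, y (l + 1) (2 * i) = y l i + y l (i + 2 ^ K))
    (h₁ : ∀ l < K + 1, ∀ i < 2 ^ K, y (l + 1) (2 * i + 1) = y l i - y l (i + 2 ^ K))
    {a : ℕ} (ha : a < 2 ^ (K + 1)) :
    y (K + 1) a = ∑ b ∈ Finset.range (2 ^ (K + 1)), hadamardEntry (K + 1) a b * y 0 b := by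
  have H : ∀ l m, l + m = K + 1 → ∀ h < 2 ^ m, ∀ a < 2 ^ l, y l (h * 2 ^ l + a) =
      ∑ b ∈ Finset.range (2 ^ l), hadamardEntry l a b * y 0 (b * 2 ^ m + h) := by
    intro l
    induction l with
    | zero =>
      intro m _ h _ a ha
      have : a = 0 := by simpa using ha
      simp [this, hadamardEntry]
    | succ l ih =>
      intro m hm h hh a ha
      obtain ⟨a', c, hc, rfl⟩ : ∃ a' c, c < 2 ∧ a = 2 * a' + c :=
        ⟨a / 2, a % 2, Nat.mod_lt _ (by norm_num), by omega⟩
      have ha' : a' < 2 ^ l := by rw [pow_succ] at ha; omega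
      have hK : 2 ^ K = 2 ^ m * 2 ^ l := by rw [← pow_add]; congr 1; omega
      have hi : h * 2 ^ l + a' < 2 ^ K := by
        have : (h + 1) * 2 ^ l ≤ 2 ^ m * 2 ^ l := Nat.mul_le_mul_right _ hh
        rw [hK]; nlinarith
      have hs : h * 2 ^ l + a' + 2 ^ K = (h + 2 ^ m) * 2 ^ l + a' := by rw [hK]; ring
      have i₀ := ih (m + 1) (by omega) h (by rw [pow_succ]; omega) a' ha'
      have i₁ := ih (m + 1) (by omega) (h + 2 ^ m) (by rw [pow_succ]; omega) a' ha'
      have hb : ∀ b, b * 2 ^ (m + 1) = 2 * b * 2 ^ m := fun b => by ring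
      have hb' : ∀ b, b * 2 ^ (m + 1) + (h + 2 ^ m) = (2 * b + 1) * 2 ^ m + h := fun b => by ring
      rw [pow_succ' 2 l, sum_range_two_mul]
      have hx : ∀ b ∈ Finset.range (2 ^ l), ∀ e < 2,
          hadamardEntry (l + 1) (2 * a' + c) (2 * b + e) =
            (if c = 1 ∧ e = 1 then -1 else 1) * hadamardEntry l a' b := fun b hb e he =>
        hadamardEntry_bit l c e ha' (Finset.mem_range.1 hb) hc he
      rcases (by omega : c = 0 ∨ c = 1) with rfl | rfl
      · have e : h * (2 * 2 ^ l) + (2 * a' + 0) = 2 * (h * 2 ^ l + a') := by ring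
        rw [e, h₀ l (by omega) _ hi, hs, i₀, i₁, ← Finset.sum_add_distrib]
        refine Finset.sum_congr rfl fun b hbm => ?_
        have x₀ := hx b hbm 0 (by norm_num)
        have x₁ := hx b hbm 1 (by norm_num)
        simp only [add_zero] at x₀ x₁ ⊢
        rw [x₀, x₁, hb', hb]
        norm_num
      · have e : h * (2 * 2 ^ l) + (2 * a' + 1) = 2 * (h * 2 ^ l + a') + 1 := by ring
        rw [e, h₁ l (by omega) _ hi, hs, i₀, i₁, ← Finset.sum_sub_distrib]
        refine Finset.sum_congr rfl fun b hbm => ?_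
        have x₀ := hx b hbm 0 (by norm_num)
        have x₁ := hx b hbm 1 (by norm_num)
        simp only [add_zero] at x₀
        rw [x₀, x₁, hb', hb]
        norm_num [sub_eq_add_neg]
  simpa using H (K + 1) 0 rfl 0 (by norm_num) a ha

end Leverage

/-! ### Averages over finite sample spaces -/

namespace Leverage

open Finset
open scoped BigOperators

theorem expect_pow_le {α : Type*} [Fintype α] [Nonempty α] (f : α → ℝ) (hf : ∀ a, 0 ≤ f a)
    (n : ℕ) : (𝔼 a, f a) ^ n ≤ 𝔼 a, f a ^ n := by
  have h := Real.pow_arith_mean_le_arith_mean_pow (univ : Finset α)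
    (fun _ => (Fintype.card α : ℝ)⁻¹) f (fun _ _ => by positivity)
    (by simp) (fun a _ => hf a) n
  simpa only [Fintype.expect_eq_sum_div_card, ← mul_sum, div_eq_inv_mul] using h

theorem expect_prod_apply {ι α : Type*} [Fintype ι] [DecidableEq ι] [Fintype α] (f : ι → α → ℝ) :
    𝔼 s : ι → α, ∏ t, f t (s t) = ∏ t, 𝔼 a, f t a := by
  simp only [Fintype.expect_eq_sum_div_card, prod_div_distrib, prod_const, Fintype.card_fun,
    Nat.cast_pow, prod_univ_sum, Fintype.piFinset_univ, card_univ]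

theorem sum_fun_apply {ι α E : Type*} [Fintype ι] [DecidableEq ι] [Fintype α] [AddCommMonoid E]
    (t : ι) (f : α → E) :
    ∑ s : ι → α, f (s t) = Fintype.card ({j // j ≠ t} → α) • ∑ a, f a := by
  rw [← (Equiv.funSplitAt t α).symm.sum_comp, Fintype.sum_prod_type]
  simp [Equiv.funSplitAt, sum_const, smul_sum]

theorem card_fun_eq {ι α : Type*} [Fintype ι] [DecidableEq ι] [Fintype α] (t : ι) :
    Fintype.card (ι → α) = Fintype.card ({j // j ≠ t} → α) * Fintype.card α := by
  rw [Fintype.card_congr (Equiv.funSplitAt t α), Fintype.card_prod, mul_comm]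

/-- The sign `±1` that encodes a Boolean. -/
def sgn (b : Bool) : ℝ := if b then 1 else -1

theorem sgn_not (b : Bool) : sgn (!b) = -sgn b := by cases b <;> simp [sgn]

theorem sgn_mul_self (b : Bool) : sgn b * sgn b = 1 := by cases b <;> simp [sgn]

/-- Changing one sign is a bijection of the sign patterns. -/
def flipAt {ι : Type*} [DecidableEq ι] (t : ι) : (ι → Bool) ≃ (ι → Bool) where
  toFun b := Function.update b t (!b t)
  invFun b := Function.update b t (!b t)
  left_inv b := by simp
  right_inv b := by simp

/-! ### A noncommutative Khintchine inequality -/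

section Khintchine

variable {d : ℕ}

theorem exists_diagonalization {Z : Matrix (Fin d) (Fin d) ℝ} (hZ : Z.IsHermitian) :
    ∃ (U : Matrix (Fin d) (Fin d) ℝ) (l : Fin d → ℝ), Uᵀ * U = 1 ∧ U * Uᵀ = 1 ∧
      ∀ q, Z ^ q = U * Matrix.diagonal (fun i => l i ^ q) * Uᵀ := by
  set U : Matrix (Fin d) (Fin d) ℝ := hZ.eigenvectorUnitary.1 with hU
  have h₁ : Uᵀ * U = 1 := by
    have := Unitary.coe_star_mul_self hZ.eigenvectorUnitary
    rwa [Matrix.star_eq_conjTranspose, Matrix.conjTranspose_eq_transpose_of_trivial] at this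
  have h₂ : U * Uᵀ = 1 := mul_eq_one_comm.1 h₁
  have h₃ : Z = U * Matrix.diagonal hZ.eigenvalues * Uᵀ := by
    have := hZ.spectral_theorem
    rw [Unitary.conjStarAlgAut_apply, Matrix.star_eq_conjTranspose,
      Matrix.conjTranspose_eq_transpose_of_trivial] at this
    exact this
  clear_value U
  refine ⟨U, hZ.eigenvalues, h₁, h₂, fun q => ?_⟩
  generalize hZ.eigenvalues = l at h₃ ⊢
  induction q with
  | zero => simp [h₂]
  | succ q ih =>
    rw [pow_succ, ih]
    conv_lhs => rw [h₃]
    calc U * Matrix.diagonal (fun i => l i ^ q) * Uᵀ *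
          (U * Matrix.diagonal l * Uᵀ)
        = U * Matrix.diagonal (fun i => l i ^ q) * (Uᵀ * U) *
          Matrix.diagonal l * Uᵀ := by simp only [Matrix.mul_assoc]
      _ = _ := by
        rw [h₁, Matrix.mul_one, Matrix.mul_assoc U, Matrix.diagonal_mul_diagonal]
        simp only [pow_succ]

/-- In terms of the entries of `A` between an eigenbasis of `Z` and one of `W`, the trace is a
nonnegative combination of products of powers of eigenvalues.  The coefficients do not depend on the
exponents. -/
theorem trace_mul_pow_mul_pow {A Z W : Matrix (Fin d) (Fin d) ℝ} (hA : Aᵀ = A)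
    (hZ : Z.IsHermitian) (hW : W.IsHermitian) :
    ∃ (l μ : Fin d → ℝ) (c : Fin d → Fin d → ℝ), (∀ i j, 0 ≤ c i j) ∧
      ∀ q s, (A * Z ^ q * A * W ^ s).trace = ∑ j, ∑ i, c i j * (l i ^ q * μ j ^ s) := by
  obtain ⟨U, l, -, -, hU⟩ := exists_diagonalization hZ
  obtain ⟨V, μ, -, -, hV⟩ := exists_diagonalization hW
  refine ⟨l, μ, fun i j => (Uᵀ * A * V) i j ^ 2, fun i j => sq_nonneg _, fun q s => ?_⟩
  have hM : (Uᵀ * A * V)ᵀ = Vᵀ * A * U := by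
    simp [Matrix.transpose_mul, hA, Matrix.mul_assoc]
  have e : (A * Z ^ q * A * W ^ s).trace =
      ((Uᵀ * A * V)ᵀ * Matrix.diagonal (fun i => l i ^ q) * (Uᵀ * A * V) *
        Matrix.diagonal (fun i => μ i ^ s)).trace := by
    rw [hU, hV, hM, ← Matrix.mul_assoc (A * _ * A), Matrix.trace_mul_comm]
    simp only [Matrix.mul_assoc]
  rw [e, Matrix.trace]
  refine sum_congr rfl fun j _ => ?_
  rw [Matrix.diag_apply, Matrix.mul_diagonal, Matrix.mul_apply, sum_mul]
  refine sum_congr rfl fun i _ => ?_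
  rw [Matrix.mul_diagonal, Matrix.transpose_apply]
  ring

theorem pow_mul_pow_add_le (x y : ℝ) {q s m : ℕ} (h : q + s = 2 * m) :
    x ^ q * y ^ s + x ^ s * y ^ q ≤ x ^ (2 * m) + y ^ (2 * m) := by
  have h₁ : ∀ q s : ℕ, x ^ q * y ^ s ≤ |x| ^ q * |y| ^ s := fun q s => by
    rw [← abs_pow, ← abs_pow, ← abs_mul]; exact le_abs_self _
  have h₂ : 0 ≤ (|x| ^ q - |y| ^ q) * (|x| ^ s - |y| ^ s) := by
    rcases le_total |x| |y| with h | h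
    · exact mul_nonneg_of_nonpos_of_nonpos
        (sub_nonpos.2 (pow_le_pow_left₀ (abs_nonneg _) h _))
        (sub_nonpos.2 (pow_le_pow_left₀ (abs_nonneg _) h _))
    · exact mul_nonneg
        (sub_nonneg.2 (pow_le_pow_left₀ (abs_nonneg _) h _))
        (sub_nonneg.2 (pow_le_pow_left₀ (abs_nonneg _) h _))
  have h₃ : ∀ z : ℝ, |z| ^ q * |z| ^ s = z ^ (2 * m) := fun z => by
    rw [← pow_add, h, pow_mul, sq_abs, ← pow_mul]
  have := h₁ q s
  have := h₁ s q
  have := h₃ x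
  have := h₃ y
  nlinarith

/-- In eigenbases of `Z` and `W` this is `pow_mul_pow_add_le`. -/
theorem trace_mul_pow_add_le {A Z W : Matrix (Fin d) (Fin d) ℝ} (hA : Aᵀ = A)
    (hZ : Z.IsHermitian) (hW : W.IsHermitian) {q s m : ℕ} (h : q + s = 2 * m) :
    (A * Z ^ q * A * W ^ s).trace + (A * Z ^ s * A * W ^ q).trace ≤
      (A * A * Z ^ (2 * m)).trace + (A * A * W ^ (2 * m)).trace := by
  obtain ⟨l, μ, c, hc, H⟩ := trace_mul_pow_mul_pow hA hZ hW
  have e₁ : (A * A * Z ^ (2 * m)).trace = ∑ j, ∑ i, c i j * (l i ^ (2 * m) * μ j ^ 0) := by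
    rw [← H, pow_zero, Matrix.mul_one, Matrix.trace_mul_comm (A * _) A, Matrix.mul_assoc]
  have e₂ : (A * A * W ^ (2 * m)).trace = ∑ j, ∑ i, c i j * (l i ^ 0 * μ j ^ (2 * m)) := by
    rw [← H, pow_zero, Matrix.mul_one]
  rw [H, H, e₁, e₂]
  simp only [← sum_add_distrib, ← mul_add]
  refine sum_le_sum fun j _ => sum_le_sum fun i _ => mul_le_mul_of_nonneg_left ?_ (hc i j)
  simpa using pow_mul_pow_add_le (l i) (μ j) h

theorem pow_sub_pow_eq_sum {R : Type*} [Ring R] (Z W : R) (n : ℕ) :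
    Z ^ n - W ^ n = ∑ q ∈ range n, Z ^ q * (Z - W) * W ^ (n - 1 - q) := by
  induction n with
  | zero => simp
  | succ n ih =>
    rw [sum_range_succ, Nat.add_sub_cancel, Nat.sub_self, pow_zero, mul_one]
    have : ∑ q ∈ range n, Z ^ q * (Z - W) * W ^ (n - q) = (Z ^ n - W ^ n) * W := by
      rw [ih, sum_mul]
      refine sum_congr rfl fun q hq => ?_
      have : n - q = n - 1 - q + 1 := by have := mem_range.1 hq; omega
      rw [this, pow_succ, mul_assoc (Z ^ q * (Z - W))]
    rw [this, pow_succ, pow_succ]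
    noncomm_ring

variable {ι : Type*} [Fintype ι]

/-- The signed sum of the matrices `A t`. -/
noncomputable def signedSum (A : ι → Matrix (Fin d) (Fin d) ℝ) (b : ι → Bool) :
    Matrix (Fin d) (Fin d) ℝ := ∑ t, sgn (b t) • A t

theorem isHermitian_signedSum {A : ι → Matrix (Fin d) (Fin d) ℝ} (hA : ∀ t, (A t)ᵀ = A t)
    (b : ι → Bool) : (signedSum A b).IsHermitian := by
  simp [Matrix.IsHermitian, signedSum, Matrix.conjTranspose_eq_transpose_of_trivial,
    Matrix.transpose_sum, hA]

variable [DecidableEq ι]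

theorem signedSum_sub_flip (A : ι → Matrix (Fin d) (Fin d) ℝ) (b : ι → Bool) (t : ι) :
    signedSum A b - signedSum A (flipAt t b) = (2 * sgn (b t)) • A t := by
  rw [signedSum, signedSum, ← sum_sub_distrib, sum_eq_single_of_mem t (mem_univ t)]
  · simp [flipAt, sgn_not, two_mul, add_smul]
  · intro u _ hu
    simp [flipAt, hu]

/-- Integration by parts for random signs: pairing each sign pattern with the one in which the
`t`-th sign is flipped turns the expectation into one of differences of powers, which play the part
of a derivative. -/
theorem expect_sgn_mul_trace_le {A : ι → Matrix (Fin d) (Fin d) ℝ} (hA : ∀ t, (A t)ᵀ = A t)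
    (t : ι) (m : ℕ) :
    𝔼 b : ι → Bool, sgn (b t) * (A t * signedSum A b ^ (2 * m + 1)).trace ≤
      (2 * m + 1) * 𝔼 b : ι → Bool, (A t * A t * signedSum A b ^ (2 * m)).trace := by
  have hflip : ∀ f : (ι → Bool) → ℝ, 𝔼 b, f (flipAt t b) = 𝔼 b, f b := fun f =>
    Fintype.expect_equiv (flipAt t) _ _ fun _ => rfl
  have h₁ : ∀ b : ι → Bool,
      sgn (b t) * (A t * signedSum A b ^ (2 * m + 1)).trace +
        sgn (flipAt t b t) * (A t * signedSum A (flipAt t b) ^ (2 * m + 1)).trace ≤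
      (2 * m + 1) * ((A t * A t * signedSum A b ^ (2 * m)).trace +
        (A t * A t * signedSum A (flipAt t b) ^ (2 * m)).trace) := by
    intro b
    set Z := signedSum A b
    set W := signedSum A (flipAt t b) with hW
    have hs : sgn (flipAt t b t) = -sgn (b t) := by simp [flipAt, sgn_not]
    have e : sgn (b t) * (A t * Z ^ (2 * m + 1)).trace +
        sgn (flipAt t b t) * (A t * W ^ (2 * m + 1)).trace =
        2 * ∑ q ∈ range (2 * m + 1), (A t * Z ^ q * A t * W ^ (2 * m - q)).trace := by
      rw [hs, neg_mul, ← sub_eq_add_neg, ← mul_sub, ← Matrix.trace_sub, ← Matrix.mul_sub,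
        pow_sub_pow_eq_sum, signedSum_sub_flip, Matrix.mul_sum, Matrix.trace_sum, mul_sum, mul_sum]
      refine sum_congr rfl fun q _ => ?_
      rw [Matrix.mul_smul, Matrix.smul_mul, Matrix.mul_smul, Matrix.trace_smul, smul_eq_mul,
        Nat.add_sub_cancel]
      simp only [Matrix.mul_assoc]
      linear_combination 2 * (A t * (Z ^ q * (A t * W ^ (2 * m - q)))).trace * sgn_mul_self (b t)
    -- Average each term with its mirror image under `q ↦ 2 * m - q`.
    rw [e, two_mul]
    nth_rewrite 2 [← sum_range_reflect]
    rw [← sum_add_distrib]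
    refine (sum_le_card_nsmul _ _ ((A t * A t * Z ^ (2 * m)).trace +
      (A t * A t * W ^ (2 * m)).trace) fun q hq => ?_).trans
      (le_of_eq (by simp; ring))
    have hq' : q ≤ 2 * m := by have := mem_range.1 hq; omega
    have h₂ : 2 * m - (2 * m + 1 - 1 - q) = q := by omega
    have h₃ : 2 * m + 1 - 1 - q = 2 * m - q := by omega
    rw [h₂, h₃]
    exact trace_mul_pow_add_le (hA t) (isHermitian_signedSum hA _) (isHermitian_signedSum hA _)
      (by omega)
  have h₂ := expect_le_expect (s := univ) fun b (_ : b ∈ univ) => h₁ b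
  rw [← mul_expect, expect_add_distrib, expect_add_distrib,
    hflip fun b => sgn (b t) * (A t * signedSum A b ^ (2 * m + 1)).trace,
    hflip fun b => (A t * A t * signedSum A b ^ (2 * m)).trace] at h₂
  linarith

theorem trace_mul_sq_le {B Y : Matrix (Fin d) (Fin d) ℝ} {v : ℝ}
    (hB : ∀ y : Fin d → ℝ, y ⬝ᵥ B *ᵥ y ≤ v * (y ⬝ᵥ y)) (hY : Yᵀ = Y) :
    (B * (Y * Y)).trace ≤ v * (Y * Y).trace := by
  have h₁ : (B * (Y * Y)).trace = ∑ j, (fun i => Y i j) ⬝ᵥ B *ᵥ (fun i => Y i j) := by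
    rw [← Matrix.mul_assoc, Matrix.trace_mul_comm, Matrix.trace]
    refine sum_congr rfl fun j _ => ?_
    rw [Matrix.diag_apply, Matrix.mul_apply]
    refine sum_congr rfl fun i _ => ?_
    rw [← hY, Matrix.transpose_apply, hY]
    rfl
  have h₂ : (Y * Y).trace = ∑ j, (fun i => Y i j) ⬝ᵥ (fun i => Y i j) := by
    rw [Matrix.trace]
    refine sum_congr rfl fun j _ => ?_
    rw [Matrix.diag_apply, Matrix.mul_apply]
    refine sum_congr rfl fun i _ => ?_
    conv_lhs => rw [← hY]
    rw [Matrix.transpose_apply, hY]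
  rw [h₁, h₂, mul_sum]
  exact sum_le_sum fun j _ => hB _

/-- The moment bound behind the Khintchine inequality.  Integration by parts replaces two factors
`signedSum A b` by the sum of the squares of the `A t`, at the cost of a factor `2 * m + 1`. -/
theorem expect_trace_pow_le {A : ι → Matrix (Fin d) (Fin d) ℝ} (hA : ∀ t, (A t)ᵀ = A t) {v : ℝ}
    (hv : 0 ≤ v) (hB : ∀ y : Fin d → ℝ, y ⬝ᵥ (∑ t, A t * A t) *ᵥ y ≤ v * (y ⬝ᵥ y)) (p : ℕ) :
    ∀ m ≤ p, 𝔼 b : ι → Bool, (signedSum A b ^ (2 * m)).trace ≤ (2 * p * v) ^ m * d := by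
  intro m
  induction m with
  | zero => intro _; simp
  | succ m ih =>
    intro hm
    have hnn : 0 ≤ 𝔼 b : ι → Bool, (signedSum A b ^ (2 * m)).trace := by
      refine expect_nonneg fun b _ => ?_
      have h : (signedSum A b ^ m)ᵀ = signedSum A b ^ m := by
        have := (isHermitian_signedSum hA b).pow m
        rwa [Matrix.IsHermitian, Matrix.conjTranspose_eq_transpose_of_trivial] at this
      rw [two_mul, pow_add]
      conv_rhs => rw [← h]
      rw [Matrix.trace, h]
      refine sum_nonneg fun i _ => ?_
      rw [Matrix.diag_apply, Matrix.mul_apply]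
      refine sum_nonneg fun j _ => ?_
      conv_rhs => rw [← h]
      rw [Matrix.transpose_apply, h]
      exact mul_self_nonneg _
    have h₁ : 𝔼 b : ι → Bool, (signedSum A b ^ (2 * (m + 1))).trace =
        ∑ t, 𝔼 b : ι → Bool, sgn (b t) * (A t * signedSum A b ^ (2 * m + 1)).trace := by
      rw [← expect_sum_comm]
      refine expect_congr rfl fun b _ => ?_
      have : 2 * (m + 1) = 2 * m + 1 + 1 := by ring
      rw [this, pow_succ']
      conv_lhs => enter [1, 1]; rw [signedSum]
      rw [Matrix.sum_mul, Matrix.trace_sum]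
      refine sum_congr rfl fun t _ => ?_
      rw [Matrix.smul_mul, Matrix.trace_smul, smul_eq_mul]
    have h₂ : ∑ t, 𝔼 b : ι → Bool, (A t * A t * signedSum A b ^ (2 * m)).trace ≤
        v * 𝔼 b : ι → Bool, (signedSum A b ^ (2 * m)).trace := by
      rw [← expect_sum_comm, mul_expect]
      refine expect_le_expect fun b _ => ?_
      rw [← Matrix.trace_sum, ← Matrix.sum_mul, two_mul, pow_add]
      refine trace_mul_sq_le hB ?_
      have := (isHermitian_signedSum hA b).pow m
      rwa [Matrix.IsHermitian, Matrix.conjTranspose_eq_transpose_of_trivial] at this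
    have hmp : (2 * m + 1 : ℝ) ≤ 2 * p := by exact_mod_cast (by omega : 2 * m + 1 ≤ 2 * p)
    calc 𝔼 b : ι → Bool, (signedSum A b ^ (2 * (m + 1))).trace
        ≤ ∑ t, (2 * m + 1) * 𝔼 b : ι → Bool, (A t * A t * signedSum A b ^ (2 * m)).trace := by
          rw [h₁]; exact sum_le_sum fun t _ => expect_sgn_mul_trace_le hA t m
      _ ≤ (2 * m + 1) * (v * 𝔼 b : ι → Bool, (signedSum A b ^ (2 * m)).trace) := by
          rw [← mul_sum]; exact mul_le_mul_of_nonneg_left h₂ (by positivity)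
      _ ≤ 2 * p * (v * ((2 * p * v) ^ m * d)) := by
          refine mul_le_mul hmp (mul_le_mul_of_nonneg_left (ih (by omega)) hv)
            (mul_nonneg hv hnn) (by positivity)
      _ = (2 * p * v) ^ (m + 1) * d := by ring

open scoped Matrix.Norms.L2Operator

theorem norm_le_trace_mul_self {Y : Matrix (Fin d) (Fin d) ℝ} (hY : Yᵀ = Y) :
    ‖Y * Y‖ ≤ (Y * Y).trace := by
  have h₁ : ‖Y * Y‖ = ‖Y‖ * ‖Y‖ := by
    have := Matrix.l2_opNorm_conjTranspose_mul_self Y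
    rwa [Matrix.conjTranspose_eq_transpose_of_trivial, hY] at this
  have ht : (Y * Y).trace = ∑ i, ∑ j, Y i j ^ 2 := by
    rw [Matrix.trace]
    refine sum_congr rfl fun i _ => ?_
    rw [Matrix.diag_apply, Matrix.mul_apply]
    refine sum_congr rfl fun j _ => ?_
    have : Y j i = Y i j := by conv_lhs => rw [← hY, Matrix.transpose_apply]
    rw [this, sq]
  have hnn : 0 ≤ (Y * Y).trace := by
    rw [ht]; exact sum_nonneg fun i _ => sum_nonneg fun j _ => sq_nonneg _
  have h₂ : ‖Y‖ ≤ √(Y * Y).trace := by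
    rw [Matrix.l2_opNorm_def]
    refine ContinuousLinearMap.opNorm_le_bound _ (Real.sqrt_nonneg _) fun x => ?_
    rw [EuclideanSpace.norm_eq, EuclideanSpace.norm_eq, ← Real.sqrt_mul hnn]
    refine Real.sqrt_le_sqrt ?_
    rw [ht, sum_mul]
    refine sum_le_sum fun i _ => ?_
    have := sum_mul_sq_le_sq_mul_sq univ (fun j => Y i j) (fun j => x j)
    simpa [Matrix.toLpLin_apply, Matrix.mulVec, dotProduct] using this
  rw [h₁]
  calc ‖Y‖ * ‖Y‖ ≤ √(Y * Y).trace * √(Y * Y).trace := by gcongr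
    _ = _ := Real.mul_self_sqrt hnn

/-- The noncommutative Khintchine inequality, with a logarithmic dependence on the dimension.  The
trace exceeds the norm by a factor of at most `d`, and the root of order `2 ^ k` of this factor is at
most two. -/
theorem sq_expect_norm_signedSum_le {A : ι → Matrix (Fin d) (Fin d) ℝ} (hA : ∀ t, (A t)ᵀ = A t)
    {v : ℝ} (hv : 0 ≤ v)
    (hB : ∀ y : Fin d → ℝ, y ⬝ᵥ (∑ t, A t * A t) *ᵥ y ≤ v * (y ⬝ᵥ y)) (k : ℕ)
    (hd : d ≤ 2 ^ 2 ^ k) :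
    (𝔼 b : ι → Bool, ‖signedSum A b‖) ^ 2 ≤ 4 * 2 ^ k * v := by
  have h₁ : (𝔼 b : ι → Bool, ‖signedSum A b‖) ^ (2 * 2 ^ k) ≤
      (2 * (2 ^ k : ℕ) * v) ^ 2 ^ k * d := by
    refine (expect_pow_le _ (fun _ => norm_nonneg _) _).trans
      ((expect_le_expect fun b _ => ?_).trans (expect_trace_pow_le hA hv hB (2 ^ k) _ le_rfl))
    have hsa : IsSelfAdjoint (signedSum A b) := isHermitian_signedSum hA b
    have h2 : 2 * 2 ^ k = 2 ^ (k + 1) := by ring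
    have h3 : 2 ^ (k + 1) = 2 ^ k + 2 ^ k := by ring
    rw [h2, ← hsa.norm_pow_two_pow, h3, pow_add]
    refine norm_le_trace_mul_self ?_
    have := (isHermitian_signedSum hA b).pow (2 ^ k)
    rwa [Matrix.IsHermitian, Matrix.conjTranspose_eq_transpose_of_trivial] at this
  have h₂ : (2 * (2 ^ k : ℕ) * v) ^ 2 ^ k * d ≤ (4 * 2 ^ k * v) ^ 2 ^ k := by
    have hd' : (d : ℝ) ≤ 2 ^ 2 ^ k := by exact_mod_cast hd
    calc (2 * (2 ^ k : ℕ) * v) ^ 2 ^ k * d ≤ (2 * (2 ^ k : ℕ) * v) ^ 2 ^ k * 2 ^ 2 ^ k := by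
          gcongr
      _ = (4 * 2 ^ k * v) ^ 2 ^ k := by rw [← mul_pow]; congr 1; push_cast; ring
  rw [pow_mul] at h₁
  exact (pow_le_pow_iff_left₀ (by positivity) (by positivity) (by positivity)).1 (h₁.trans h₂)

end Khintchine

end Leverage

/-! ### Concentration of sums of independent rank-one matrices -/

namespace Leverage

open Finset
open scoped BigOperators

section Symmetrization

variable {α ι E : Type*} [Fintype α] [Nonempty α] [Fintype ι]

/-- Exchange the `t`-th entries of two sequences wherever `b t` is false. -/
def swapBy (b : ι → Bool) : (ι → α) × (ι → α) ≃ (ι → α) × (ι → α) where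
  toFun x := (fun t => if b t then x.1 t else x.2 t, fun t => if b t then x.2 t else x.1 t)
  invFun x := (fun t => if b t then x.1 t else x.2 t, fun t => if b t then x.2 t else x.1 t)
  left_inv x := by
    ext t <;> dsimp only <;> cases b t <;> simp
  right_inv x := by
    ext t <;> dsimp only <;> cases b t <;> simp

variable [DecidableEq ι] [NormedAddCommGroup E] [NormedSpace ℝ E]

/-- Symmetrization: a centred sum of independent terms is dominated, in mean, by twice the
corresponding sum with random signs. -/
theorem expect_norm_sum_sub_le (X : α → E) (M : E) (hM : ∑ a, X a = Fintype.card α • M) :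
    𝔼 s : ι → α, ‖∑ t, (X (s t) - M)‖ ≤
      2 * 𝔼 s : ι → α, 𝔼 b : ι → Bool, ‖∑ t, sgn (b t) • X (s t)‖ := by
  -- Replace the mean by an independent copy.
  have h₁ : ∀ s : ι → α, ‖∑ t, (X (s t) - M)‖ ≤
      𝔼 s' : ι → α, ‖∑ t, (X (s t) - X (s' t))‖ := by
    intro s
    have e : Fintype.card (ι → α) • ∑ t, (X (s t) - M) =
        ∑ s' : ι → α, ∑ t, (X (s t) - X (s' t)) := by
      rw [sum_comm, smul_sum]
      refine sum_congr rfl fun t _ => ?_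
      rw [sum_sub_distrib, sum_fun_apply t X, hM, ← mul_smul, ← card_fun_eq, sum_const, smul_sub,
        card_univ]
    have hC : (0 : ℝ) < Fintype.card (ι → α) := by exact_mod_cast Fintype.card_pos
    rw [Fintype.expect_eq_sum_div_card, le_div_iff₀' hC]
    calc (Fintype.card (ι → α) : ℝ) * ‖∑ t, (X (s t) - M)‖
        = ‖Fintype.card (ι → α) • ∑ t, (X (s t) - M)‖ := by
          rw [← Nat.cast_smul_eq_nsmul ℝ, norm_smul]; simp
      _ ≤ _ := by rw [e]; exact norm_sum_le _ _
  -- The differences have a symmetric distribution.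
  have h₂ : ∀ b : ι → Bool, 𝔼 s : ι → α, 𝔼 s' : ι → α, ‖∑ t, (X (s t) - X (s' t))‖ =
      𝔼 s : ι → α, 𝔼 s' : ι → α, ‖∑ t, sgn (b t) • (X (s t) - X (s' t))‖ := by
    intro b
    rw [← expect_product' univ univ fun s s' : ι → α => ‖∑ t, (X (s t) - X (s' t))‖,
      ← expect_product' univ univ fun s s' : ι → α => ‖∑ t, sgn (b t) • (X (s t) - X (s' t))‖,
      univ_product_univ]
    refine Fintype.expect_equiv (swapBy b) _ _ fun x => ?_
    congr 1
    refine sum_congr rfl fun t _ => ?_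
    cases h : b t <;> simp [swapBy, sgn, h]
  have h₃ : ∀ b : ι → Bool, 𝔼 s : ι → α, 𝔼 s' : ι → α, ‖∑ t, (X (s t) - X (s' t))‖ ≤
      2 * 𝔼 s : ι → α, ‖∑ t, sgn (b t) • X (s t)‖ := by
    intro b
    rw [h₂ b]
    calc 𝔼 s : ι → α, 𝔼 s' : ι → α, ‖∑ t, sgn (b t) • (X (s t) - X (s' t))‖
        ≤ 𝔼 s : ι → α, 𝔼 s' : ι → α,
          (‖∑ t, sgn (b t) • X (s t)‖ + ‖∑ t, sgn (b t) • X (s' t)‖) := by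
          refine expect_le_expect fun s _ => expect_le_expect fun s' _ => ?_
          simp only [smul_sub, sum_sub_distrib]
          exact norm_sub_le _ _
      _ = _ := by
          simp only [expect_add_distrib, Fintype.expect_const]
          ring
  calc 𝔼 s : ι → α, ‖∑ t, (X (s t) - M)‖
      ≤ 𝔼 s : ι → α, 𝔼 s' : ι → α, ‖∑ t, (X (s t) - X (s' t))‖ :=
        expect_le_expect fun s _ => h₁ s
    _ = 𝔼 _b : ι → Bool, 𝔼 s : ι → α, 𝔼 s' : ι → α, ‖∑ t, (X (s t) - X (s' t))‖ :=
        (Fintype.expect_const _).symm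
    _ ≤ 𝔼 b : ι → Bool, 2 * 𝔼 s : ι → α, ‖∑ t, sgn (b t) • X (s t)‖ :=
        expect_le_expect fun b _ => h₃ b
    _ = _ := by rw [← mul_expect, expect_comm]

end Symmetrization

section Concentration

open scoped Matrix.Norms.L2Operator

variable {d : ℕ}

theorem mulVec_dotProduct_self_le (M : Matrix (Fin d) (Fin d) ℝ) (y : Fin d → ℝ) :
    (M *ᵥ y) ⬝ᵥ (M *ᵥ y) ≤ ‖M‖ ^ 2 * (y ⬝ᵥ y) := by
  have h := M.l2_opNorm_mulVec (WithLp.toLp 2 y)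
  have h' := pow_le_pow_left₀ (norm_nonneg _) h 2
  rw [mul_pow, EuclideanSpace.real_norm_sq_eq, EuclideanSpace.real_norm_sq_eq] at h'
  simpa [dotProduct, sq] using h'

theorem abs_dotProduct_mulVec_le (M : Matrix (Fin d) (Fin d) ℝ) (x y : Fin d → ℝ) :
    |x ⬝ᵥ M *ᵥ y| ≤ ‖M‖ * (√(x ⬝ᵥ x) * √(y ⬝ᵥ y)) := by
  have h₀ : ∀ z : Fin d → ℝ, 0 ≤ z ⬝ᵥ z := fun z => sum_nonneg fun _ _ => mul_self_nonneg _
  refine abs_le_of_sq_le_sq ?_ (by positivity)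
  have h₁ : (x ⬝ᵥ M *ᵥ y) ^ 2 ≤ (x ⬝ᵥ x) * ((M *ᵥ y) ⬝ᵥ (M *ᵥ y)) := by
    simpa [dotProduct, sq] using sum_mul_sq_le_sq_mul_sq univ x (M *ᵥ y)
  rw [mul_pow, mul_pow, Real.sq_sqrt (h₀ _), Real.sq_sqrt (h₀ _)]
  calc _ ≤ _ := h₁
    _ ≤ (x ⬝ᵥ x) * (‖M‖ ^ 2 * (y ⬝ᵥ y)) :=
      mul_le_mul_of_nonneg_left (mulVec_dotProduct_self_le M y) (h₀ x)
    _ = _ := by ring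

theorem dotProduct_mulVec_self_le (M : Matrix (Fin d) (Fin d) ℝ) (y : Fin d → ℝ) :
    y ⬝ᵥ M *ᵥ y ≤ ‖M‖ * (y ⬝ᵥ y) := by
  have h₀ : 0 ≤ y ⬝ᵥ y := sum_nonneg fun _ _ => mul_self_nonneg _
  have := (le_abs_self _).trans (abs_dotProduct_mulVec_le M y y)
  rwa [Real.mul_self_sqrt h₀] at this

theorem dotProduct_vecMulVec_mulVec (x y : Fin d → ℝ) :
    y ⬝ᵥ Matrix.vecMulVec x x *ᵥ y = (x ⬝ᵥ y) ^ 2 := by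
  rw [Matrix.vecMulVec_mulVec, dotProduct_comm y]
  simp [dotProduct_comm, sq]

variable {α ι : Type*} [Fintype α] [Nonempty α] [Fintype ι] [DecidableEq ι] [NeZero d]

/-- The mean deviation `m` from its expectation of a sum of independent rank-one matrices.  It is
bounded through the noncommutative Khintchine inequality by the norm of the sum itself, hence by
`Fintype.card ι + m`. -/
theorem sq_expect_norm_sum_vecMulVec_le (x : α → Fin d → ℝ) {L : ℝ}
    (hx : ∑ a, Matrix.vecMulVec (x a) (x a) = Fintype.card α • (1 : Matrix (Fin d) (Fin d) ℝ))
    (hL : ∀ a, x a ⬝ᵥ x a ≤ L) (k : ℕ) (hd : d ≤ 2 ^ 2 ^ k) :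
    (𝔼 s : ι → α, ‖∑ t, (Matrix.vecMulVec (x (s t)) (x (s t)) - 1)‖) ^ 2 ≤
      16 * 2 ^ k * L * (Fintype.card ι +
        𝔼 s : ι → α, ‖∑ t, (Matrix.vecMulVec (x (s t)) (x (s t)) - 1)‖) := by
  set X : α → Matrix (Fin d) (Fin d) ℝ := fun a => Matrix.vecMulVec (x a) (x a) with hX
  have hxx : ∀ a, 0 ≤ x a ⬝ᵥ x a := fun a => sum_nonneg fun _ _ => mul_self_nonneg _
  have hL0 : 0 ≤ L := (hxx (Classical.arbitrary α)).trans (hL _)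
  have hXX : ∀ a, X a * X a = (x a ⬝ᵥ x a) • X a := by
    intro a
    ext i j
    simp only [hX, Matrix.mul_apply, Matrix.vecMulVec_apply, Matrix.smul_apply, smul_eq_mul,
      dotProduct, sum_mul]
    exact sum_congr rfl fun _ _ => by ring
  set f : (ι → α) → ℝ := fun s => 𝔼 b : ι → Bool, ‖∑ t, sgn (b t) • X (s t)‖ with hf
  have hf0 : ∀ s, 0 ≤ f s := fun s => expect_nonneg fun _ _ => norm_nonneg _
  have hfs : ∀ s, f s ^ 2 ≤ 4 * 2 ^ k * (L * (Fintype.card ι + ‖∑ t, (X (s t) - 1)‖)) := by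
    intro s
    have h₁ := sq_expect_norm_signedSum_le (A := fun t => X (s t))
      (fun t => by ext i j; simp [hX, Matrix.vecMulVec_apply, mul_comm])
      (v := L * ‖∑ t, X (s t)‖) (by positivity) (fun y => ?_) k hd
    · refine h₁.trans ?_
      have h₂ : ‖∑ t, X (s t)‖ ≤ Fintype.card ι + ‖∑ t, (X (s t) - 1)‖ := by
        have e : ∑ t, X (s t) =
            Fintype.card ι • (1 : Matrix (Fin d) (Fin d) ℝ) + ∑ t, (X (s t) - 1) := by
          rw [sum_sub_distrib, sum_const, card_univ]; abel
        rw [e]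
        refine (norm_add_le _ _).trans (add_le_add_left ?_ _)
        rw [← Nat.cast_smul_eq_nsmul ℝ, norm_smul]
        simp
      gcongr
    · calc y ⬝ᵥ (∑ t, X (s t) * X (s t)) *ᵥ y
          = ∑ t, (x (s t) ⬝ᵥ x (s t)) * (x (s t) ⬝ᵥ y) ^ 2 := by
            rw [Matrix.sum_mulVec, dotProduct_sum]
            refine sum_congr rfl fun t _ => ?_
            rw [hXX, Matrix.smul_mulVec, dotProduct_smul, dotProduct_vecMulVec_mulVec, smul_eq_mul]
        _ ≤ ∑ t, L * (x (s t) ⬝ᵥ y) ^ 2 :=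
            sum_le_sum fun t _ => mul_le_mul_of_nonneg_right (hL _) (sq_nonneg _)
        _ = L * (y ⬝ᵥ (∑ t, X (s t)) *ᵥ y) := by
            rw [Matrix.sum_mulVec, dotProduct_sum, mul_sum]
            exact sum_congr rfl fun t _ => by rw [dotProduct_vecMulVec_mulVec]
        _ ≤ L * (‖∑ t, X (s t)‖ * (y ⬝ᵥ y)) :=
            mul_le_mul_of_nonneg_left (dotProduct_mulVec_self_le _ _) hL0
        _ = _ := by ring
  set m := 𝔼 s : ι → α, ‖∑ t, (X (s t) - 1)‖ with hm
  have hm0 : 0 ≤ m := expect_nonneg fun _ _ => norm_nonneg _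
  have hsym : m ≤ 2 * 𝔼 s, f s := expect_norm_sum_sub_le X 1 hx
  calc m ^ 2 ≤ (2 * 𝔼 s, f s) ^ 2 := pow_le_pow_left₀ hm0 hsym 2
    _ = 4 * (𝔼 s, f s) ^ 2 := by ring
    _ ≤ 4 * 𝔼 s, f s ^ 2 := by gcongr; exact expect_pow_le f hf0 2
    _ ≤ 4 * 𝔼 s : ι → α, 4 * 2 ^ k * (L * (Fintype.card ι + ‖∑ t, (X (s t) - 1)‖)) := by
        gcongr with s; exact hfs s
    _ = 16 * 2 ^ k * L * (Fintype.card ι + m) := by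
        rw [← mul_expect, ← mul_expect, expect_add_distrib, Fintype.expect_const, ← hm]; ring

/-- Markov's inequality. -/
theorem markov_expect {Ω : Type*} [Fintype Ω] (f : Ω → ℝ) (hf : ∀ ω, 0 ≤ f ω) {a : ℝ}
    (ha : 0 < a) : 𝔼 ω, (if f ω ≤ a then 0 else 1 : ℝ) ≤ (𝔼 ω, f ω) / a := by
  rw [expect_div]
  refine expect_le_expect fun ω _ => ?_
  split_ifs with h
  · exact div_nonneg (hf ω) ha.le
  · rw [one_le_div ha]; exact (not_le.1 h).le

/-- A sum of `r` independent rank-one matrices is, except with probability `1 / 20`, within `r * δ`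
of its mean if `r` exceeds the squared lengths `L`, times a logarithm of the dimension,
by a factor of order `δ⁻²`. -/
theorem probability_norm_sum_vecMulVec_le (x : α → Fin d → ℝ) {L δ : ℝ}
    (hx : ∑ a, Matrix.vecMulVec (x a) (x a) = Fintype.card α • (1 : Matrix (Fin d) (Fin d) ℝ))
    (hL : ∀ a, x a ⬝ᵥ x a ≤ L) (k : ℕ) (hd : d ≤ 2 ^ 2 ^ k) (hδ : 0 < δ) (hδ1 : δ ≤ 1)
    (hι : 0 < Fintype.card ι) (hr : 16 * 2 ^ k * L * 1600 ≤ δ ^ 2 * Fintype.card ι) :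
    𝔼 s : ι → α, (if ‖∑ t, (Matrix.vecMulVec (x (s t)) (x (s t)) - 1)‖ ≤ Fintype.card ι * δ
      then 0 else 1 : ℝ) ≤ 1 / 20 := by
  have hr0 : (0 : ℝ) < Fintype.card ι := by exact_mod_cast hι
  refine (markov_expect _ (fun _ => norm_nonneg _) (by positivity)).trans ?_
  have h := sq_expect_norm_sum_vecMulVec_le (ι := ι) x hx hL k hd
  set m := 𝔼 s : ι → α, ‖∑ t, (Matrix.vecMulVec (x (s t)) (x (s t)) - 1)‖ with hm
  have hm0 : 0 ≤ m := expect_nonneg fun _ _ => norm_nonneg _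
  set r : ℝ := (Fintype.card ι : ℝ)
  -- A mean `m` above `δ * r / 20` contradicts the quadratic inequality for `m`.
  rw [div_le_iff₀ (by positivity)]
  by_contra hlt
  rw [not_le] at hlt
  have h₁ : 1600 * m ^ 2 ≤ δ ^ 2 * r * (r + m) := by
    calc 1600 * m ^ 2 ≤ 1600 * (16 * 2 ^ k * L * (r + m)) := by gcongr
      _ = (16 * 2 ^ k * L * 1600) * (r + m) := by ring
      _ ≤ _ := by gcongr
  have h₂ : δ * r ≤ 20 * m := by linarith
  have h₃ : δ * r * (δ * r) ≤ 20 * m * (20 * m) := by gcongr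
  have h₄ : δ * (δ * r) * m ≤ 1 * (20 * m) * m := by gcongr
  have h₅ : 0 < m := lt_of_le_of_lt (by positivity) hlt
  nlinarith

end Concentration

end Leverage

/-! ### Sparse random projections -/

namespace Leverage

open Finset
open scoped BigOperators

/-- The entries of the sparse sign matrix, normalized to have variance one. -/
noncomputable def sparseEntry (z : Fin 6) : ℝ := if z = 0 then √3 else if z = 1 then -√3 else 0

theorem expect_sparseEntry : 𝔼 z, sparseEntry z = 0 := by
  rw [Fintype.expect_eq_sum_div_card, Fin.sum_univ_six]
  simp [sparseEntry, Fin.ext_iff]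

theorem expect_sparseEntry_sq : 𝔼 z, sparseEntry z * sparseEntry z = 1 := by
  rw [Fintype.expect_eq_sum_div_card, Fin.sum_univ_six]
  simp [sparseEntry, Fin.ext_iff]
  norm_num

theorem expect_exp_sparseEntry_le (u : ℝ) :
    𝔼 z, Real.exp (u * sparseEntry z) ≤ Real.exp (3 / 2 * u ^ 2) := by
  have h := Real.cosh_le_exp_half_sq (u * √3)
  rw [mul_pow, Real.sq_sqrt (by norm_num), Real.cosh_eq] at h
  have h' : u ^ 2 * 3 / 2 = 3 / 2 * u ^ 2 := by ring
  rw [h'] at h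
  have h₁ : 1 ≤ Real.exp (3 / 2 * u ^ 2) := Real.one_le_exp (by positivity)
  rw [Fintype.expect_eq_sum_div_card, Fin.sum_univ_six]
  simp [sparseEntry, Fin.ext_iff]
  linarith

variable {d : ℕ}

/-- The coordinate of the projection of `w` along one column of independent sparse signs. -/
noncomputable def sparseSum (w : Fin d → ℝ) (z : Fin d → Fin 6) : ℝ :=
  ∑ j, w j * sparseEntry (z j)

theorem expect_sparseEntry_mul (j k : Fin d) :
    𝔼 z : Fin d → Fin 6, sparseEntry (z j) * sparseEntry (z k) = if j = k then 1 else 0 := by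
  have h : ∀ z : Fin d → Fin 6, sparseEntry (z j) * sparseEntry (z k) =
      ∏ t, ((if t = j then sparseEntry (z t) else 1) * if t = k then sparseEntry (z t) else 1) := by
    intro z
    rw [prod_mul_distrib]
    simp
  simp only [h]
  rw [expect_prod_apply fun t a =>
    (if t = j then sparseEntry a else 1) * if t = k then sparseEntry a else 1]
  split_ifs with hjk
  · subst hjk
    refine prod_eq_one fun t _ => ?_
    split_ifs
    · exact expect_sparseEntry_sq
    · simp
  · refine prod_eq_zero (mem_univ j) ?_
    simpa [hjk] using expect_sparseEntry

theorem expect_sparseSum_sq (w : Fin d → ℝ) :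
    𝔼 z, sparseSum w z ^ 2 = ∑ j, w j ^ 2 := by
  have h : ∀ z : Fin d → Fin 6, sparseSum w z ^ 2 =
      ∑ j, ∑ k, w j * w k * (sparseEntry (z j) * sparseEntry (z k)) := by
    intro z
    rw [sq, sparseSum, sum_mul_sum]
    exact sum_congr rfl fun _ _ => sum_congr rfl fun _ _ => by ring
  simp only [h, expect_sum_comm, ← mul_expect, expect_sparseEntry_mul]
  simp [sq]

theorem expect_exp_sparseSum_le (w : Fin d → ℝ) (g : ℝ) :
    𝔼 z, Real.exp (g * sparseSum w z) ≤ Real.exp (3 / 2 * g ^ 2 * ∑ j, w j ^ 2) := by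
  have h : ∀ z : Fin d → Fin 6, Real.exp (g * sparseSum w z) =
      ∏ j, Real.exp (g * w j * sparseEntry (z j)) := by
    intro z
    rw [← Real.exp_sum, sparseSum, mul_sum]
    simp only [mul_assoc]
  simp only [h]
  rw [expect_prod_apply fun j a => Real.exp (g * w j * sparseEntry a), mul_sum, Real.exp_sum]
  refine prod_le_prod (fun j _ => expect_nonneg fun _ _ => (Real.exp_pos _).le) fun j _ => ?_
  refine (expect_exp_sparseEntry_le _).trans (le_of_eq ?_)
  congr 1; ring

theorem integral_gaussian_shift (y : ℝ) :
    ∫ g : ℝ, Real.exp (-(1 / 2) * (g - y) ^ 2) = √(Real.pi / (1 / 2)) := by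
  rw [MeasureTheory.integral_sub_right_eq_self fun g : ℝ => Real.exp (-(1 / 2) * g ^ 2)]
  exact integral_gaussian _

/-- The square in the exponent is linearized by integration against a Gaussian.  With the exponent
`1 / 12` the moment generating function of the sparse sum absorbs one half of the decay of the
Gaussian density. -/
theorem expect_exp_sparseSum_sq_le (w : Fin d → ℝ) (hw : ∑ j, w j ^ 2 = 1) :
    𝔼 z, Real.exp (sparseSum w z ^ 2 / 12) ≤ 2 := by
  have h6 : √6 ^ 2 = 6 := Real.sq_sqrt (by norm_num)
  have hpt : ∀ (y g : ℝ), Real.exp (y ^ 2 / 12) * Real.exp (-(1 / 2) * (g - y / √6) ^ 2) =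
      Real.exp (-(1 / 2) * g ^ 2) * Real.exp (g / √6 * y) := by
    intro y g
    rw [← Real.exp_add, ← Real.exp_add]
    congr 1
    have : (y / √6) ^ 2 = y ^ 2 / 6 := by rw [div_pow, h6]
    have h' : g / √6 * y = g * (y / √6) := by ring
    rw [h']
    linear_combination (-1 / 2) * this
  have hint : ∀ y : ℝ, MeasureTheory.Integrable fun g : ℝ =>
      Real.exp (-(1 / 2) * g ^ 2) * Real.exp (g / √6 * y) := by
    intro y
    have : MeasureTheory.Integrable fun g : ℝ => Real.exp (-(1 / 2) * (g - y / √6) ^ 2) :=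
      (integrable_exp_neg_mul_sq (by norm_num : (0 : ℝ) < 1 / 2)).comp_sub_right (y / √6)
    exact (this.const_mul (Real.exp (y ^ 2 / 12))).congr (.of_forall fun g => hpt y g)
  have hval : ∀ y : ℝ, Real.exp (y ^ 2 / 12) * √(Real.pi / (1 / 2)) =
      ∫ g : ℝ, Real.exp (-(1 / 2) * g ^ 2) * Real.exp (g / √6 * y) := by
    intro y
    rw [← integral_gaussian_shift (y / √6), ← MeasureTheory.integral_const_mul]
    exact MeasureTheory.integral_congr_ae (.of_forall fun g => hpt y g)
  have hsum : (𝔼 z, Real.exp (sparseSum w z ^ 2 / 12)) * √(Real.pi / (1 / 2)) =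
      ∫ g : ℝ, Real.exp (-(1 / 2) * g ^ 2) * 𝔼 z, Real.exp (g / √6 * sparseSum w z) := by
    rw [expect_mul]
    simp only [hval, Fintype.expect_eq_sum_div_card]
    rw [← MeasureTheory.integral_finsetSum _ fun z _ => hint _, ← MeasureTheory.integral_div]
    simp only [mul_sum, mul_div_assoc, sum_div]
  have hle : ∫ g : ℝ, Real.exp (-(1 / 2) * g ^ 2) * 𝔼 z, Real.exp (g / √6 * sparseSum w z) ≤
      ∫ g : ℝ, Real.exp (-(1 / 4) * g ^ 2) := by
    refine MeasureTheory.integral_mono ?_ (integrable_exp_neg_mul_sq (by norm_num)) fun g => ?_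
    · simp only [Fintype.expect_eq_sum_div_card, ← mul_div_assoc, mul_sum]
      exact (MeasureTheory.integrable_finsetSum _ fun z _ => hint _).div_const _
    · have h := expect_exp_sparseSum_le w (g / √6)
      rw [hw, mul_one, div_pow, h6] at h
      calc Real.exp (-(1 / 2) * g ^ 2) * 𝔼 z, Real.exp (g / √6 * sparseSum w z)
          ≤ Real.exp (-(1 / 2) * g ^ 2) * Real.exp (3 / 2 * (g ^ 2 / 6)) := by gcongr
        _ = Real.exp (-(1 / 4) * g ^ 2) := by rw [← Real.exp_add]; congr 1; ring
  rw [← hsum, integral_gaussian] at hle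
  have hpos : 0 < √(Real.pi / (1 / 2)) := Real.sqrt_pos.2 (by positivity)
  have h4 : √(Real.pi / (1 / 4)) ≤ 2 * √(Real.pi / (1 / 2)) := by
    have : (2 : ℝ) * √(Real.pi / (1 / 2)) = √(2 ^ 2 * (Real.pi / (1 / 2))) := by
      rw [Real.sqrt_mul (by norm_num), Real.sqrt_sq (by norm_num)]
    rw [this]
    exact Real.sqrt_le_sqrt (by have := Real.pi_pos; linarith)
  exact le_of_mul_le_mul_right (hle.trans h4) hpos

theorem exp_le_one_add_add_sq_mul_exp (x : ℝ) :
    Real.exp x ≤ 1 + x + x ^ 2 * Real.exp |x| := by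
  have h1 : 1 ≤ Real.exp |x| := Real.one_le_exp (abs_nonneg x)
  have hx2 : x ^ 2 ≤ x ^ 2 * Real.exp |x| := le_mul_of_one_le_right (sq_nonneg x) h1
  rcases le_or_gt |x| 1 with h | h
  · have := (abs_le.1 (Real.abs_exp_sub_one_sub_id_le h)).2
    linarith
  · rcases lt_abs.1 h with hx | hx
    · have e : |x| = x := abs_of_pos (by linarith)
      rw [e]
      have : 1 * Real.exp x ≤ x ^ 2 * Real.exp x := by gcongr; nlinarith
      linarith
    · have : Real.exp x ≤ 1 := Real.exp_le_one_iff.2 (by linarith)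
      nlinarith

/-- The second-order expansion of the moment generating function.  The quadratic remainder is bounded
by `(y ^ 2) ^ 2 ≤ 1152 * exp (y ^ 2 / 24)`, since `1152 = 2 * 24 ^ 2`. -/
theorem expect_exp_mul_sparseSum_sq_le (w : Fin d → ℝ) (hw : ∑ j, w j ^ 2 = 1) {h : ℝ}
    (hh : |h| ≤ 1 / 24) :
    𝔼 z, Real.exp (h * sparseSum w z ^ 2) ≤ Real.exp (h + 2304 * h ^ 2) := by
  have hpt : ∀ y : ℝ, Real.exp (h * y ^ 2) ≤
      1 + h * y ^ 2 + 1152 * h ^ 2 * Real.exp (y ^ 2 / 12) := by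
    intro y
    refine (exp_le_one_add_add_sq_mul_exp _).trans (add_le_add_right ?_ _)
    have h₁ : |h * y ^ 2| ≤ y ^ 2 / 24 := by
      rw [abs_mul, abs_of_nonneg (sq_nonneg y)]
      nlinarith [sq_nonneg y]
    have h₂ : (y ^ 2) ^ 2 ≤ 1152 * Real.exp (y ^ 2 / 24) := by
      have := Real.quadratic_le_exp_of_nonneg (by positivity : 0 ≤ y ^ 2 / 24)
      nlinarith [sq_nonneg y]
    calc (h * y ^ 2) ^ 2 * Real.exp |h * y ^ 2|
        ≤ (h * y ^ 2) ^ 2 * Real.exp (y ^ 2 / 24) := by gcongr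
      _ = h ^ 2 * ((y ^ 2) ^ 2 * Real.exp (y ^ 2 / 24)) := by ring
      _ ≤ h ^ 2 * (1152 * Real.exp (y ^ 2 / 24) * Real.exp (y ^ 2 / 24)) := by gcongr
      _ = 1152 * h ^ 2 * Real.exp (y ^ 2 / 12) := by
        rw [mul_assoc 1152 (Real.exp _), ← Real.exp_add]
        ring_nf
  calc 𝔼 z, Real.exp (h * sparseSum w z ^ 2)
      ≤ 𝔼 z, (1 + h * sparseSum w z ^ 2 + 1152 * h ^ 2 * Real.exp (sparseSum w z ^ 2 / 12)) :=
        expect_le_expect fun z _ => hpt _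
    _ = 1 + h + 1152 * h ^ 2 * 𝔼 z, Real.exp (sparseSum w z ^ 2 / 12) := by
        rw [expect_add_distrib, expect_add_distrib, Fintype.expect_const, ← mul_expect,
          ← mul_expect, expect_sparseSum_sq, hw, mul_one]
    _ ≤ 1 + h + 1152 * h ^ 2 * 2 := by gcongr; exact expect_exp_sparseSum_sq_le w hw
    _ ≤ Real.exp (h + 2304 * h ^ 2) := by
        have := Real.add_one_le_exp (h + 2304 * h ^ 2)
        linarith

variable {r : ℕ}

/-- The exponential moments of the squared length of the projection, not yet divided by `r`. -/
theorem expect_exp_sum_sparseSum_sq_le (w : Fin d → ℝ) (hw : ∑ j, w j ^ 2 = 1) {h : ℝ}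
    (hh : |h| ≤ 1 / 24) :
    𝔼 x : Fin d → Fin r → Fin 6, Real.exp (h * ∑ t, sparseSum w (fun j => x j t) ^ 2) ≤
      Real.exp (r * (h + 2304 * h ^ 2)) := by
  have e : 𝔼 x : Fin d → Fin r → Fin 6, Real.exp (h * ∑ t, sparseSum w (fun j => x j t) ^ 2) =
      𝔼 y : Fin r → Fin d → Fin 6, ∏ t, Real.exp (h * sparseSum w (y t) ^ 2) := by
    refine Fintype.expect_equiv (Equiv.piComm fun _ _ => Fin 6) _ _ fun x => ?_
    rw [← Real.exp_sum, mul_sum]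
    rfl
  rw [e, expect_prod_apply fun _ a => Real.exp (h * sparseSum w a ^ 2), prod_const, card_univ,
    Fintype.card_fin, Real.exp_nat_mul]
  exact pow_le_pow_left₀ (expect_nonneg fun _ _ => (Real.exp_pos _).le)
    (expect_exp_mul_sparseSum_sq_le w hw hh) r

theorem probability_sparseSum_of_unit (w : Fin d → ℝ) (hw : ∑ j, w j ^ 2 = 1) {η : ℝ} (hη : 0 < η)
    (hη1 : η ≤ 1) :
    𝔼 x : Fin d → Fin r → Fin 6,
      (if |∑ t, sparseSum w (fun j => x j t) ^ 2 - r| ≤ η * r then 0 else 1 : ℝ) ≤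
      2 * Real.exp (-(η ^ 2 * r / 9216)) := by
  -- The minimizer of `2304 * h ^ 2 - η * h`.
  set h := η / 4608 with hh
  have hle : |h| ≤ 1 / 24 := by rw [abs_of_pos (by positivity), hh]; linarith
  have hle' : |-h| ≤ 1 / 24 := by rwa [abs_neg]
  have hpt : ∀ q : ℝ, (if |q - r| ≤ η * r then 0 else 1 : ℝ) ≤
      Real.exp (-(h * (r + η * r))) * Real.exp (h * q) +
        Real.exp (h * (r - η * r)) * Real.exp (-h * q) := by
    intro q
    rw [← Real.exp_add, ← Real.exp_add]
    have hpos : 0 < h := by positivity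
    split_ifs with hq
    · positivity
    · rcases lt_abs.1 (not_le.1 hq) with hq | hq
      · have : 1 ≤ Real.exp (-(h * (r + η * r)) + h * q) := Real.one_le_exp (by nlinarith)
        linarith [Real.exp_pos (h * (r - η * r) + -h * q)]
      · have : 1 ≤ Real.exp (h * (r - η * r) + -h * q) := Real.one_le_exp (by nlinarith)
        linarith [Real.exp_pos (-(h * (r + η * r)) + h * q)]
  calc _ ≤ 𝔼 x : Fin d → Fin r → Fin 6,
        (Real.exp (-(h * (r + η * r))) * Real.exp (h * ∑ t, sparseSum w (fun j => x j t) ^ 2) +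
        Real.exp (h * (r - η * r)) * Real.exp (-h * ∑ t, sparseSum w (fun j => x j t) ^ 2)) :=
        expect_le_expect fun x _ => hpt _
    _ ≤ Real.exp (-(h * (r + η * r))) * Real.exp (r * (h + 2304 * h ^ 2)) +
        Real.exp (h * (r - η * r)) * Real.exp (r * (-h + 2304 * (-h) ^ 2)) := by
        rw [expect_add_distrib, ← mul_expect, ← mul_expect]
        gcongr
        · exact expect_exp_sum_sparseSum_sq_le w hw hle
        · exact expect_exp_sum_sparseSum_sq_le w hw hle'
    _ = _ := by
        rw [← Real.exp_add, ← Real.exp_add, two_mul]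
        congr 2 <;> rw [hh] <;> ring

theorem sum_mul_sparseSign (w : Fin d → ℝ) (x : Fin d → Fin r → Fin 6) (t : Fin r) :
    ∑ j, w j * sparseSign x j t = sparseSum w (fun j => x j t) / √r := by
  rw [sparseSum, sum_div]
  refine sum_congr rfl fun j _ => ?_
  rw [sparseSign, Matrix.of_apply, sparseEntry, Real.sqrt_div (by norm_num)]
  split_ifs <;> ring

/-- A sparse sign matrix with `r` columns preserves the squared length of a fixed vector up to the
relative error `η`, except with a probability that is exponentially small in `η ^ 2 * r`. -/
theorem probability_sparseSign (hr : 0 < r) (w : Fin d → ℝ) {η : ℝ} (hη : 0 < η) (hη1 : η ≤ 1) :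
    𝔼 x : Fin d → Fin r → Fin 6,
      (if |∑ t, (∑ j, w j * sparseSign x j t) ^ 2 - ∑ j, w j ^ 2| ≤ η * ∑ j, w j ^ 2
        then 0 else 1 : ℝ) ≤ 2 * Real.exp (-(η ^ 2 * r / 9216)) := by
  have hr' : (0 : ℝ) < r := by exact_mod_cast hr
  set q := ∑ j, w j ^ 2 with hq
  have hq0 : 0 ≤ q := sum_nonneg fun _ _ => sq_nonneg _
  rcases hq0.eq_or_lt with h0 | hpos
  · have hw : ∀ j, w j = 0 := by
      intro j
      have := (sum_eq_zero_iff_of_nonneg fun j _ => sq_nonneg (w j)).1 h0.symm j (mem_univ j)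
      exact pow_eq_zero_iff (two_ne_zero) |>.1 this
    have : 𝔼 x : Fin d → Fin r → Fin 6,
      (if |∑ t, (∑ j, w j * sparseSign x j t) ^ 2 - q| ≤ η * q then 0 else 1 : ℝ) = 0 := by
      refine expect_eq_zero fun x _ => if_pos ?_
      simp [hw, ← h0]
    rw [this]
    positivity
  · have hu : ∑ j, (w j / √q) ^ 2 = 1 := by
      simp only [div_pow, Real.sq_sqrt hq0, ← sum_div]
      exact div_self hpos.ne'
    refine le_trans (le_of_eq ?_) (probability_sparseSum_of_unit (r := r) _ hu hη hη1)
    refine expect_congr rfl fun x _ => ?_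
    have e : ∑ t, (∑ j, w j * sparseSign x j t) ^ 2 - q =
        (q / r) * (∑ t, sparseSum (fun j => w j / √q) (fun j => x j t) ^ 2 - r) := by
      have hs : ∀ t, sparseSum (fun j => w j / √q) (fun j => x j t) =
          sparseSum w (fun j => x j t) / √q := fun t => by
        simp only [sparseSum, sum_div]
        exact sum_congr rfl fun _ _ => by ring
      simp only [hs, sum_mul_sparseSign, div_pow, Real.sq_sqrt hq0, Real.sq_sqrt hr'.le, ← sum_div]
      field_simp
    refine if_congr ?_ rfl rfl
    rw [e, abs_mul, abs_of_pos (by positivity), div_mul_eq_mul_div, div_le_iff₀ hr',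
      mul_comm q, mul_assoc η, mul_comm q, ← mul_assoc η, mul_le_mul_iff_left₀ hpos]

end Leverage

/-! ### The randomized Hadamard transform flattens the rows -/

namespace Leverage

open Finset
open scoped BigOperators

theorem expect_exp_sgn_le (u : ℝ) : 𝔼 b, Real.exp (u * sgn b) ≤ Real.exp (u ^ 2 / 2) := by
  refine le_trans (le_of_eq ?_) (Real.cosh_le_exp_half_sq u)
  rw [Fintype.expect_eq_sum_div_card, Fintype.sum_bool, Real.cosh_eq]
  simp [sgn]

theorem expect_exp_sum_sgn_le {ι : Type*} [Fintype ι] [DecidableEq ι] (c : ι → ℝ) (g : ℝ) :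
    𝔼 b : ι → Bool, Real.exp (g * ∑ i, c i * sgn (b i)) ≤
      Real.exp (g ^ 2 / 2 * ∑ i, c i ^ 2) := by
  have h : ∀ b : ι → Bool, Real.exp (g * ∑ i, c i * sgn (b i)) =
      ∏ i, Real.exp (g * c i * sgn (b i)) := by
    intro b
    rw [← Real.exp_sum, mul_sum]
    simp only [mul_assoc]
  simp only [h]
  rw [expect_prod_apply fun i a => Real.exp (g * c i * sgn a), mul_sum, Real.exp_sum]
  refine prod_le_prod (fun j _ => expect_nonneg fun _ _ => (Real.exp_pos _).le) fun j _ => ?_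
  refine (expect_exp_sgn_le _).trans (le_of_eq ?_)
  congr 1; ring

/-- Hoeffding's inequality for random signs. -/
theorem probability_sum_sgn {ι : Type*} [Fintype ι] [DecidableEq ι] (c : ι → ℝ)
    (hc : ∑ i, c i ^ 2 = 1) {τ : ℝ} (hτ : 0 ≤ τ) :
    𝔼 b : ι → Bool, (if (∑ i, c i * sgn (b i)) ^ 2 ≤ τ ^ 2 then 0 else 1 : ℝ) ≤
      2 * Real.exp (-(τ ^ 2 / 2)) := by
  have hpt : ∀ q : ℝ, (if q ^ 2 ≤ τ ^ 2 then 0 else 1 : ℝ) ≤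
      Real.exp (-τ ^ 2) * (Real.exp (τ * q) + Real.exp (-τ * q)) := by
    intro q
    rw [mul_add, ← Real.exp_add, ← Real.exp_add]
    split_ifs with hq
    · positivity
    · rw [sq_le_sq, abs_of_nonneg hτ, not_le, lt_abs] at hq
      rcases hq with hq | hq
      · have : 1 ≤ Real.exp (-τ ^ 2 + τ * q) := Real.one_le_exp (by nlinarith)
        linarith [Real.exp_pos (-τ ^ 2 + -τ * q)]
      · have : 1 ≤ Real.exp (-τ ^ 2 + -τ * q) := Real.one_le_exp (by nlinarith)
        linarith [Real.exp_pos (-τ ^ 2 + τ * q)]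
  have h₁ := expect_exp_sum_sgn_le c τ
  have h₂ := expect_exp_sum_sgn_le c (-τ)
  rw [hc, mul_one] at h₁ h₂
  rw [neg_sq] at h₂
  calc _ ≤ 𝔼 b : ι → Bool, Real.exp (-τ ^ 2) *
        (Real.exp (τ * ∑ i, c i * sgn (b i)) + Real.exp (-τ * ∑ i, c i * sgn (b i))) :=
        expect_le_expect fun b _ => hpt _
    _ ≤ Real.exp (-τ ^ 2) * (Real.exp (τ ^ 2 / 2) + Real.exp (τ ^ 2 / 2)) := by
        rw [← mul_expect, expect_add_distrib]
        gcongr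
    _ = _ := by
        rw [← two_mul, mul_left_comm, ← Real.exp_add]
        congr 2; ring

/-- The union bound. -/
theorem le_expect_exists {Ω ι : Type*} [Fintype Ω] [Fintype ι] (P : ι → Ω → Prop)
    [∀ i ω, Decidable (P i ω)] [∀ ω, Decidable (∀ i, P i ω)] {δ : ℝ}
    (h : ∀ i, 𝔼 ω, (if P i ω then 0 else 1 : ℝ) ≤ δ) :
    𝔼 ω, (if ∀ i, P i ω then 0 else 1 : ℝ) ≤ Fintype.card ι * δ := by
  calc 𝔼 ω, (if ∀ i, P i ω then 0 else 1 : ℝ)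
      ≤ 𝔼 ω, ∑ i, (if P i ω then 0 else 1 : ℝ) := by
        refine expect_le_expect fun ω _ => ?_
        have hnn : ∀ i ∈ (univ : Finset ι), (0 : ℝ) ≤ if P i ω then 0 else 1 := fun i _ => by
          split_ifs <;> norm_num
        split_ifs with hω
        · exact sum_nonneg hnn
        · obtain ⟨i, hi⟩ := not_forall.1 hω
          exact le_trans (by simp [hi]) (single_le_sum hnn (mem_univ i))
    _ = ∑ i, 𝔼 ω, (if P i ω then 0 else 1 : ℝ) := expect_sum_comm _ _ _
    _ ≤ Fintype.card ι * δ := by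
        refine (sum_le_card_nsmul _ _ δ fun i _ => h i).trans ?_
        simp

theorem padMatrix_transpose_mul_self {n N : ℕ} (h : n ≤ N) :
    (padMatrix n N)ᵀ * padMatrix n N = 1 := by
  ext i j
  rw [Matrix.mul_apply, sum_eq_single (⟨i, i.isLt.trans_le h⟩ : Fin N)]
  · simp [padMatrix, Matrix.one_apply, Fin.ext_iff]
  · intro a _ ha
    have : (a : ℕ) ≠ i := fun h => ha (Fin.ext h)
    simp [padMatrix, this]
  · simp

theorem signMatrix_transpose_mul_self {N : ℕ} (b : Fin N → Bool) :
    (signMatrix b)ᵀ * signMatrix b = 1 := by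
  rw [signMatrix, Matrix.diagonal_transpose, Matrix.diagonal_mul_diagonal, ← Matrix.diagonal_one]
  congr 1
  funext a
  split_ifs <;> norm_num

variable {n d : ℕ}

/-- The matrix with orthonormal columns `H D U`, where `U` is padded by zero rows. -/
noncomputable def mixed (U : Matrix (Fin n) (Fin d) ℝ) (b : Fin (2 ^ Nat.clog 2 n) → Bool) :
    Matrix (Fin (2 ^ Nat.clog 2 n)) (Fin d) ℝ :=
  hadamard (Nat.clog 2 n) * signMatrix b * padMatrix n (2 ^ Nat.clog 2 n) * U

theorem mixed_transpose_mul_self {U : Matrix (Fin n) (Fin d) ℝ} (hU : Uᵀ * U = 1)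
    (b : Fin (2 ^ Nat.clog 2 n) → Bool) : (mixed U b)ᵀ * mixed U b = 1 := by
  have h : n ≤ 2 ^ Nat.clog 2 n := Nat.le_pow_clog (by norm_num) n
  calc (mixed U b)ᵀ * mixed U b
      = Uᵀ * ((padMatrix n (2 ^ Nat.clog 2 n))ᵀ * ((signMatrix b)ᵀ *
          ((hadamard (Nat.clog 2 n))ᵀ * hadamard (Nat.clog 2 n)) * signMatrix b) * padMatrix n (2 ^ Nat.clog 2 n)) * U := by
        simp only [mixed, Matrix.transpose_mul, Matrix.mul_assoc]
    _ = 1 := by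
        rw [transpose_hadamard_mul, Matrix.mul_one, signMatrix_transpose_mul_self, Matrix.mul_one,
          padMatrix_transpose_mul_self h, Matrix.mul_one, hU]

/-- The rows of `H D U`, rescaled such that their outer products have the identity as average. -/
noncomputable def mixedRow (U : Matrix (Fin n) (Fin d) ℝ) (b : Fin (2 ^ Nat.clog 2 n) → Bool)
    (a : Fin (2 ^ Nat.clog 2 n)) (j : Fin d) : ℝ :=
  √(2 ^ Nat.clog 2 n) * mixed U b a j

theorem sum_vecMulVec_mixedRow {U : Matrix (Fin n) (Fin d) ℝ} (hU : Uᵀ * U = 1)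
    (b : Fin (2 ^ Nat.clog 2 n) → Bool) :
    ∑ a, Matrix.vecMulVec (mixedRow U b a) (mixedRow U b a) =
      Fintype.card (Fin (2 ^ Nat.clog 2 n)) • (1 : Matrix (Fin d) (Fin d) ℝ) := by
  rw [← mixed_transpose_mul_self hU b]
  ext i j
  rw [Matrix.sum_apply, Matrix.smul_apply, Matrix.mul_apply, Fintype.card_fin, nsmul_eq_mul,
    mul_sum]
  refine sum_congr rfl fun a _ => ?_
  rw [Matrix.vecMulVec_apply, mixedRow, mixedRow, Matrix.transpose_apply, mul_mul_mul_comm,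
    Real.mul_self_sqrt (by positivity)]
  push_cast
  ring

theorem mixedRow_eq (U : Matrix (Fin n) (Fin d) ℝ) (b : Fin (2 ^ Nat.clog 2 n) → Bool)
    (a : Fin (2 ^ Nat.clog 2 n)) (j : Fin d) :
    mixedRow U b a j = ∑ c : Fin (2 ^ Nat.clog 2 n), hadamardEntry (Nat.clog 2 n) a c *
      (padMatrix n (2 ^ Nat.clog 2 n) * U) c j * sgn (b c) := by
  have hs : √(2 ^ Nat.clog 2 n : ℝ) ≠ 0 := (Real.sqrt_pos.2 (by positivity)).ne'
  rw [mixedRow, mixed, Matrix.mul_assoc, signMatrix, Matrix.mul_apply, mul_sum]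
  refine sum_congr rfl fun c _ => ?_
  rw [Matrix.mul_diagonal, hadamard, Matrix.of_apply, sgn]
  field_simp

/-- Except with probability `1 / 20`, all entries of the rescaled `H D U` are of order `√(ln n)`.
Each entry is a sum of random signs with coefficients of total square one, and there are at most
`4 ^ ⌈log₂ n⌉` entries. -/
theorem probability_mixedRow {U : Matrix (Fin n) (Fin d) ℝ} (hU : Uᵀ * U = 1) (hd : d ≤ n)
    (hn : 2 ≤ n) :
    𝔼 b, (if ∀ aj : Fin (2 ^ Nat.clog 2 n) × Fin d,
      mixedRow U b aj.1 aj.2 ^ 2 ≤ 12 * Nat.clog 2 n then 0 else 1 : ℝ) ≤ 1 / 20 := by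
  have hnK : n ≤ 2 ^ Nat.clog 2 n := Nat.le_pow_clog (by norm_num) n
  have hK : 1 ≤ Nat.clog 2 n := Nat.clog_pos (by norm_num) hn
  set K := Nat.clog 2 n with hKdef
  have hone : ∀ aj : Fin (2 ^ K) × Fin d,
      𝔼 b, (if mixedRow U b aj.1 aj.2 ^ 2 ≤ 12 * K then 0 else 1 : ℝ) ≤
        2 * Real.exp (-(6 * K)) := by
    rintro ⟨a, j⟩
    have h12 : √(12 * K : ℝ) ^ 2 = 12 * K := Real.sq_sqrt (by positivity)
    have hcol : ∑ c : Fin (2 ^ K),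
        (hadamardEntry K a c * (padMatrix n (2 ^ K) * U) c j) ^ 2 = 1 := by
      have hPU : (padMatrix n (2 ^ K) * U)ᵀ * (padMatrix n (2 ^ K) * U) = 1 := by
        rw [Matrix.transpose_mul, Matrix.mul_assoc, ← Matrix.mul_assoc _ _ U,
          padMatrix_transpose_mul_self hnK, Matrix.one_mul, hU]
      have := congrFun (congrFun hPU j) j
      rw [Matrix.mul_apply, Matrix.one_apply_eq] at this
      rw [← this]
      refine sum_congr rfl fun c _ => ?_
      rw [mul_pow, hadamardEntry_sq, one_mul, sq, Matrix.transpose_apply]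
    have h := probability_sum_sgn _ hcol (Real.sqrt_nonneg (12 * K : ℝ))
    rw [h12] at h
    have e : (12 * K / 2 : ℝ) = 6 * K := by ring
    rw [e] at h
    simp only [mixedRow_eq]
    exact h
  refine (le_expect_exists (fun (aj : Fin (2 ^ K) × Fin d) b =>
    mixedRow U b aj.1 aj.2 ^ 2 ≤ 12 * K) hone).trans ?_
  have hcard : (Fintype.card (Fin (2 ^ K) × Fin d) : ℝ) ≤ 4 ^ K := by
    rw [Fintype.card_prod, Fintype.card_fin, Fintype.card_fin]
    have : 2 ^ K * d ≤ 4 ^ K := by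
      calc 2 ^ K * d ≤ 2 ^ K * 2 ^ K := Nat.mul_le_mul_left _ (hd.trans hnK)
        _ = 4 ^ K := by rw [← mul_pow]; norm_num
    exact_mod_cast this
  have he : Real.exp (-6) ≤ 1 / 160 := by
    rw [Real.exp_neg, one_div]
    refine inv_anti₀ (by norm_num) ?_
    have h1 := Real.exp_one_gt_d9
    have : Real.exp 6 = Real.exp 1 ^ 6 := by rw [← Real.exp_nat_mul]; norm_num
    rw [this]
    calc (160 : ℝ) ≤ 2.7182818283 ^ 6 := by norm_num
      _ ≤ _ := pow_le_pow_left₀ (by norm_num) h1.le 6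
  have hexp : Real.exp (-(6 * K)) ≤ (1 / 160) ^ K := by
    have : -(6 * K : ℝ) = K * (-6) := by ring
    rw [this, Real.exp_nat_mul]
    exact pow_le_pow_left₀ (Real.exp_pos _).le he K
  calc (Fintype.card (Fin (2 ^ K) × Fin d) : ℝ) * (2 * Real.exp (-(6 * K)))
      ≤ 4 ^ K * (2 * (1 / 160) ^ K) := by gcongr
    _ = 2 * (1 / 40) ^ K := by
      rw [mul_left_comm, ← mul_pow]; norm_num
    _ ≤ 2 * (1 / 40) ^ 1 := by
      gcongr ?_ * ?_
      exact pow_le_pow_of_le_one (by norm_num) (by norm_num) hK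
    _ = 1 / 20 := by norm_num

/-! ### Accuracy of the estimates -/

section Accuracy

open scoped Matrix.Norms.L2Operator

theorem srht_mul_apply {r : ℕ} (U : Matrix (Fin n) (Fin d) ℝ)
    (b : Fin (2 ^ Nat.clog 2 n) → Bool) (s : Fin r → Fin (2 ^ Nat.clog 2 n)) (t : Fin r)
    (j : Fin d) :
    (srht n b s * U) t j =
      √((2 ^ Nat.clog 2 n : ℕ) / r) * mixed U b (s t) j := by
  have : srht n b s * U = samplingMatrix s * mixed U b := by
    simp only [srht, mixed, Matrix.mul_assoc]
  rw [this, Matrix.mul_apply, sum_eq_single (s t)]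
  · simp [samplingMatrix]
  · intro a _ ha
    simp [samplingMatrix, ha.symm]
  · simp

theorem srht_gram {r : ℕ} (U : Matrix (Fin n) (Fin d) ℝ)
    (b : Fin (2 ^ Nat.clog 2 n) → Bool) (s : Fin r → Fin (2 ^ Nat.clog 2 n)) :
    (srht n b s * U)ᵀ * (srht n b s * U) =
      (1 / r : ℝ) • ∑ t, Matrix.vecMulVec (mixedRow U b (s t)) (mixedRow U b (s t)) := by
  ext i j
  rw [Matrix.mul_apply, Matrix.smul_apply, Matrix.sum_apply, smul_eq_mul, mul_sum]
  refine sum_congr rfl fun t _ => ?_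
  rw [Matrix.transpose_apply, srht_mul_apply, srht_mul_apply, Matrix.vecMulVec_apply, mixedRow,
    mixedRow, mul_mul_mul_comm, Real.mul_self_sqrt (by positivity), mul_mul_mul_comm,
    Real.mul_self_sqrt (by positivity)]
  push_cast
  ring

theorem norm_srht_gram_sub_one_le {r : ℕ} (hr : 0 < r) {δ : ℝ} (U : Matrix (Fin n) (Fin d) ℝ)
    (b : Fin (2 ^ Nat.clog 2 n) → Bool) (s : Fin r → Fin (2 ^ Nat.clog 2 n))
    (h : ‖∑ t, (Matrix.vecMulVec (mixedRow U b (s t)) (mixedRow U b (s t)) - 1)‖ ≤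
      Fintype.card (Fin r) * δ) :
    ‖(srht n b s * U)ᵀ * (srht n b s * U) - 1‖ ≤ δ := by
  have hr' : (0 : ℝ) < r := by exact_mod_cast hr
  have e : (srht n b s * U)ᵀ * (srht n b s * U) - 1 = (1 / r : ℝ) •
      ∑ t, (Matrix.vecMulVec (mixedRow U b (s t)) (mixedRow U b (s t)) - 1) := by
    rw [srht_gram, sum_sub_distrib, smul_sub, sum_const, card_univ, Fintype.card_fin,
      ← Nat.cast_smul_eq_nsmul ℝ, smul_smul, one_div, inv_mul_cancel₀ hr'.ne', one_smul]
  rw [e, norm_smul, Real.norm_of_nonneg (by positivity), one_div, inv_mul_le_iff₀ hr']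
  simpa using h

/-- If `G` is close to the identity and `Mᵀ G M = 1`, then `M Mᵀ = G⁻¹`, so that `Mᵀ` almost
preserves squared lengths. -/
theorem abs_transpose_mulVec_sub_le {G M : Matrix (Fin d) (Fin d) ℝ} (hM : Mᵀ * G * M = 1)
    {δ : ℝ} (hG : ‖G - 1‖ ≤ δ) (hδ : δ ≤ 1 / 2) (u : Fin d → ℝ) :
    |(u ᵥ* M) ⬝ᵥ (u ᵥ* M) - u ⬝ᵥ u| ≤ 2 * δ * (u ⬝ᵥ u) := by
  have h₀ : ∀ z : Fin d → ℝ, 0 ≤ z ⬝ᵥ z := fun z => sum_nonneg fun _ _ => mul_self_nonneg _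
  have hδ0 : 0 ≤ δ := (norm_nonneg _).trans hG
  have hinv : G * M * Mᵀ = 1 := by
    rw [Matrix.mul_assoc] at hM
    exact mul_eq_one_comm.1 hM
  set v := M *ᵥ (u ᵥ* M) with hv
  have hGv : G *ᵥ v = u := by
    rw [hv, ← Matrix.mulVec_transpose M u, Matrix.mulVec_mulVec, Matrix.mulVec_mulVec,
      hinv, Matrix.one_mulVec]
  have hdiff : (G - 1) *ᵥ v = u - v := by rw [Matrix.sub_mulVec, hGv, Matrix.one_mulVec]
  have huv : (u ᵥ* M) ⬝ᵥ (u ᵥ* M) = u ⬝ᵥ v := by rw [hv, Matrix.dotProduct_mulVec]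
  set a := √(u ⬝ᵥ u) with ha
  set c := √(v ⬝ᵥ v) with hc
  have ha2 : a * a = u ⬝ᵥ u := Real.mul_self_sqrt (h₀ u)
  have hc2 : c * c = v ⬝ᵥ v := Real.mul_self_sqrt (h₀ v)
  have ha0 : 0 ≤ a := Real.sqrt_nonneg _
  have hc0 : 0 ≤ c := Real.sqrt_nonneg _
  have h₁ : |u ⬝ᵥ (G - 1) *ᵥ v| ≤ δ * (a * c) :=
    (abs_dotProduct_mulVec_le _ _ _).trans (mul_le_mul_of_nonneg_right hG (by positivity))
  have h₂ : |v ⬝ᵥ (G - 1) *ᵥ v| ≤ δ * (c * c) :=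
    (abs_dotProduct_mulVec_le _ _ _).trans (mul_le_mul_of_nonneg_right hG (by positivity))
  have h₃ : v ⬝ᵥ u ≤ c * a := by
    have h := abs_dotProduct_mulVec_le (1 : Matrix (Fin d) (Fin d) ℝ) v u
    rw [Matrix.one_mulVec] at h
    have h1 : ‖(1 : Matrix (Fin d) (Fin d) ℝ)‖ ≤ 1 := by
      cases isEmpty_or_nonempty (Fin d)
      · rw [Subsingleton.elim (1 : Matrix (Fin d) (Fin d) ℝ) 0, norm_zero]; norm_num
      · exact norm_one.le
    calc v ⬝ᵥ u ≤ _ := (le_abs_self _).trans h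
      _ ≤ 1 * (c * a) := by gcongr
      _ = c * a := one_mul _
  rw [hdiff, dotProduct_sub] at h₁ h₂
  have h₂' := (abs_le.1 h₂).1
  rw [← hc2] at h₂'
  have hca : c ≤ 2 * a := by
    by_contra hlt
    rw [not_le] at hlt
    have : 0 < c := lt_of_le_of_lt (by positivity) hlt
    nlinarith
  rw [huv, abs_sub_comm]
  refine h₁.trans ?_
  rw [← ha2]
  have : δ * (a * c) ≤ δ * (a * (2 * a)) := by gcongr
  linarith

theorem rank_eq_of_injective {r : ℕ} {B : Matrix (Fin r) (Fin d) ℝ}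
    (hB : ∀ x : Fin d → ℝ, B *ᵥ x = 0 → x = 0) : B.rank = d := by
  have h : Function.Injective B.mulVecLin :=
    LinearMap.ker_eq_bot.1 (LinearMap.ker_eq_bot'.2 hB)
  rw [Matrix.rank, LinearMap.finrank_range_of_inj h, Module.finrank_fin_fun]

/-- If the sketch nearly preserves the Gram matrix of `U`, then the squared row lengths of `A R⁻¹`
nearly equal the leverage scores. -/
theorem abs_row_sub_score_le {r : ℕ}
    {orth : (r d : ℕ) → Matrix (Fin r) (Fin d) ℝ → Matrix (Fin d) (Fin d) ℝ}
    (ho : IsOrthogonalizer orth) {A : Matrix (Fin n) (Fin d) ℝ} (S : ThinSVD A)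
    (P : Matrix (Fin r) (Fin n) ℝ) {δ : ℝ} (hP : ‖(P * S.U)ᵀ * (P * S.U) - 1‖ ≤ δ)
    (hδ : δ ≤ 1 / 2) (i : Fin n) :
    |∑ j, (A * orth r d (P * A)) i j ^ 2 - S.score i| ≤ 2 * δ * S.score i := by
  set G := (P * S.U)ᵀ * (P * S.U) with hG
  set C := Matrix.diagonal S.σ * S.Vᵀ with hC
  have hA : A = S.U * C := by rw [hC, ← Matrix.mul_assoc]; exact S.eq
  have hCinj : ∀ x, C *ᵥ x = 0 → x = 0 := by
    intro x hx
    have h₁ : S.V * Matrix.diagonal (fun j => (S.σ j)⁻¹) * C = 1 := by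
      have : Matrix.diagonal (fun j => (S.σ j)⁻¹) * Matrix.diagonal S.σ = 1 := by
        rw [Matrix.diagonal_mul_diagonal, ← Matrix.diagonal_one]
        congr 1
        funext j
        exact inv_mul_cancel₀ (S.pos j).ne'
      rw [hC, Matrix.mul_assoc, ← Matrix.mul_assoc _ (Matrix.diagonal S.σ), this, Matrix.one_mul]
      exact mul_eq_one_comm.1 S.orthV
    calc x = (S.V * Matrix.diagonal (fun j => (S.σ j)⁻¹) * C) *ᵥ x := by
          rw [h₁, Matrix.one_mulVec]
      _ = 0 := by rw [← Matrix.mulVec_mulVec, hx, Matrix.mulVec_zero]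
  have hrank : (P * A).rank = d := by
    refine rank_eq_of_injective fun x hx => hCinj x ?_
    set y := C *ᵥ x with hy
    have hPy : (P * S.U) *ᵥ y = 0 := by
      rw [hy, Matrix.mulVec_mulVec, Matrix.mul_assoc, ← hA, hx]
    have hGy : G *ᵥ y = 0 := by rw [hG, ← Matrix.mulVec_mulVec, hPy, Matrix.mulVec_zero]
    have h₁ := mulVec_dotProduct_self_le (G - 1) y
    rw [Matrix.sub_mulVec, hGy, Matrix.one_mulVec, zero_sub, neg_dotProduct_neg] at h₁
    have h₀ : 0 ≤ y ⬝ᵥ y := sum_nonneg fun _ _ => mul_self_nonneg _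
    have h₂ : ‖G - 1‖ ^ 2 ≤ (1 / 2) ^ 2 := pow_le_pow_left₀ (norm_nonneg _) (hP.trans hδ) 2
    have h₃ : y ⬝ᵥ y = 0 := by nlinarith
    exact dotProduct_self_eq_zero.1 h₃
  set M := C * orth r d (P * A) with hM
  have hBM : P * A * orth r d (P * A) = P * S.U * M := by
    conv_lhs => enter [1]; rw [hA]
    rw [hM]; simp only [Matrix.mul_assoc]
  have hMG : Mᵀ * G * M = 1 := by
    have := ho r d (P * A) hrank
    rw [hBM, Matrix.transpose_mul] at this
    rw [← this, hG]
    simp only [Matrix.mul_assoc]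
  have h := abs_transpose_mulVec_sub_le hMG hP hδ (S.U i)
  have e₁ : ∀ j, (A * orth r d (P * A)) i j = (S.U i ᵥ* M) j := by
    intro j
    have : A * orth r d (P * A) = S.U * M := by
      conv_lhs => enter [1]; rw [hA]
      rw [hM]; simp only [Matrix.mul_assoc]
    rw [this]; rfl
  have e₂ : S.score i = S.U i ⬝ᵥ S.U i := by
    simp [ThinSVD.score, dotProduct, sq]
  have e₃ : ∑ j, (A * orth r d (P * A)) i j ^ 2 = (S.U i ᵥ* M) ⬝ᵥ (S.U i ᵥ* M) := by
    simp only [e₁, dotProduct, sq]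
  rwa [e₂, e₃]

theorem score_nonneg {A : Matrix (Fin n) (Fin d) ℝ} (S : ThinSVD A) (i : Fin n) :
    0 ≤ S.score i := sum_nonneg fun _ _ => sq_nonneg _

/-- The estimates are accurate unless the transform fails to flatten the rows, or the row sample
fails to preserve the Gram matrix, or the sparse projection distorts one of the `n` rows. -/
theorem probability_estimates {r₁ r₂ k : ℕ} {ε : ℝ}
    {orth : (r d : ℕ) → Matrix (Fin r) (Fin d) ℝ → Matrix (Fin d) (Fin d) ℝ}
    (ho : IsOrthogonalizer orth) {A : Matrix (Fin n) (Fin d) ℝ} (S : ThinSVD A)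
    (hd : 1 ≤ d) (hdn : d ≤ n) (hn : 2 ≤ n) (hε : 0 < ε) (hε1 : ε ≤ 1 / 2)
    (hr₁ : 0 < r₁) (hr₂ : 0 < r₂) (hk : d ≤ 2 ^ 2 ^ k)
    (h₁ : 16 * 2 ^ k * (12 * Nat.clog 2 n * d) * 1600 ≤ (ε / 8) ^ 2 * r₁)
    (h₂ : n * (2 * Real.exp (-((ε / 8) ^ 2 * r₂ / 9216))) ≤ 1 / 20) :
    𝔼 ω : Draws (2 ^ Nat.clog 2 n) r₁ d r₂,
      (if ∀ i, |S.score i - estimates orth A r₁ r₂ ω i| ≤ ε * S.score i then 0 else 1 : ℝ) ≤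
        1 / 5 := by
  classical
  have : NeZero d := ⟨by omega⟩
  set flat : (Fin (2 ^ Nat.clog 2 n) → Bool) → Prop := fun b =>
    ∀ aj : Fin (2 ^ Nat.clog 2 n) × Fin d, mixedRow S.U b aj.1 aj.2 ^ 2 ≤ 12 * Nat.clog 2 n
    with hflat
  set embed : (Fin (2 ^ Nat.clog 2 n) → Bool) → (Fin r₁ → Fin (2 ^ Nat.clog 2 n)) → Prop :=
    fun b s => ‖∑ t, (Matrix.vecMulVec (mixedRow S.U b (s t)) (mixedRow S.U b (s t)) - 1)‖ ≤
      Fintype.card (Fin r₁) * (ε / 8) with hembed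
  set W : (Fin (2 ^ Nat.clog 2 n) → Bool) → (Fin r₁ → Fin (2 ^ Nat.clog 2 n)) → Fin n →
    Fin d → ℝ := fun b s i j => (A * orth r₁ d (srht n b s * A)) i j with hW
  set proj : (Fin (2 ^ Nat.clog 2 n) → Bool) → (Fin r₁ → Fin (2 ^ Nat.clog 2 n)) →
    (Fin d → Fin r₂ → Fin 6) → Prop := fun b s x => ∀ i,
      |∑ t, (∑ j, W b s i j * sparseSign x j t) ^ 2 - ∑ j, W b s i j ^ 2| ≤
        ε / 8 * ∑ j, W b s i j ^ 2 with hproj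
  have key : ∀ b s x, embed b s → proj b s x →
      ∀ i, |S.score i - estimates orth A r₁ r₂ (b, s, x) i| ≤ ε * S.score i := by
    intro b s x hbs hx i
    have e : estimates orth A r₁ r₂ (b, s, x) i = ∑ t, (∑ j, W b s i j * sparseSign x j t) ^ 2 := by
      simp only [estimates, hW]
      exact sum_congr rfl fun t _ => by rw [Matrix.mul_apply]
    have h₃ := abs_le.1 (hx i)
    have h₄ := abs_le.1 (abs_row_sub_score_le ho S (srht n b s)
      (norm_srht_gram_sub_one_le hr₁ S.U b s hbs) (by linarith) i)
    rw [e]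
    have hsc := score_nonneg S i
    set q := ∑ j, W b s i j ^ 2
    have hq : ε / 8 * q ≤ ε / 8 * (2 * S.score i) := by
      gcongr
      nlinarith [h₄.2]
    rw [abs_le]
    constructor <;> nlinarith [h₃.1, h₃.2, h₄.1, h₄.2, mul_nonneg hε.le hsc]
  -- The row sample is controlled only for signs that flatten the rows.
  have hpt : ∀ b s x,
      (if ∀ i, |S.score i - estimates orth A r₁ r₂ (b, s, x) i| ≤ ε * S.score i
        then 0 else 1 : ℝ) ≤ (if flat b then 0 else 1) +
          ((if flat b then 1 else 0) * (if embed b s then 0 else 1) +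
            if proj b s x then 0 else 1) := by
    intro b s x
    by_cases hb : flat b <;> by_cases hs : embed b s <;> by_cases hx : proj b s x <;>
      simp only [hb, hs, hx, if_true, if_false]
    all_goals first
      | rw [if_pos (key b s x hs hx)]; norm_num
      | split_ifs <;> norm_num
  have hE₂ : ∀ b, 𝔼 s, (if flat b then 1 else 0 : ℝ) * (if embed b s then 0 else 1 : ℝ) ≤
      1 / 20 := by
    intro b
    by_cases hb : flat b
    · simp only [if_pos hb, one_mul]
      refine probability_norm_sum_vecMulVec_le (L := 12 * Nat.clog 2 n * d) (mixedRow S.U b)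
        (sum_vecMulVec_mixedRow S.orthU b) (fun a => ?_) k hk (by positivity) (by linarith)
        (by simpa using hr₁) (by simpa using h₁)
      calc mixedRow S.U b a ⬝ᵥ mixedRow S.U b a = ∑ j, mixedRow S.U b a j ^ 2 := by
            simp [dotProduct, sq]
        _ ≤ ∑ _j : Fin d, (12 * Nat.clog 2 n : ℝ) := sum_le_sum fun j _ => hb (a, j)
        _ = 12 * Nat.clog 2 n * d := by simp; ring
    · simp [hb]
  have hE₃ : ∀ b s, 𝔼 x, (if proj b s x then 0 else 1 : ℝ) ≤ 1 / 20 := by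
    intro b s
    refine le_trans (le_expect_exists (fun i x =>
      |∑ t, (∑ j, W b s i j * sparseSign x j t) ^ 2 - ∑ j, W b s i j ^ 2| ≤
        ε / 8 * ∑ j, W b s i j ^ 2) fun i =>
        probability_sparseSign hr₂ (W b s i) (by positivity) (by linarith)) ?_
    simpa using h₂
  have e : 𝔼 ω : Draws (2 ^ Nat.clog 2 n) r₁ d r₂,
      (if ∀ i, |S.score i - estimates orth A r₁ r₂ ω i| ≤ ε * S.score i then 0 else 1 : ℝ) =
      𝔼 b, 𝔼 s, 𝔼 x, (if ∀ i, |S.score i - estimates orth A r₁ r₂ (b, s, x) i| ≤ ε * S.score i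
        then 0 else 1 : ℝ) := by
    rw [← univ_product_univ, expect_product]
    refine expect_congr rfl fun b _ => ?_
    rw [← univ_product_univ, expect_product]
  rw [e]
  calc _ ≤ 𝔼 b, 𝔼 s, 𝔼 x, ((if flat b then 0 else 1 : ℝ) +
          ((if flat b then 1 else 0) * (if embed b s then 0 else 1) +
            if proj b s x then 0 else 1)) :=
        expect_le_expect fun b _ => expect_le_expect fun s _ => expect_le_expect fun x _ =>
          hpt b s x
    _ = 𝔼 b, (if flat b then 0 else 1 : ℝ) +
          (𝔼 b, 𝔼 s, (if flat b then 1 else 0 : ℝ) * (if embed b s then 0 else 1 : ℝ) +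
            𝔼 b, 𝔼 s, 𝔼 x, (if proj b s x then 0 else 1 : ℝ)) := by
        simp only [expect_add_distrib, Fintype.expect_const]
    _ ≤ 1 / 20 + (1 / 20 + 1 / 20) := by
        refine add_le_add (probability_mixedRow S.orthU hdn hn) (add_le_add ?_ ?_)
        · exact expect_le univ_nonempty fun b _ => hE₂ b
        · exact expect_le univ_nonempty fun b _ => expect_le univ_nonempty fun s _ => hE₃ b s
    _ ≤ 1 / 5 := by norm_num

/-- A failure rate of at most `1 / 5`, as a statement on the probability of success. -/
theorem le_toOuterMeasure_uniform {Ω : Type} [Fintype Ω] [Nonempty Ω] (P : Ω → Prop)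
    [DecidablePred P] (h : 𝔼 ω, (if P ω then 0 else 1 : ℝ) ≤ 1 / 5) :
    (8 / 10 : ℝ≥0∞) ≤ (PMF.uniformOfFintype Ω).toOuterMeasure {ω | P ω} := by
  rw [PMF.toOuterMeasure_uniformOfFintype_apply]
  have hC : (0 : ℝ) < Fintype.card Ω := by exact_mod_cast Fintype.card_pos
  have hsum : ∑ ω, (if P ω then 0 else 1 : ℝ) = Fintype.card Ω - Fintype.card {ω | P ω} := by
    have h₁ : ∀ ω, (if P ω then 0 else 1 : ℝ) = 1 - if P ω then 1 else 0 := fun ω => by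
      split_ifs <;> norm_num
    simp only [h₁, sum_sub_distrib, sum_const, card_univ, sum_boole]
    simp [Fintype.card_subtype]
  rw [Fintype.expect_eq_sum_div_card, div_le_iff₀ hC, hsum] at h
  have h' : 8 * Fintype.card Ω ≤ 10 * Fintype.card {ω | P ω} := by
    have : (8 * Fintype.card Ω : ℝ) ≤ 10 * Fintype.card {ω | P ω} := by linarith
    exact_mod_cast this
  have hC' : (Fintype.card Ω : ℝ≥0∞) ≠ 0 := by exact_mod_cast Fintype.card_ne_zero
  rw [ENNReal.le_div_iff_mul_le (.inl hC') (.inl (ENNReal.natCast_ne_top _)),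
    div_eq_mul_inv, mul_right_comm, ← div_eq_mul_inv]
  refine ENNReal.div_le_of_le_mul ?_
  rw [mul_comm _ (10 : ℝ≥0∞)]
  exact_mod_cast h'

theorem abs_iSup_sub_iSup_le (hn : 0 < n) {f g : Fin n → ℝ} {ε : ℝ} (hε : 0 ≤ ε)
    (h : ∀ i, |f i - g i| ≤ ε * f i) : |(⨆ i, f i) - ⨆ i, g i| ≤ ε * ⨆ i, f i := by
  have : Nonempty (Fin n) := ⟨⟨0, hn⟩⟩
  have hf : ∀ i, f i ≤ ⨆ i, f i := fun i => le_ciSup (Set.finite_range f).bddAbove i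
  have hg : ∀ i, g i ≤ ⨆ i, g i := fun i => le_ciSup (Set.finite_range g).bddAbove i
  have h₁ : ∀ i, ε * f i ≤ ε * ⨆ i, f i := fun i => mul_le_mul_of_nonneg_left (hf i) hε
  have h₂ : ⨆ i, f i ≤ (⨆ i, g i) + ε * ⨆ i, f i :=
    ciSup_le fun i => by linarith [(abs_le.1 (h i)).2, h₁ i, hg i]
  have h₃ : ⨆ i, g i ≤ (⨆ i, f i) + ε * ⨆ i, f i :=
    ciSup_le fun i => by linarith [(abs_le.1 (h i)).1, h₁ i, hf i]
  rw [abs_le]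
  constructor <;> linarith

end Accuracy

end Leverage

/-! ### The program: sizes and random draws -/

namespace RealRAM

theorem Ends.setNat_seq {a : ℕ} {i j x : NExpr} {q : Prog} {s : Memory} {T : ℕ}
    {Q : Memory → Prop}
    (h : Ends q { s with nat := write s.nat a (i.eval s) (j.eval s) (x.eval s) } T Q) :
    Ends (.seq (.setNat a i j x) q) s (T + 2) Q := by
  have h1 : Ends (.setNat a i j x) s 1 fun s' =>
      s' = { s with nat := write s.nat a (i.eval s) (j.eval s) (x.eval s) } :=
    ends_setNat _ _ _ _ _ rfl
  refine (Ends.seq h1 (U := T) (Q := Q) ?_).mono (by omega) fun _ h => h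
  rintro _ rfl
  exact h

/-- Compute the least power of two that is at least `x`, its exponent and, if the exponent is
positive, half of that power, in the variables `y`, `l` and `z`. -/
def Prog.clog (x : NExpr) (y l z : ℕ) : Prog :=
  .seq (.letNat y (.lit 1)) (.seq (.letNat l (.lit 0))
    (.loop (.natLt (.var y) x)
      (.seq (.letNat z (.var y)) (.seq (.letNat y (.plus (.var y) (.var y)))
        (.letNat l (.plus (.var l) (.lit 1)))))))

theorem ends_clog {x : NExpr} {y l z : ℕ} {s : Memory} (X : ℕ) (hyl : y ≠ l) (hyz : y ≠ z)
    (hlz : l ≠ z)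
    (hx : ∀ s' : Memory, (∀ b, b ≠ y → b ≠ l → b ≠ z → s'.nat b = s.nat b) → x.eval s' = X) :
    Ends (.clog x y l z) s (Nat.clog 2 X * 6 + 5) fun s' =>
      s'.nat y 0 0 = 2 ^ Nat.clog 2 X ∧ s'.nat l 0 0 = Nat.clog 2 X ∧
      (0 < Nat.clog 2 X → s'.nat z 0 0 = 2 ^ (Nat.clog 2 X - 1)) ∧
      (∀ b, b ≠ y → b ≠ l → b ≠ z → s'.nat b = s.nat b) ∧ s'.real = s.real := by
  refine Ends.mono (Ends.setNat_seq (Ends.setNat_seq (ends_loop (Nat.clog 2 X) 5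
    (fun k s' => s'.nat y 0 0 = 2 ^ k ∧ s'.nat l 0 0 = k ∧
      (0 < k → s'.nat z 0 0 = 2 ^ (k - 1)) ∧
      (∀ b, b ≠ y → b ≠ l → b ≠ z → s'.nat b = s.nat b) ∧ s'.real = s.real) ?_ ?_ ?_)))
    (by omega) fun _ h => h
  · rintro k - s' ⟨hy, -, -, hb, -⟩
    simp only [Test.Holds, NExpr.eval, hy, hx s' hb]
    exact (Nat.lt_clog_iff_pow_lt (by norm_num)).symm
  · rintro k - s' ⟨hy, hl, -, hb, hr⟩
    refine Ends.mono (Ends.setNat_seq (Ends.setNat_seq (ends_setNat _ _ _ _ _ ?_))) le_rfl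
      fun _ h => h
    simp only [NExpr.eval]
    refine ⟨?_, ?_, fun _ => ?_, fun b h₁ h₂ h₃ => ?_, hr⟩
    · simp [write, hyl, hyz, hy, pow_succ, mul_two]
    · simp [write, hyl.symm, hlz, hl]
    · simp [write, hyz.symm, hlz.symm, hy]
    · rw [write_of_ne _ h₂, write_of_ne _ h₁, write_of_ne _ h₃, hb b h₁ h₂ h₃]
  · refine ⟨?_, ?_, fun h => absurd h (lt_irrefl _), fun b h₁ h₂ h₃ => ?_, rfl⟩
    · simp [write, NExpr.eval, hyl]
    · simp [write, NExpr.eval]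
    · exact (write_of_ne _ h₂ _ _ _).trans (write_of_ne _ h₁ _ _ _)

/-- Compute `m * x` in the variable `z` by repeated addition. -/
def Prog.mul (m x : NExpr) (z : ℕ) : Prog :=
  .seq (.letNat z (.lit 0)) (.forLoop 20 m (.letNat z (.plus (.var z) x)))

theorem ends_mul {m x : NExpr} {z : ℕ} {s : Memory} (M X : ℕ) (hz : z ≠ 20)
    (h : ∀ s' : Memory, (∀ b, b ≠ 20 → b ≠ z → s'.nat b = s.nat b) →
      m.eval s' = M ∧ x.eval s' = X) :
    Ends (.mul m x z) s (M * 4 + 5) fun s' =>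
      s'.nat z 0 0 = M * X ∧ (∀ b, b ≠ 20 → b ≠ z → s'.nat b = s.nat b) ∧ s'.real = s.real := by
  refine Ends.mono (Ends.setNat_seq (ends_forLoop M 1
    (fun k s' => s'.nat z 0 0 = k * X ∧ (∀ b, b ≠ 20 → b ≠ z → s'.nat b = s.nat b) ∧
      s'.real = s.real) (by simpa [Prog.KeepsNat] using hz.symm) ?_ ?_ ?_ ?_)) (by omega)
    fun _ h => h
  · rintro k s' v ⟨h₁, h₂, h₃⟩
    refine ⟨?_, fun b hb hb' => ?_, h₃⟩
    · rw [Memory.setVar_nat_of_ne _ hz, h₁]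
    · rw [Memory.setVar_nat_of_ne _ hb, h₂ b hb hb']
  · rintro k - s' ⟨-, h₂, -⟩
    exact (h s' h₂).1
  · rintro k - s' ⟨h₁, h₂, h₃⟩ -
    refine ends_setNat _ _ _ _ _ ⟨?_, fun b hb hb' => ?_, h₃⟩
    · simp [write, NExpr.eval, h₁, (h s' h₂).2, Nat.succ_mul]
    · exact (write_of_ne _ hb' _ _ _).trans (h₂ b hb hb')
  · refine ⟨?_, fun b _ hb' => write_of_ne _ hb' _ _ _, rfl⟩
    simp [write, NExpr.eval]

/-- Compute the least `e` with `1 ≤ e * ε ^ 2` in the variable `z`, where `ε` is the real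
variable `1`. -/
def Prog.invSq (z : ℕ) : Prog :=
  .seq (.letNat z (.lit 0))
    (.loop (.realLt (.times (.ofNat (.var z)) (.times (.var 1) (.var 1))) (.ofNat (.lit 1)))
      (.letNat z (.plus (.var z) (.lit 1))))

theorem ends_invSq {z : ℕ} {s : Memory} {ε : ℝ} (hε : 0 < ε) (hs : s.real 1 0 0 = ε) :
    Ends (.invSq z) s (⌈1 / ε ^ 2⌉₊ * 2 + 3) fun s' =>
      s'.nat z 0 0 = ⌈1 / ε ^ 2⌉₊ ∧ (∀ b, b ≠ z → s'.nat b = s.nat b) ∧ s'.real = s.real := by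
  refine Ends.mono (Ends.setNat_seq (ends_loop ⌈1 / ε ^ 2⌉₊ 1
    (fun k s' => s'.nat z 0 0 = k ∧ (∀ b, b ≠ z → s'.nat b = s.nat b) ∧ s'.real = s.real)
    ?_ ?_ ?_)) (by omega) fun _ h => h
  · rintro k - s' ⟨h₁, -, h₃⟩
    simp only [Test.Holds, RExpr.eval, NExpr.eval, h₁, h₃, hs]
    rw [Nat.lt_ceil, lt_div_iff₀ (by positivity), ← sq]
    norm_num
  · rintro k - s' ⟨h₁, h₂, h₃⟩
    refine ends_setNat _ _ _ _ _ ⟨?_, fun b hb => ?_, h₃⟩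
    · simp [write, NExpr.eval, h₁]
    · exact (write_of_ne _ hb _ _ _).trans (h₂ b hb)
  · exact ⟨by simp [write, NExpr.eval], fun b hb => write_of_ne _ hb _ _ _, rfl⟩

/-- Compute `2 ^ k * x` in the variable `z` by doubling. -/
def Prog.shift (z : ℕ) (x : NExpr) : ℕ → Prog
  | 0 => .letNat z x
  | k + 1 => .seq (shift z x k) (.letNat z (.plus (.var z) (.var z)))

theorem ends_shift (s : Memory) (z : ℕ) (x : NExpr) (k : ℕ) :
    Ends (.shift z x k) s (2 * k + 1) fun s' => s' = s.setVar z (2 ^ k * x.eval s) := by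
  induction k with
  | zero => exact ends_setNat _ _ _ _ _ (by simp [Memory.setVar, NExpr.eval])
  | succ k ih =>
    refine (Ends.seq ih (U := 1) ?_).mono (by omega) fun _ h => h
    rintro _ rfl
    refine ends_setNat _ _ _ _ _ ?_
    simp only [NExpr.eval, Memory.setVar]
    congr 1
    funext a i j
    simp only [write, and_self, if_true]
    split_ifs
    · ring
    · rfl

end RealRAM

namespace Leverage

open RealRAM

/-- The product of the dimension and of discrete versions of `ln n` and `ε⁻²`. -/
noncomputable def baseSize (n d : ℕ) (ε : ℝ) : ℕ := d * (⌈1 / ε ^ 2⌉₊ * Nat.clog 2 n)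

/-- The number of columns of the sparse sign matrix. -/
noncomputable def projSize (n : ℕ) (ε : ℝ) : ℕ := 2 ^ 22 * (⌈1 / ε ^ 2⌉₊ * Nat.clog 2 n)

/-- The number of rows of the subsampled randomized Hadamard transform. -/
noncomputable def sketchSize (n d : ℕ) (ε : ℝ) : ℕ :=
  2 ^ 26 * (Nat.clog 2 (baseSize n d ε) * baseSize n d ε)

/-- Compute the sizes: `2 ^ ⌈log₂ n⌉`, `⌈log₂ n⌉` and `2 ^ (⌈log₂ n⌉ - 1)` in the variables `2`,
`3`, `4`, the number of columns of the sparse sign matrix in `13` and the number of sampled rows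
in `14`. -/
def sizeProg : Prog :=
  .seq (.clog (.var 0) 2 3 4) (.seq (.invSq 5) (.seq (.mul (.var 5) (.var 3) 6)
    (.seq (.mul (.var 1) (.var 6) 7) (.seq (.clog (.var 7) 8 9 16)
      (.seq (.mul (.var 9) (.var 7) 15) (.seq (.shift 13 (.var 6) 22)
        (.shift 14 (.var 15) 26)))))))

/-- A bound for the running time of `sizeProg`. -/
noncomputable def sizeTime (n d : ℕ) (ε : ℝ) : ℕ :=
  Nat.clog 2 n * 6 + ⌈1 / ε ^ 2⌉₊ * 6 + d * 4 + Nat.clog 2 (baseSize n d ε) * 10 + 140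

theorem ends_sizeProg {n d : ℕ} {ε : ℝ} (hn : 2 ≤ n) (hε : 0 < ε) {s : Memory}
    (h0 : s.nat 0 0 0 = n) (h1 : s.nat 1 0 0 = d) (hr : s.real 1 0 0 = ε) :
    Ends sizeProg s (sizeTime n d ε) fun s' =>
      s'.nat 0 0 0 = n ∧ s'.nat 1 0 0 = d ∧ s'.nat 2 0 0 = 2 ^ Nat.clog 2 n ∧
      s'.nat 3 0 0 = Nat.clog 2 n ∧ s'.nat 4 0 0 = 2 ^ (Nat.clog 2 n - 1) ∧
      s'.nat 13 0 0 = projSize n ε ∧ s'.nat 14 0 0 = sketchSize n d ε ∧ s'.real = s.real := by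
  have hK : 0 < Nat.clog 2 n := Nat.clog_pos (by norm_num) hn
  set K := Nat.clog 2 n with hKdef
  set E := ⌈1 / ε ^ 2⌉₊ with hE
  set L := Nat.clog 2 (baseSize n d ε) with hL
  refine Ends.mono (T := (K * 6 + 5) + ((E * 2 + 3) + ((E * 4 + 5) + ((d * 4 + 5) + ((L * 6 + 5) +
    ((L * 4 + 5) + (45 + 53 + 1) + 1) + 1) + 1) + 1) + 1) + 1) ?_
    (by simp only [sizeTime, ← hKdef, ← hE, ← hL]; omega) fun _ h => h
  refine Ends.seq (ends_clog n (by norm_num) (by norm_num) (by norm_num)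
    fun s' h => by simp only [NExpr.eval]; rw [h 0 (by norm_num) (by norm_num) (by norm_num), h0])
    ?_
  rintro s₁ ⟨hN, hK₁, hM, hb, hs₁⟩
  refine Ends.seq (ends_invSq hε (by rw [hs₁, hr])) ?_
  rintro s₂ ⟨hE₂, hb₂, hs₂⟩
  have k2 : s₂.nat 3 0 0 = K := by rw [hb₂ 3 (by norm_num), hK₁]
  refine Ends.seq (ends_mul E K (by norm_num) fun s' h => ?_) ?_
  · simp only [NExpr.eval]
    rw [h 5 (by norm_num) (by norm_num), h 3 (by norm_num) (by norm_num), hE₂, k2]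
    exact ⟨rfl, rfl⟩
  rintro s₃ ⟨hW, hb₃, hs₃⟩
  have d3 : s₃.nat 1 0 0 = d := by
    rw [hb₃ 1 (by norm_num) (by norm_num), hb₂ 1 (by norm_num),
      hb 1 (by norm_num) (by norm_num) (by norm_num), h1]
  refine Ends.seq (ends_mul d (E * K) (by norm_num) fun s' h => ?_) ?_
  · simp only [NExpr.eval]
    rw [h 1 (by norm_num) (by norm_num), h 6 (by norm_num) (by norm_num), d3, hW]
    exact ⟨rfl, rfl⟩
  rintro s₄ ⟨hX, hb₄, hs₄⟩
  refine Ends.seq (ends_clog (baseSize n d ε) (by norm_num) (by norm_num) (by norm_num)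
    fun s' h => ?_) ?_
  · simp only [NExpr.eval]
    rw [h 7 (by norm_num) (by norm_num) (by norm_num), hX]
    rfl
  rintro s₅ ⟨-, hL₅, -, hb₅, hs₅⟩
  refine Ends.seq (T := L * 4 + 5) (U := 45 + 53 + 1)
    (ends_mul (z := 15) L (baseSize n d ε) (by norm_num) fun s' h => ?_) ?_
  · simp only [NExpr.eval]
    rw [h 9 (by norm_num) (by norm_num), h 7 (by norm_num) (by norm_num), hL₅,
      hb₅ 7 (by norm_num) (by norm_num) (by norm_num), hX]
    exact ⟨rfl, rfl⟩
  rintro s₆ ⟨hQ, hb₆, hs₆⟩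
  have hold : ∀ b, b < 7 → b ≠ 6 → b ≠ 5 → s₆.nat b = s₁.nat b := by
    intro b h₁ h₂ h₃
    rw [hb₆ b (by omega) (by omega), hb₅ b (by omega) (by omega) (by omega),
      hb₄ b (by omega) (by omega), hb₃ b (by omega) (by omega), hb₂ b (by omega)]
  have hW₆ : s₆.nat 6 0 0 = E * K := by
    rw [hb₆ 6 (by omega) (by omega), hb₅ 6 (by omega) (by omega) (by omega),
      hb₄ 6 (by omega) (by omega), hW]
  refine Ends.seq (ends_shift s₆ 13 (.var 6) 22) ?_
  rintro _ rfl
  refine (ends_shift _ 14 (.var 15) 26).mono le_rfl ?_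
  rintro _ rfl
  have hkeep : ∀ b, b ≠ 13 → b ≠ 14 → ∀ v w, ((s₆.setVar 13 v).setVar 14 w).nat b = s₆.nat b :=
    fun b h₁ h₂ v w => by rw [Memory.setVar_nat_of_ne _ h₂, Memory.setVar_nat_of_ne _ h₁]
  refine ⟨?_, ?_, ?_, ?_, ?_, ?_, ?_, ?_⟩
  · rw [hkeep 0 (by norm_num) (by norm_num), hold 0 (by norm_num) (by norm_num) (by norm_num),
      hb 0 (by norm_num) (by norm_num) (by norm_num), h0]
  · rw [hkeep 1 (by norm_num) (by norm_num), hold 1 (by norm_num) (by norm_num) (by norm_num),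
      hb 1 (by norm_num) (by norm_num) (by norm_num), h1]
  · rw [hkeep 2 (by norm_num) (by norm_num), hold 2 (by norm_num) (by norm_num) (by norm_num), hN]
  · rw [hkeep 3 (by norm_num) (by norm_num), hold 3 (by norm_num) (by norm_num) (by norm_num), hK₁]
  · rw [hkeep 4 (by norm_num) (by norm_num), hold 4 (by norm_num) (by norm_num) (by norm_num),
      hM hK]
  · rw [Memory.setVar_nat_of_ne _ (by norm_num), Memory.setVar_nat_self]
    simp only [NExpr.eval, hW₆]
    rfl
  · rw [Memory.setVar_nat_self]
    simp only [NExpr.eval]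
    rw [Memory.setVar_nat_of_ne _ (by norm_num), hQ]
    rfl
  · exact hs₆.trans (hs₅.trans (hs₄.trans (hs₃.trans (hs₂.trans hs₁))))

/-- Draw the signs, the sampled rows and the entries of the sparse sign matrix into the arrays
`10`, `11` and `12`. -/
def drawProg : Prog :=
  .seq (.drawTable 10 (.var 2) (.lit 1) (.lit 2)) (.seq (.drawTable 11 (.var 14) (.lit 1) (.var 2))
    (.drawTable 12 (.var 1) (.var 13) (.lit 6)))

/-- The running time of `drawProg`. -/
def drawProgTime (N r₁ d r₂ : ℕ) : ℕ :=
  1 + drawTime N 1 + (1 + drawTime r₁ 1 + drawTime d r₂)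

/-- The outcomes of `drawProg` encode the random choices of the algorithm. -/
def drawsEquiv (N r₁ d r₂ : ℕ) :
    (Fin N → Fin 1 → Fin 2) × (Fin r₁ → Fin 1 → Fin N) × (Fin d → Fin r₂ → Fin 6) ≃
      Draws N r₁ d r₂ :=
  Equiv.prodCongr (Equiv.arrowCongr (Equiv.refl _)
      ((Equiv.funUnique (Fin 1) (Fin 2)).trans finTwoEquiv))
    (Equiv.prodCongr (Equiv.arrowCongr (Equiv.refl _) (Equiv.funUnique (Fin 1) (Fin N)))
      (Equiv.refl _))

theorem yields_equiv {α β : Type} [Fintype α] [Nonempty α] [Fintype β] [Nonempty β] (e : α ≃ β)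
    {p : Prog} {s : Memory} {t : ℕ} {Q : β → Memory → Prop}
    (h : Yields p s t α fun a => Q (e a)) : Yields p s t β Q := by
  obtain ⟨g, hg, hQ⟩ := h
  refine ⟨fun b => g (e.symm b), fun k => ?_, fun b => by simpa using hQ (e.symm b)⟩
  rw [hg, ← uniform_map_equiv e, PMF.map_comp]
  congr 1
  funext a
  simp

theorem yields_drawProg {k r₁ d r₂ : ℕ} {s : Memory} (hN : s.nat 2 0 0 = 2 ^ k)
    (hd : s.nat 1 0 0 = d) (hr₁ : s.nat 14 0 0 = r₁) (hr₂ : s.nat 13 0 0 = r₂) :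
    Yields drawProg s (drawProgTime (2 ^ k) r₁ d r₂) (Draws (2 ^ k) r₁ d r₂) fun ω s' =>
      (∀ i : Fin (2 ^ k), s'.nat 10 i 0 = if ω.1 i then 1 else 0) ∧
      (∀ t : Fin r₁, s'.nat 11 t 0 = ω.2.1 t) ∧
      (∀ (j : Fin d) (t : Fin r₂), s'.nat 12 j t = ω.2.2 j t) ∧
      (∀ b, b < 20 → b ≠ 10 → b ≠ 11 → b ≠ 12 → s'.nat b = s.nat b) ∧ s'.real = s.real := by
  refine yields_equiv (drawsEquiv (2 ^ k) r₁ d r₂) ?_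
  refine Yields.mono (Yields.seq
    (yields_drawTable (a := 10) (2 ^ k) 1 2 (by norm_num) fun s' h => ?_)
    (Q := fun (f : Fin (2 ^ k) → Fin 1 → Fin 2)
      (x : (Fin r₁ → Fin 1 → Fin (2 ^ k)) × (Fin d → Fin r₂ → Fin 6)) s' =>
      (∀ i : Fin (2 ^ k), s'.nat 10 i 0 = f i 0) ∧
      (∀ t : Fin r₁, s'.nat 11 t 0 = x.1 t 0) ∧
      (∀ (j : Fin d) (t : Fin r₂), s'.nat 12 j t = x.2 j t) ∧
      (∀ b, b < 20 → b ≠ 10 → b ≠ 11 → b ≠ 12 → s'.nat b = s.nat b) ∧ s'.real = s.real) ?_) ?_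
  · simp [NExpr.eval, h 2 (by norm_num) (by norm_num) (by norm_num), hN]
  · rintro f s₁ ⟨h₁, h₁', h₁''⟩
    refine Yields.seq (yields_drawTable (a := 11) r₁ 1 (2 ^ k) (by norm_num) fun s' h => ?_)
      (Q := fun (g : Fin r₁ → Fin 1 → Fin (2 ^ k)) (x : Fin d → Fin r₂ → Fin 6) s' =>
      (∀ i : Fin (2 ^ k), s'.nat 10 i 0 = f i 0) ∧
      (∀ t : Fin r₁, s'.nat 11 t 0 = g t 0) ∧
      (∀ (j : Fin d) (t : Fin r₂), s'.nat 12 j t = x j t) ∧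
      (∀ b, b < 20 → b ≠ 10 → b ≠ 11 → b ≠ 12 → s'.nat b = s.nat b) ∧ s'.real = s.real) ?_
    · simp [NExpr.eval, h 2 (by norm_num) (by norm_num) (by norm_num),
        h 14 (by norm_num) (by norm_num) (by norm_num),
        h₁' 2 (by norm_num) (by norm_num) (by norm_num),
        h₁' 14 (by norm_num) (by norm_num) (by norm_num), hN, hr₁]
    · rintro g s₂ ⟨h₂, h₂', h₂''⟩
      refine Yields.mono (yields_drawTable (a := 12) d r₂ 6 (by norm_num) fun s' h => ?_) ?_
      · simp [NExpr.eval, h 1 (by norm_num) (by norm_num) (by norm_num),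
          h 13 (by norm_num) (by norm_num) (by norm_num),
          h₂' 1 (by norm_num) (by norm_num) (by norm_num),
          h₂' 13 (by norm_num) (by norm_num) (by norm_num),
          h₁' 1 (by norm_num) (by norm_num) (by norm_num),
          h₁' 13 (by norm_num) (by norm_num) (by norm_num), hd, hr₂]
      · rintro x s₃ ⟨h₃, h₃', h₃''⟩
        refine ⟨fun i => ?_, fun t => ?_, h₃, fun b hb₀ hb hb' hb'' => ?_, ?_⟩
        · rw [h₃' 10 (by norm_num) (by norm_num) (by norm_num),
            h₂' 10 (by norm_num) (by norm_num) (by norm_num)]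
          exact h₁ i 0
        · rw [h₃' 11 (by norm_num) (by norm_num) (by norm_num)]
          exact h₂ t 0
        · rw [h₃' b (by omega) (by omega) hb'', h₂' b (by omega) (by omega) hb',
            h₁' b (by omega) (by omega) hb]
        · rw [h₃'', h₂'', h₁'']
  · rintro ⟨f, g, x⟩ s' ⟨h₁, h₂, h₃, h₄, h₅⟩
    refine ⟨fun i => ?_, fun t => h₂ t, h₃, h₄, h₅⟩
    rw [h₁ i]
    have hv : ∀ v : Fin 2, (v : ℕ) = if finTwoEquiv v then 1 else 0 := by decide
    exact hv (f i 0)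

end Leverage

/-! ### The program: the deterministic computation -/

namespace RealRAM

/-- The running time of a table computation. -/
def tableTime (Mi Mj Mk : ℕ) : ℕ := Mi * (Mj * (Mk * 4 + 10) + 6) + 3

/-- The memories `s` and `s'` agree outside the array `a` and the auxiliary variables of a table
computation. -/
structure Near (a : ℕ) (s s' : Memory) : Prop where
  nat : ∀ b, b ≠ 20 → b ≠ 21 → b ≠ 22 → s'.nat b = s.nat b
  real : ∀ b, b ≠ 20 → b ≠ a → s'.real b = s.real b

/-- Fill the rectangle of entries `(i, j)` with `i < mi` and `j < mj`. -/
abbrev Prog.rect (a : ℕ) (mi mj mk : NExpr) (term : RExpr) : Prog :=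
  .table a mi mj mk (.var 20) (.var 21) term

theorem ends_rect {a : ℕ} {mi mj mk : NExpr} {term : RExpr} {s : Memory}
    (Mi Mj Mk : ℕ) (f : ℕ → ℕ → ℕ → ℝ) (ha : a ≠ 20)
    (hmi : ∀ s', Near a s s' → mi.eval s' = Mi) (hmj : ∀ s', Near a s s' → mj.eval s' = Mj)
    (hmk : ∀ s', Near a s s' → mk.eval s' = Mk)
    (hterm : ∀ s', Near a s s' → ∀ i < Mi, ∀ j < Mj, ∀ k < Mk, s'.nat 20 0 0 = i →
      s'.nat 21 0 0 = j → s'.nat 22 0 0 = k → term.eval s' = f i j k) :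
    Ends (.rect a mi mj mk term) s (tableTime Mi Mj Mk) fun s' =>
      Near a s s' ∧ ∀ i < Mi, ∀ j < Mj, s'.real a i j = ∑ k ∈ Finset.range Mk, f i j k := by
  have hnear : ∀ s', Agree a (fun _ _ => True) s s' → Near a s s' := fun s' h => ⟨h.nat, h.real⟩
  refine Ends.mono (ends_table Mi Mj Mk id id f (fun _ _ => True) ha Function.injective_id
    Function.injective_id (fun _ _ _ _ => trivial) (fun s' h => hmi s' (hnear s' h))
    (fun s' h => hmj s' (hnear s' h)) (fun s' h => hmk s' (hnear s' h)) (fun s' _ => rfl)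
    (fun s' _ => rfl) fun s' h hi hj hk => hterm s' (hnear s' h) _ hi _ hj _ hk rfl rfl rfl)
    le_rfl ?_
  rintro s' ⟨h, h'⟩
  exact ⟨hnear s' h, h'⟩

end RealRAM

namespace Leverage

open RealRAM

/-- Multiply the rows of the input matrix by the signs. -/
def signStage : Prog :=
  .rect 4 (.var 2) (.var 1) (.lit 1)
    (.times (.minus (.plus (.ofNat (.get 10 (.var 20) (.lit 0)))
      (.ofNat (.get 10 (.var 20) (.lit 0)))) (.ofNat (.lit 1))) (.get 0 (.var 20) (.var 21)))

theorem ends_signStage {N d : ℕ} {s : Memory} (hN : s.nat 2 0 0 = N) (hd : s.nat 1 0 0 = d) :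
    Ends signStage s (tableTime N d 1) fun s' => Near 4 s s' ∧
      ∀ i < N, ∀ j < d, s'.real 4 i j =
        ((s.nat 10 i 0 : ℝ) + s.nat 10 i 0 - 1) * s.real 0 i j := by
  refine Ends.mono (ends_rect N d 1
    (fun i j _ => ((s.nat 10 i 0 : ℝ) + s.nat 10 i 0 - 1) * s.real 0 i j) (by norm_num) ?_ ?_ ?_
    ?_) le_rfl ?_
  · intro s' h; simp [NExpr.eval, h.nat, hN]
  · intro s' h; simp [NExpr.eval, h.nat, hd]
  · intro s' h; simp [NExpr.eval]
  · intro s' h i _ j _ k _ h₀ h₁ _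
    simp [RExpr.eval, NExpr.eval, h.nat, h.real, h₀, h₁]
  · rintro s' ⟨h, h'⟩
    exact ⟨h, fun i hi j hj => by rw [h' i hi j hj]; simp⟩

/-- The levels of the fast Hadamard transform, applied to the columns of `z`. -/
noncomputable def butterflies (M : ℕ) (z : ℕ → ℕ → ℝ) : ℕ → ℕ → ℕ → ℝ
  | 0 => z
  | l + 1 => fun i j =>
      if i % 2 = 0 then butterflies M z l (i / 2) j + butterflies M z l (i / 2 + M) j
      else butterflies M z l (i / 2) j - butterflies M z l (i / 2 + M) j

/-- The fast Hadamard transform.  Each level reads a block of `d` columns, which starts at the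
column stored in the variable `17`, and writes the next block. -/
def hadamardStage : Prog :=
  .seq (.letNat 17 (.lit 0)) (.forLoop 30 (.var 3)
    (.seq (.table 4 (.var 4) (.var 1) (.lit 1) (.plus (.var 20) (.var 20))
        (.plus (.plus (.var 17) (.var 1)) (.var 21))
        (.plus (.get 4 (.var 20) (.plus (.var 17) (.var 21)))
          (.get 4 (.plus (.var 20) (.var 4)) (.plus (.var 17) (.var 21)))))
      (.seq (.table 4 (.var 4) (.var 1) (.lit 1) (.plus (.plus (.var 20) (.var 20)) (.lit 1))
        (.plus (.plus (.var 17) (.var 1)) (.var 21))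
        (.minus (.get 4 (.var 20) (.plus (.var 17) (.var 21)))
          (.get 4 (.plus (.var 20) (.var 4)) (.plus (.var 17) (.var 21)))))
        (.letNat 17 (.plus (.var 17) (.var 1))))))

theorem ends_hadamardStage {K d : ℕ} {s : Memory} (z : ℕ → ℕ → ℝ) (hd : s.nat 1 0 0 = d)
    (hK : s.nat 3 0 0 = K + 1) (hM : s.nat 4 0 0 = 2 ^ K)
    (hz : ∀ i < 2 ^ (K + 1), ∀ j < d, s.real 4 i j = z i j) :
    Ends hadamardStage s ((K + 1) * (2 * tableTime (2 ^ K) d 1 + 6) + 5) fun s' =>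
      (∀ b, b < 17 → s'.nat b = s.nat b) ∧ s'.nat 17 0 0 = (K + 1) * d ∧
      (∀ b, b ≠ 20 → b ≠ 4 → s'.real b = s.real b) ∧
      ∀ i < 2 ^ (K + 1), ∀ j < d, s'.real 4 i ((K + 1) * d + j) =
        ∑ c ∈ Finset.range (2 ^ (K + 1)), hadamardEntry (K + 1) i c * z c j := by
  set Y := butterflies (2 ^ K) z with hY
  have hpow : 2 ^ (K + 1) = 2 ^ K + 2 ^ K := by ring
  refine Ends.mono (Ends.setNat_seq (ends_forLoop (K + 1) (2 * tableTime (2 ^ K) d 1 + 3)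
    (fun k s' => (∀ b, b < 17 → s'.nat b = s.nat b) ∧ s'.nat 17 0 0 = k * d ∧
      (∀ b, b ≠ 20 → b ≠ 4 → s'.real b = s.real b) ∧
      ∀ i < 2 ^ (K + 1), ∀ j < d, s'.real 4 i (k * d + j) = Y k i j) ?_ ?_ ?_ ?_ ?_)) le_rfl ?_
  · simp [Prog.KeepsNat, keepsNat_table]
  · rintro k s' v ⟨h₁, h₂, h₃, h₄⟩
    refine ⟨fun b hb => ?_, ?_, h₃, h₄⟩
    · rw [Memory.setVar_nat_of_ne _ (by omega), h₁ b hb]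
    · rw [Memory.setVar_nat_of_ne _ (by omega), h₂]
  · rintro k - s' ⟨h₁, -⟩
    simp [NExpr.eval, h₁, hK]
  · rintro k hk s₁ ⟨h₁, h₂, h₃, h₄⟩ -
    have hshift : k * d + d = (k + 1) * d := by ring
    refine Ends.mono (Ends.seq (ends_table (2 ^ K) d 1 (fun i => i + i)
      (fun j => k * d + d + j) (fun i j _ => Y k i j + Y k (i + 2 ^ K) j)
      (fun _ y => k * d + d ≤ y) (by norm_num) (fun x y h => by dsimp only at h; omega)
      (fun x y h => by dsimp only at h; omega) (fun _ _ _ _ => by omega) ?_ ?_ ?_ ?_ ?_ ?_)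
      (U := tableTime (2 ^ K) d 1 + 2) (Q := _) ?_)
      (le_of_eq (by rw [tableTime]; ring)) fun _ h => h
    · intro s' h; simp [NExpr.eval, h.nat, h₁, hM]
    · intro s' h; simp [NExpr.eval, h.nat, h₁, hd]
    · intro s' h; simp [NExpr.eval]
    · intro s' h; simp [NExpr.eval]
    · intro s' h; simp [NExpr.eval, h.nat, h₁, h₂, hd]
    · intro s' h hi hj _
      simp only [RExpr.eval, NExpr.eval]
      rw [h.nat 17 (by norm_num) (by norm_num) (by norm_num),
        h.nat 4 (by norm_num) (by norm_num) (by norm_num), h₂, h₁ 4 (by norm_num), hM,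
        h.cell _ _ (by omega), h.cell _ _ (by omega), h₄ _ (by omega) _ hj,
        h₄ _ (by omega) _ hj]
    rintro s₂ ⟨a₂, v₂⟩
    refine Ends.mono (Ends.seq (ends_table (2 ^ K) d 1 (fun i => i + i + 1)
      (fun j => k * d + d + j) (fun i j _ => Y k i j - Y k (i + 2 ^ K) j)
      (fun x y => x % 2 = 1 ∧ k * d + d ≤ y) (by norm_num)
      (fun x y h => by dsimp only at h; omega)
      (fun x y h => by dsimp only at h; omega) (fun _ _ _ _ => by omega) ?_ ?_ ?_ ?_ ?_ ?_)
      (U := 1) (Q := _) ?_)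
      (le_of_eq (by rw [tableTime])) fun _ h => h
    · intro s' h; simp [NExpr.eval, h.nat, a₂.nat, h₁, hM]
    · intro s' h; simp [NExpr.eval, h.nat, a₂.nat, h₁, hd]
    · intro s' h; simp [NExpr.eval]
    · intro s' h; simp [NExpr.eval]
    · intro s' h; simp [NExpr.eval, h.nat, a₂.nat, h₁, h₂, hd]
    · intro s' h hi hj _
      simp only [RExpr.eval, NExpr.eval]
      rw [h.nat 17 (by norm_num) (by norm_num) (by norm_num),
        h.nat 4 (by norm_num) (by norm_num) (by norm_num),
        a₂.nat 17 (by norm_num) (by norm_num) (by norm_num),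
        a₂.nat 4 (by norm_num) (by norm_num) (by norm_num), h₂, h₁ 4 (by norm_num), hM,
        h.cell _ _ (by omega), h.cell _ _ (by omega), a₂.cell _ _ (by omega),
        a₂.cell _ _ (by omega), h₄ _ (by omega) _ hj, h₄ _ (by omega) _ hj]
    rintro s₃ ⟨a₃, v₃⟩
    refine ends_setNat _ _ _ _ _ ⟨fun b hb => ?_, ?_, fun b hb hb' => ?_, fun i hi j hj => ?_⟩
    · refine (write_of_ne _ (by omega) _ _ _).trans ?_
      rw [a₃.nat b (by omega) (by omega) (by omega),
        a₂.nat b (by omega) (by omega) (by omega), h₁ b hb]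
    · simp [write, NExpr.eval, a₃.nat, a₂.nat, h₁, h₂, hd, hshift]
    · dsimp only
      rw [a₃.real b hb hb', a₂.real b hb hb', h₃ b hb hb']
    · dsimp only
      rw [← hshift]
      have hYs : Y (k + 1) i j = if i % 2 = 0 then Y k (i / 2) j + Y k (i / 2 + 2 ^ K) j
        else Y k (i / 2) j - Y k (i / 2 + 2 ^ K) j := rfl
      rw [hYs]
      split_ifs with hi2
      · rw [a₃.cell _ _ (by omega)]
        have := v₂ (i / 2) (by omega) j hj
        have e : i / 2 + i / 2 = i := by omega
        rw [e] at this
        rw [this]; simp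
      · have := v₃ (i / 2) (by omega) j hj
        have e : i / 2 + i / 2 + 1 = i := by omega
        rw [e] at this
        rw [this]; simp
  · refine ⟨fun b hb => write_of_ne _ (by omega) _ _ _, ?_, fun _ _ _ => rfl, fun i hi j hj => ?_⟩
    · simp [write, NExpr.eval]
    · rw [Nat.zero_mul, Nat.zero_add]
      exact hz i hi j hj
  · rintro s' ⟨h₁, h₂, h₃, h₄⟩
    refine ⟨h₁, h₂, h₃, fun i hi j hj => ?_⟩
    rw [h₄ i hi j hj]
    refine fast_hadamard K (fun l i => Y l i j) (fun l _ i _ => ?_) (fun l _ i _ => ?_) hi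
    · simp [hY, butterflies]
    · have e : (2 * i + 1) / 2 = i := by omega
      simp [hY, butterflies, e, Nat.add_mod]

/-- Sample rows of the transformed matrix. -/
def sampleStage : Prog :=
  .rect 5 (.var 14) (.var 1) (.lit 1)
    (.times (.root (.quot (.ofNat (.var 2)) (.ofNat (.var 14))))
      (.quot (.get 4 (.get 11 (.var 20) (.lit 0)) (.plus (.var 17) (.var 21)))
        (.root (.ofNat (.var 2)))))

theorem ends_sampleStage {N r₁ d c : ℕ} {s : Memory} (hN : s.nat 2 0 0 = N)
    (hd : s.nat 1 0 0 = d) (hr : s.nat 14 0 0 = r₁) (hc : s.nat 17 0 0 = c) :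
    Ends sampleStage s (tableTime r₁ d 1) fun s' => Near 5 s s' ∧
      ∀ t < r₁, ∀ j < d, s'.real 5 t j =
        √((N : ℝ) / r₁) * (s.real 4 (s.nat 11 t 0) (c + j) / √(N : ℝ)) := by
  refine Ends.mono (ends_rect r₁ d 1
    (fun t j _ => √((N : ℝ) / r₁) * (s.real 4 (s.nat 11 t 0) (c + j) / √(N : ℝ)))
    (by norm_num) ?_ ?_ ?_ ?_) le_rfl ?_
  · intro s' h; simp [NExpr.eval, h.nat, hr]
  · intro s' h; simp [NExpr.eval, h.nat, hd]
  · intro s' h; simp [NExpr.eval]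
  · intro s' h i _ j _ k _ h₀ h₁ _
    simp [RExpr.eval, NExpr.eval, h.nat, h.real, h₀, h₁, hN, hr, hc]
  · rintro s' ⟨h, h'⟩
    exact ⟨h, fun i hi j hj => by rw [h' i hi j hj]; simp⟩

/-- The Gram matrix of the sampled rows. -/
def gramStage : Prog :=
  .rect 6 (.var 1) (.var 1) (.var 14)
    (.times (.get 5 (.var 22) (.var 20)) (.get 5 (.var 22) (.var 21)))

theorem ends_gramStage {r₁ d : ℕ} {s : Memory} (hd : s.nat 1 0 0 = d) (hr : s.nat 14 0 0 = r₁) :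
    Ends gramStage s (tableTime d d r₁) fun s' => Near 6 s s' ∧
      ∀ i < d, ∀ j < d, s'.real 6 i j = gram r₁ (s.real 5) i j := by
  refine ends_rect d d r₁ (fun i j t => s.real 5 t i * s.real 5 t j) (by norm_num) ?_ ?_ ?_ ?_
  · intro s' h; simp [NExpr.eval, h.nat, hd]
  · intro s' h; simp [NExpr.eval, h.nat, hd]
  · intro s' h; simp [NExpr.eval, h.nat, hr]
  · intro s' h i _ j _ k _ h₀ h₁ h₂
    simp [RExpr.eval, NExpr.eval, h.real, h₀, h₁, h₂]

/-- The entry with index `e` of the residual of the basis vector whose index is in the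
variable `30`; the array `10` holds the components to be subtracted.  Truncated subtraction provides
the entries of the basis vector, see `cast_one_sub_dist`. -/
def residualExpr (e : NExpr) : RExpr :=
  .minus (.ofNat (.minus (.lit 1) (.plus (.minus e (.var 30)) (.minus (.var 30) e))))
    (.get 10 e (.lit 0))

theorem cast_one_sub_dist (i m : ℕ) :
    ((1 - ((i - m) + (m - i)) : ℕ) : ℝ) = if i = m then 1 else 0 := by
  split_ifs with h
  · subst h; simp
  · have : 1 - ((i - m) + (m - i)) = 0 := by omega
    rw [this, Nat.cast_zero]

/-- One step of the Gram–Schmidt process: append the column with the index in the variable `30`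
to the array `7`. -/
def gsStep : Prog :=
  .seq (.rect 9 (.var 30) (.lit 1) (.var 1)
      (.times (.get 7 (.var 22) (.var 20)) (.get 6 (.var 22) (.var 30))))
    (.seq (.rect 10 (.var 1) (.lit 1) (.var 30)
        (.times (.get 9 (.var 22) (.lit 0)) (.get 7 (.var 20) (.var 22))))
      (.seq (.rect 12 (.var 1) (.lit 1) (.var 1)
          (.times (.get 6 (.var 20) (.var 22)) (residualExpr (.var 22))))
        (.seq (.rect 11 (.lit 1) (.lit 1) (.var 1)
            (.times (residualExpr (.var 22)) (.get 12 (.var 22) (.lit 0))))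
          (.table 7 (.var 1) (.lit 1) (.lit 1) (.var 20) (.plus (.var 30) (.var 21))
            (.quot (residualExpr (.var 20)) (.root (.get 11 (.lit 0) (.lit 0))))))))

/-- A bound for the running time of `gsStep`. -/
def gsStepTime (d : ℕ) : ℕ :=
  tableTime d 1 d + (tableTime d 1 d + (tableTime d 1 d + (tableTime 1 1 d +
    tableTime d 1 1 + 1) + 1) + 1) + 1

theorem ends_gsStep {m d : ℕ} {s : Memory} (G : ℕ → ℕ → ℝ) (hm : m < d)
    (hd : s.nat 1 0 0 = d) (h30 : s.nat 30 0 0 = m)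
    (hG : ∀ i < d, ∀ j < d, s.real 6 i j = G i j)
    (hT : ∀ i < d, ∀ k < m, s.real 7 i k = gs d G m i k) :
    Ends gsStep s (gsStepTime d) fun s' =>
      (∀ b, b ≠ 20 → b ≠ 21 → b ≠ 22 → s'.nat b = s.nat b) ∧
      (∀ b, b < 7 → s'.real b = s.real b) ∧
      ∀ i < d, ∀ k < m + 1, s'.real 7 i k = gs d G (m + 1) i k := by
  set T := gs d G m with hTdef
  have hmono : tableTime m 1 d ≤ tableTime d 1 d := by
    simp only [tableTime]; gcongr
  have hmono' : tableTime d 1 m ≤ tableTime d 1 d := by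
    simp only [tableTime]; gcongr
  refine Ends.seq (Ends.mono (ends_rect m 1 d (fun k _ i => T i k * G i m) (by norm_num)
    ?_ ?_ ?_ ?_) hmono fun _ h => h) ?_
  · intro s' h; simp [NExpr.eval, h.nat, h30]
  · intro s' h; simp [NExpr.eval]
  · intro s' h; simp [NExpr.eval, h.nat, hd]
  · intro s' h i hi j _ k hk h₀ h₁ h₂
    simp [RExpr.eval, NExpr.eval, h.real, h.nat, h₀, h₂, h30, hT k hk i hi, hG k hk m hm]
  rintro s₁ ⟨n₁, v₁⟩
  refine Ends.seq (Ends.mono (ends_rect d 1 m (fun i _ k => gsCoeff d G T m k * T i k)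
    (by norm_num) ?_ ?_ ?_ ?_) hmono' fun _ h => h) ?_
  · intro s' h; simp [NExpr.eval, h.nat, n₁.nat, hd]
  · intro s' h; simp [NExpr.eval]
  · intro s' h; simp [NExpr.eval, h.nat, n₁.nat, h30]
  · intro s' h i hi j _ k hk h₀ h₁ h₂
    simp [RExpr.eval, NExpr.eval, h.real, n₁.real, h₀, h₂, hT i hi k hk,
      v₁ k hk 0 (by norm_num), gsCoeff]
  rintro s₂ ⟨n₂, v₂⟩
  have hres : ∀ s' : Memory, s'.nat 30 0 0 = m → s'.real 10 = s₂.real 10 → ∀ (e : NExpr) (i : ℕ),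
      i < d → e.eval s' = i → (residualExpr e).eval s' = gsResidual d G T m i := by
    intro s' h h' e i hi he
    simp only [residualExpr, RExpr.eval, NExpr.eval, he, h, h', cast_one_sub_dist,
      v₂ i hi 0 (by norm_num)]
    rfl
  refine Ends.seq (ends_rect d 1 d (fun i _ l => G i l * gsResidual d G T m l)
    (by norm_num) ?_ ?_ ?_ ?_) ?_
  · intro s' h; simp [NExpr.eval, h.nat, n₂.nat, n₁.nat, hd]
  · intro s' h; simp [NExpr.eval]
  · intro s' h; simp [NExpr.eval, h.nat, n₂.nat, n₁.nat, hd]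
  · intro s' h i hi j _ k hk h₀ h₁ h₂
    have hr := hres s' (by simp [h.nat, n₂.nat, n₁.nat, h30]) (by simp [h.real]) (.var 22) k hk
      (by simp [NExpr.eval, h₂])
    simp [RExpr.eval, NExpr.eval, h.real, n₂.real, n₁.real, h₀, h₂, hG i hi k hk, hr]
  rintro s₃ ⟨n₃, v₃⟩
  refine Ends.seq (ends_rect 1 1 d
    (fun _ _ i => gsResidual d G T m i * ∑ l ∈ Finset.range d, G i l * gsResidual d G T m l)
    (by norm_num) ?_ ?_ ?_ ?_) ?_
  · intro s' h; simp [NExpr.eval]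
  · intro s' h; simp [NExpr.eval]
  · intro s' h; simp [NExpr.eval, h.nat, n₃.nat, n₂.nat, n₁.nat, hd]
  · intro s' h i hi j _ k hk h₀ h₁ h₂
    have hr := hres s' (by simp [h.nat, n₃.nat, n₂.nat, n₁.nat, h30])
      (by simp [h.real, n₃.real]) (.var 22) k hk (by simp [NExpr.eval, h₂])
    simp [RExpr.eval, NExpr.eval, h.real, h₂, v₃ k hk 0 (by norm_num), hr]
  rintro s₄ ⟨n₄, v₄⟩
  have hnat : ∀ b, b ≠ 20 → b ≠ 21 → b ≠ 22 → s₄.nat b = s.nat b := by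
    intro b h₀ h₁ h₂
    rw [n₄.nat b h₀ h₁ h₂, n₃.nat b h₀ h₁ h₂, n₂.nat b h₀ h₁ h₂, n₁.nat b h₀ h₁ h₂]
  have hreal : ∀ b, b < 8 → s₄.real b = s.real b := by
    intro b hb
    rw [n₄.real b (by omega) (by omega), n₃.real b (by omega) (by omega),
      n₂.real b (by omega) (by omega), n₁.real b (by omega) (by omega)]
  have hν : s₄.real 11 0 0 = gsNormSq d G T m := v₄ 0 (by norm_num) 0 (by norm_num)
  refine Ends.mono (ends_table d 1 1 id (fun j => m + j)
    (fun i _ _ => gsResidual d G T m i / √(gsNormSq d G T m)) (fun _ y => m ≤ y) (by norm_num)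
    Function.injective_id (fun x y h => by dsimp only at h; omega) (fun _ _ _ _ => by omega)
    ?_ ?_ ?_ ?_ ?_ ?_) le_rfl ?_
  · intro s' h; simp [NExpr.eval, h.nat, hnat, hd]
  · intro s' h; simp [NExpr.eval]
  · intro s' h; simp [NExpr.eval]
  · intro s' h; simp [NExpr.eval]
  · intro s' h; simp [NExpr.eval, h.nat, hnat, h30]
  · intro s' h hi _ _
    have hr := hres s' (by simp [h.nat, hnat, h30]) (by simp [h.real, n₄.real, n₃.real]) (.var 20)
      _ hi (by simp [NExpr.eval])
    simp [RExpr.eval, NExpr.eval, h.real, hν, hr]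
  · rintro s' ⟨a, v⟩
    refine ⟨fun b h₀ h₁ h₂ => ?_, fun b hb => ?_, fun i hi k hk => ?_⟩
    · rw [a.nat b h₀ h₁ h₂, hnat b h₀ h₁ h₂]
    · rw [a.real b (by omega) (by omega), hreal b (by omega)]
    · rcases Nat.lt_succ_iff_lt_or_eq.1 hk with hk | rfl
      · rw [a.cell i k (by omega), hreal 7 (by norm_num), hT i hi k hk]
        simp [gs, hk.ne, hTdef]
      · have := v i hi 0 (by norm_num)
        simp only [id, add_zero, Finset.sum_range_one] at this
        rw [this]
        simp [gs, ← hTdef]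

/-- The Gram–Schmidt process. -/
def gsStage : Prog := .forLoop 30 (.var 1) gsStep

theorem ends_gsStage {d : ℕ} {s : Memory} (G : ℕ → ℕ → ℝ) (hd : s.nat 1 0 0 = d)
    (hG : ∀ i < d, ∀ j < d, s.real 6 i j = G i j) :
    Ends gsStage s (d * (gsStepTime d + 3) + 3) fun s' =>
      (∀ b, b < 20 → s'.nat b = s.nat b) ∧ (∀ b, b < 7 → s'.real b = s.real b) ∧
      ∀ i < d, ∀ k < d, s'.real 7 i k = gs d G d i k := by
  refine ends_forLoop d (gsStepTime d)
    (fun m s' => (∀ b, b < 20 → s'.nat b = s.nat b) ∧ (∀ b, b < 7 → s'.real b = s.real b) ∧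
      ∀ i < d, ∀ k < m, s'.real 7 i k = gs d G m i k) ?_ ?_ ?_ ?_ ?_
  · simp [gsStep, Prog.KeepsNat, keepsNat_table]
  · rintro k s' v ⟨h₁, h₂, h₃⟩
    refine ⟨fun b hb => ?_, h₂, h₃⟩
    rw [Memory.setVar_nat_of_ne _ (by omega), h₁ b hb]
  · rintro k - s' ⟨h₁, -⟩
    simp [NExpr.eval, h₁, hd]
  · rintro m hm s' ⟨h₁, h₂, h₃⟩ h30
    refine Ends.mono (ends_gsStep G hm (by simp [h₁, hd]) h30
      (fun i hi j hj => by rw [h₂ 6 (by norm_num), hG i hi j hj]) h₃) le_rfl ?_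
    rintro s'' ⟨h₁', h₂', h₃'⟩
    refine ⟨fun b hb => ?_, fun b hb => ?_, h₃'⟩
    · rw [h₁' b (by omega) (by omega) (by omega), h₁ b hb]
    · rw [h₂' b hb, h₂ b hb]
  · exact ⟨fun _ _ => rfl, fun _ _ => rfl, fun i _ k hk => absurd hk (Nat.not_lt_zero k)⟩

/-- The value of an entry of the sparse sign matrix for the outcome `x` of the draw.  The truncated
differences are the indicators of `x = 0` and of `x = 1`. -/
noncomputable def sparseValue (r x : ℕ) : ℝ :=
  √((3 : ℕ) / (r : ℝ)) * (((1 - x : ℕ) : ℝ) - ((2 - x - (1 - x + (1 - x)) : ℕ) : ℝ))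

theorem sparseValue_eq {d r : ℕ} (x : Fin d → Fin r → Fin 6) (j : Fin d) (t : Fin r) :
    sparseValue r (x j t) = sparseSign x j t := by
  rw [sparseSign, Matrix.of_apply, sparseValue]
  generalize x j t = z
  fin_cases z <;> simp

/-- The product of the orthogonalizer and the sparse sign matrix. -/
def projStage : Prog :=
  .rect 8 (.var 1) (.var 13) (.var 1) (.times (.get 7 (.var 20) (.var 22))
    (.times (.root (.quot (.ofNat (.lit 3)) (.ofNat (.var 13))))
      (.minus (.ofNat (.minus (.lit 1) (.get 12 (.var 22) (.var 21))))
        (.ofNat (.minus (.minus (.lit 2) (.get 12 (.var 22) (.var 21)))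
          (.plus (.minus (.lit 1) (.get 12 (.var 22) (.var 21)))
            (.minus (.lit 1) (.get 12 (.var 22) (.var 21)))))))))

theorem ends_projStage {r₂ d : ℕ} {s : Memory} (hd : s.nat 1 0 0 = d) (hr : s.nat 13 0 0 = r₂) :
    Ends projStage s (tableTime d r₂ d) fun s' => Near 8 s s' ∧
      ∀ i < d, ∀ t < r₂, s'.real 8 i t =
        ∑ k ∈ Finset.range d, s.real 7 i k * sparseValue r₂ (s.nat 12 k t) := by
  refine ends_rect d r₂ d (fun i t k => s.real 7 i k * sparseValue r₂ (s.nat 12 k t))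
    (by norm_num) ?_ ?_ ?_ ?_
  · intro s' h; simp [NExpr.eval, h.nat, hd]
  · intro s' h; simp [NExpr.eval, h.nat, hr]
  · intro s' h; simp [NExpr.eval, h.nat, hd]
  · intro s' h i _ j _ k _ h₀ h₁ h₂
    simp [RExpr.eval, NExpr.eval, h.real, h.nat, h₀, h₁, h₂, hr, sparseValue]

/-- The product of the input matrix and the result of `projStage`. -/
def outerStage : Prog :=
  .rect 13 (.var 0) (.var 13) (.var 1)
    (.times (.get 0 (.var 20) (.var 22)) (.get 8 (.var 22) (.var 21)))

theorem ends_outerStage {n r₂ d : ℕ} {s : Memory} (hn : s.nat 0 0 0 = n) (hd : s.nat 1 0 0 = d)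
    (hr : s.nat 13 0 0 = r₂) :
    Ends outerStage s (tableTime n r₂ d) fun s' => Near 13 s s' ∧
      ∀ i < n, ∀ t < r₂, s'.real 13 i t =
        ∑ k ∈ Finset.range d, s.real 0 i k * s.real 8 k t := by
  refine ends_rect n r₂ d (fun i t k => s.real 0 i k * s.real 8 k t) (by norm_num) ?_ ?_ ?_ ?_
  · intro s' h; simp [NExpr.eval, h.nat, hn]
  · intro s' h; simp [NExpr.eval, h.nat, hr]
  · intro s' h; simp [NExpr.eval, h.nat, hd]
  · intro s' h i _ j _ k _ h₀ h₁ h₂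
    simp [RExpr.eval, NExpr.eval, h.real, h₀, h₁, h₂]

/-- The squared row lengths. -/
def normStage : Prog :=
  .rect 2 (.var 0) (.lit 1) (.var 13)
    (.times (.get 13 (.var 20) (.var 22)) (.get 13 (.var 20) (.var 22)))

theorem ends_normStage {n r₂ : ℕ} {s : Memory} (hn : s.nat 0 0 0 = n)
    (hr : s.nat 13 0 0 = r₂) :
    Ends normStage s (tableTime n 1 r₂) fun s' => Near 2 s s' ∧
      ∀ i < n, s'.real 2 i 0 = ∑ t ∈ Finset.range r₂, s.real 13 i t * s.real 13 i t := by
  refine Ends.mono (ends_rect n 1 r₂ (fun i _ t => s.real 13 i t * s.real 13 i t) (by norm_num)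
    ?_ ?_ ?_ ?_) le_rfl ?_
  · intro s' h; simp [NExpr.eval, h.nat, hn]
  · intro s' h; simp [NExpr.eval]
  · intro s' h; simp [NExpr.eval, h.nat, hr]
  · intro s' h i _ j _ k _ h₀ h₁ h₂
    simp [RExpr.eval, NExpr.eval, h.real, h₀, h₂]
  · rintro s' ⟨h, h'⟩
    exact ⟨h, fun i hi => h' i hi 0 (by norm_num)⟩

/-- The maximum of the estimates. -/
def maxStage : Prog :=
  .seq (.letReal 3 (.ofNat (.lit 0))) (.forLoop 30 (.var 0)
    (.branch (.realLt (.var 3) (.get 2 (.var 30) (.lit 0)))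
      (.letReal 3 (.get 2 (.var 30) (.lit 0))) .skip))

theorem ends_maxStage {n : ℕ} {s : Memory} (hn : 0 < n) (h0 : s.nat 0 0 0 = n)
    (hnn : ∀ i < n, 0 ≤ s.real 2 i 0) :
    Ends maxStage s (n * 5 + 5) fun s' =>
      s'.real 2 = s.real 2 ∧ s'.real 3 0 0 = ⨆ i : Fin n, s.real 2 i 0 := by
  have hstart : Ends (.letReal 3 (.ofNat (.lit 0))) s 1 fun s' =>
      s' = { s with real := write s.real 3 0 0 0 } :=
    ends_setReal _ _ _ _ _ (by simp [NExpr.eval, RExpr.eval])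
  refine Ends.mono (Ends.seq hstart (U := n * 5 + 3) (Q := fun s' => s'.real 2 = s.real 2 ∧
    s'.real 3 0 0 = ⨆ i : Fin n, s.real 2 i 0) ?_) (by omega) fun _ h => h
  rintro _ rfl
  refine Ends.mono (ends_forLoop n 2 (fun k s' => s'.nat 0 0 0 = n ∧ s'.real 2 = s.real 2 ∧
    (∀ i < k, s.real 2 i 0 ≤ s'.real 3 0 0) ∧
    (s'.real 3 0 0 = 0 ∨ ∃ i < k, s'.real 3 0 0 = s.real 2 i 0)) ?_ ?_ ?_ ?_ ?_) le_rfl ?_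
  · simp [Prog.KeepsNat]
  · rintro k s' v ⟨h, h'⟩
    exact ⟨by rw [Memory.setVar_nat_of_ne _ (by norm_num), h], h'⟩
  · rintro k - s' ⟨h, -⟩
    simp [NExpr.eval, h]
  · rintro k hk s' ⟨h₁, h₂, h₃, h₄⟩ h30
    by_cases hlt : s'.real 3 0 0 < s.real 2 k 0
    · refine ⟨1 + 1, le_rfl, _, .branch_pos _ ?_ (.setReal _ _ _ _ _), h₁, ?_, ?_, ?_⟩
      · simpa [Test.Holds, RExpr.eval, NExpr.eval, h30, h₂] using hlt
      · refine Eq.trans ?_ h₂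
        funext x y
        simp [write]
      · intro i hi
        simp only [write, NExpr.eval, RExpr.eval, h30, h₂, and_self, if_true]
        rcases Nat.lt_succ_iff_lt_or_eq.1 hi with hi | rfl
        · exact (h₃ i hi).trans hlt.le
        · exact le_rfl
      · refine .inr ⟨k, by omega, ?_⟩
        simp [write, NExpr.eval, RExpr.eval, h30, h₂]
    · refine ⟨1 + 1, le_rfl, s', .branch_neg _ ?_ (.skip _), h₁, h₂, ?_, ?_⟩
      · simpa [Test.Holds, RExpr.eval, NExpr.eval, h30, h₂] using hlt
      · intro i hi
        rcases Nat.lt_succ_iff_lt_or_eq.1 hi with hi | rfl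
        · exact h₃ i hi
        · exact not_lt.1 hlt
      · rcases h₄ with h | ⟨i, hi, h⟩
        · exact .inl h
        · exact .inr ⟨i, by omega, h⟩
  · exact ⟨h0, by funext x y; simp [write], fun i hi => absurd hi (Nat.not_lt_zero i),
      .inl (by simp [write])⟩
  · rintro s' ⟨-, h₂, h₃, h₄⟩
    refine ⟨h₂, ?_⟩
    have : Nonempty (Fin n) := ⟨⟨0, hn⟩⟩
    have hle : ∀ i : Fin n, s.real 2 i 0 ≤ ⨆ i : Fin n, s.real 2 i 0 := fun i =>
      le_ciSup (Set.finite_range fun i : Fin n => s.real 2 i 0).bddAbove i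
    refine le_antisymm ?_ (ciSup_le fun i => h₃ i i.isLt)
    rcases h₄ with h | ⟨i, hi, h⟩
    · rw [h]; exact (hnn 0 hn).trans (hle ⟨0, hn⟩)
    · rw [h]; exact hle ⟨i, hi⟩

end Leverage

/-! ### The program and its output distribution -/

namespace Leverage

open RealRAM

/-- The deterministic computation that follows the draws.  The real array `4` holds the transformed
columns, `5` the sketch, `6` its Gram matrix, `7` the orthogonalizer, `8` and `13` its products with
the sparse sign matrix and with both that matrix and the input; the results are in `2` and `3`. -/
def computeProg : Prog :=
  .seq signStage (.seq hadamardStage (.seq sampleStage (.seq gramStage (.seq gsStage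
    (.seq projStage (.seq outerStage (.seq normStage maxStage)))))))

/-- A bound for the running time of `computeProg`, where `2 ^ k` is the padded number of rows. -/
def computeTime (k n d r₁ r₂ : ℕ) : ℕ :=
  tableTime (2 ^ k) d 1 + (k * (2 * tableTime (2 ^ (k - 1)) d 1 + 6) + 5 + (tableTime r₁ d 1 +
    (tableTime d d r₁ + (d * (gsStepTime d + 3) + 3 + (tableTime d r₂ d + (tableTime n r₂ d +
      (tableTime n 1 r₂ + (n * 5 + 5) + 1) + 1) + 1) + 1) + 1) + 1) + 1) + 1

/-- The sketch `Π₁ A` as a sum over the padded rows, in the form in which it is computed. -/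
theorem srht_mul_eq_sum {n d r : ℕ} (A : Matrix (Fin n) (Fin d) ℝ)
    (b : Fin (2 ^ Nat.clog 2 n) → Bool) (s : Fin r → Fin (2 ^ Nat.clog 2 n)) (t : Fin r)
    (j : Fin d) :
    (srht n b s * A) t j = √((2 ^ Nat.clog 2 n : ℕ) / r) *
      ((∑ c : Fin (2 ^ Nat.clog 2 n), hadamardEntry (Nat.clog 2 n) (s t) c *
        (sgn (b c) * entry A c j)) / √(2 ^ Nat.clog 2 n : ℕ)) := by
  have hs : √((2 ^ Nat.clog 2 n : ℕ) : ℝ) ≠ 0 := (Real.sqrt_pos.2 (by positivity)).ne'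
  have hpad : ∀ c : Fin (2 ^ Nat.clog 2 n),
      (padMatrix n (2 ^ Nat.clog 2 n) * A) c j = entry A c j := by
    intro c
    rw [Matrix.mul_apply]
    by_cases hc : (c : ℕ) < n
    · rw [Finset.sum_eq_single (⟨c, hc⟩ : Fin n)]
      · simp [padMatrix, entry, hc]
      · intro i _ hi
        have : (c : ℕ) ≠ i := fun h => hi (Fin.ext h.symm)
        simp [padMatrix, this]
      · simp
    · rw [Finset.sum_eq_zero]
      · simp [entry, hc]
      · intro i _
        have : (c : ℕ) ≠ i := fun h => hc (h ▸ i.isLt)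
        simp [padMatrix, this]
  have h := mixedRow_eq A b (s t) j
  simp only [hpad] at h
  rw [mixedRow] at h
  rw [srht_mul_apply]
  congr 1
  rw [eq_div_iff hs, mul_comm]
  push_cast
  rw [h]
  exact Finset.sum_congr rfl fun c _ => by ring

theorem ends_computeProg {n d r₁ r₂ : ℕ} (hn : 2 ≤ n) (A : Matrix (Fin n) (Fin d) ℝ)
    (ω : Draws (2 ^ Nat.clog 2 n) r₁ d r₂) {s : Memory}
    (h0 : s.nat 0 0 0 = n) (h1 : s.nat 1 0 0 = d) (h2 : s.nat 2 0 0 = 2 ^ Nat.clog 2 n)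
    (h3 : s.nat 3 0 0 = Nat.clog 2 n) (h4 : s.nat 4 0 0 = 2 ^ (Nat.clog 2 n - 1))
    (h13 : s.nat 13 0 0 = r₂) (h14 : s.nat 14 0 0 = r₁)
    (h10 : ∀ i : Fin (2 ^ Nat.clog 2 n), s.nat 10 i 0 = if ω.1 i then 1 else 0)
    (h11 : ∀ t : Fin r₁, s.nat 11 t 0 = ω.2.1 t)
    (h12 : ∀ (j : Fin d) (t : Fin r₂), s.nat 12 j t = ω.2.2 j t)
    (hA : s.real 0 = entry A) :
    Ends computeProg s (computeTime (Nat.clog 2 n) n d r₁ r₂) fun s' =>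
      (∀ i : Fin n, s'.real 2 i 0 = estimates gsOrth A r₁ r₂ ω i) ∧
      s'.real 3 0 0 = ⨆ i, estimates gsOrth A r₁ r₂ ω i := by
  obtain ⟨K, hK⟩ : ∃ K, Nat.clog 2 n = K + 1 :=
    ⟨Nat.clog 2 n - 1, by have := Nat.clog_pos (b := 2) (by norm_num) hn; omega⟩
  set B := srht n ω.1 ω.2.1 * A with hB
  refine Ends.seq (ends_signStage h2 h1) ?_
  rintro s₁ ⟨n₁, v₁⟩
  refine Ends.seq (Ends.mono (ends_hadamardStage (K := K) (d := d) (s := s₁)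
    (fun i j => ((s.nat 10 i 0 : ℝ) + s.nat 10 i 0 - 1) * entry A i j) ?_ ?_ ?_ ?_)
    (le_of_eq (by rw [hK]; rfl)) fun _ h => h) ?_
  · rw [n₁.nat 1 (by norm_num) (by norm_num) (by norm_num), h1]
  · rw [n₁.nat 3 (by norm_num) (by norm_num) (by norm_num), h3, hK]
  · rw [n₁.nat 4 (by norm_num) (by norm_num) (by norm_num), h4, hK]; rfl
  · intro i hi j hj
    rw [v₁ i (by rwa [hK]) j hj, hA]
  rintro s₂ ⟨n₂, c₂, r₂', v₂⟩
  have nat₂ : ∀ b, b < 17 → s₂.nat b = s.nat b := fun b hb => by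
    rw [n₂ b hb, n₁.nat b (by omega) (by omega) (by omega)]
  refine Ends.seq (ends_sampleStage (s := s₂) (by rw [nat₂ 2 (by norm_num), h2])
    (by rw [nat₂ 1 (by norm_num), h1]) (by rw [nat₂ 14 (by norm_num), h14]) c₂) ?_
  rintro s₃ ⟨n₃, v₃⟩
  have nat₃ : ∀ b, b < 17 → s₃.nat b = s.nat b := fun b hb => by
    rw [n₃.nat b (by omega) (by omega) (by omega), nat₂ b hb]
  have hv₃ : ∀ t < r₁, ∀ j < d, s₃.real 5 t j = entry B t j := by
    intro t ht j hj
    rw [v₃ t ht j hj, show entry B t j = B ⟨t, ht⟩ ⟨j, hj⟩ from entry_val B ⟨t, ht⟩ ⟨j, hj⟩, hB,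
      srht_mul_eq_sum, nat₂ 11 (by norm_num), h11 ⟨t, ht⟩,
      v₂ _ (by rw [← hK]; exact (ω.2.1 ⟨t, ht⟩).isLt) j hj, ← hK, Finset.sum_range]
    refine congrArg₂ _ rfl (congrArg₂ _ ?_ rfl)
    refine Finset.sum_congr rfl fun c _ => ?_
    rw [h10 c]
    cases ω.1 c <;> simp [sgn]
  have hG : ∀ i j, i < d → j < d → gram r₁ (s₃.real 5) i j = gram r₁ (entry B) i j := by
    intro i j hi hj
    refine Finset.sum_congr rfl fun t ht => ?_
    rw [Finset.mem_range] at ht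
    rw [hv₃ t ht i hi, hv₃ t ht j hj]
  refine Ends.seq (ends_gramStage (s := s₃) (by rw [nat₃ 1 (by norm_num), h1])
    (by rw [nat₃ 14 (by norm_num), h14])) ?_
  rintro s₄ ⟨n₄, v₄⟩
  have nat₄ : ∀ b, b < 17 → s₄.nat b = s.nat b := fun b hb => by
    rw [n₄.nat b (by omega) (by omega) (by omega), nat₃ b hb]
  refine Ends.seq (ends_gsStage (s := s₄) (gram r₁ (entry B)) (by rw [nat₄ 1 (by norm_num), h1])
    fun i hi j hj => by rw [v₄ i hi j hj, hG i j hi hj]) ?_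
  rintro s₅ ⟨n₅, r₅, v₅⟩
  have nat₅ : ∀ b, b < 17 → s₅.nat b = s.nat b := fun b hb => by
    rw [n₅ b (by omega), nat₄ b hb]
  refine Ends.seq (ends_projStage (s := s₅) (by rw [nat₅ 1 (by norm_num), h1])
    (by rw [nat₅ 13 (by norm_num), h13])) ?_
  rintro s₆ ⟨n₆, v₆⟩
  have nat₆ : ∀ b, b < 17 → s₆.nat b = s.nat b := fun b hb => by
    rw [n₆.nat b (by omega) (by omega) (by omega), nat₅ b hb]
  refine Ends.seq (ends_outerStage (s := s₆) (by rw [nat₆ 0 (by norm_num), h0])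
    (by rw [nat₆ 1 (by norm_num), h1]) (by rw [nat₆ 13 (by norm_num), h13])) ?_
  rintro s₇ ⟨n₇, v₇⟩
  have nat₇ : ∀ b, b < 17 → s₇.nat b = s.nat b := fun b hb => by
    rw [n₇.nat b (by omega) (by omega) (by omega), nat₆ b hb]
  refine Ends.seq (ends_normStage (s := s₇) (by rw [nat₇ 0 (by norm_num), h0])
    (by rw [nat₇ 13 (by norm_num), h13])) ?_
  rintro s₈ ⟨n₈, v₈⟩
  have real0 : s₆.real 0 = entry A := by
    rw [n₆.real 0 (by norm_num) (by norm_num), r₅ 0 (by norm_num),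
      n₄.real 0 (by norm_num) (by norm_num), n₃.real 0 (by norm_num) (by norm_num),
      r₂' 0 (by norm_num) (by norm_num), n₁.real 0 (by norm_num) (by norm_num), hA]
  have hres : ∀ i : Fin n, s₈.real 2 i 0 = estimates gsOrth A r₁ r₂ ω i := by
    intro i
    rw [v₈ i i.isLt, Finset.sum_range, estimates]
    refine Finset.sum_congr rfl fun t _ => ?_
    rw [← pow_two]
    congr 1
    rw [v₇ i i.isLt t t.isLt, Finset.sum_range, Matrix.mul_assoc, Matrix.mul_apply]
    refine Finset.sum_congr rfl fun k _ => ?_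
    rw [real0, entry_val, v₆ k k.isLt t t.isLt, Finset.sum_range, Matrix.mul_apply]
    congr 1
    refine Finset.sum_congr rfl fun l _ => ?_
    rw [v₅ k k.isLt l l.isLt, nat₅ 12 (by norm_num), h12, sparseValue_eq]
    rfl
  refine Ends.mono (ends_maxStage (s := s₈) (n := n) (by omega) ?_ fun i hi => ?_) le_rfl ?_
  · rw [n₈.nat 0 (by norm_num) (by norm_num) (by norm_num), nat₇ 0 (by norm_num), h0]
  · rw [v₈ i hi]
    exact Finset.sum_nonneg fun t _ => mul_self_nonneg _
  · rintro s' ⟨h, h'⟩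
    simp only [hres] at h'
    exact ⟨fun i => by rw [h, hres i], h'⟩

end Leverage

namespace RealRAM

/-- A run that consists of a deterministic phase, a random phase and a deterministic phase, and is
observed after it has halted. -/
theorem runFor_of_phases {p q r : Prog} {s : Memory} {T₀ t₁ T₂ T : ℕ} {Ω : Type} [Fintype Ω]
    [Nonempty Ω] {P : Memory → Prop} {Q R : Ω → Memory → Prop} (hp : Ends p s T₀ P)
    (hq : ∀ s', P s' → Yields q s' t₁ Ω Q) (hr : ∀ ω s', Q ω s' → Ends r s' T₂ (R ω))
    (hT : T₀ + t₁ + T₂ + 2 ≤ T) :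
    ∃ g : Ω → Memory, runFor ⟨s, [.seq p (.seq q r)]⟩ T =
      (PMF.uniformOfFintype Ω).map (fun ω => ⟨g ω, []⟩) ∧ ∀ ω, R ω (g ω) := by
  obtain ⟨t₀, ht₀, s₀, e₀, hP⟩ := hp
  obtain ⟨g₁, hg₁, hQ⟩ := hq s₀ hP
  choose t₂ ht₂ g e₂ hR using fun ω => hr ω _ (hQ ω)
  refine ⟨g, ?_, hR⟩
  obtain ⟨u, rfl⟩ : ∃ u, T = 1 + (t₀ + (1 + (t₁ + u))) := ⟨T - (2 + t₀ + t₁), by omega⟩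
  rw [runFor_succ_of_step rfl, runFor_add, e₀.runFor, PMF.pure_bind, runFor_succ_of_step rfl,
    runFor_add, hg₁, PMF.bind_map, ← PMF.bind_pure_comp]
  congr 1
  funext ω
  obtain ⟨v, rfl⟩ : ∃ v, u = t₂ ω + v := ⟨u - t₂ ω, by have := ht₂ ω; omega⟩
  simp only [Function.comp_apply]
  rw [runFor_add, (e₂ ω).runFor, PMF.pure_bind, runFor_halted]

end RealRAM

namespace Leverage

open RealRAM

/-- The program of the algorithm. -/
def leverageProg : Prog := .seq sizeProg (.seq drawProg computeProg)

/-- A bound for the running time of `leverageProg`. -/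
noncomputable def runTime (n d : ℕ) (ε : ℝ) : ℕ :=
  sizeTime n d ε + drawProgTime (2 ^ Nat.clog 2 n) (sketchSize n d ε) d (projSize n ε) +
    computeTime (Nat.clog 2 n) n d (sketchSize n d ε) (projSize n ε) + 2

theorem exists_runFor_leverageProg {n d : ℕ} {ε : ℝ} (hn : 2 ≤ n) (hε : 0 < ε)
    (A : Matrix (Fin n) (Fin d) ℝ) :
    ∃ g : Draws (2 ^ Nat.clog 2 n) (sketchSize n d ε) d (projSize n ε) → Memory,
      runFor (start leverageProg A ε) (runTime n d ε) =
        (PMF.uniformOfFintype _).map (fun ω => ⟨g ω, []⟩) ∧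
      ∀ ω, (∀ i : Fin n, (g ω).real 2 i 0 =
          estimates gsOrth A (sketchSize n d ε) (projSize n ε) ω i) ∧
        (g ω).real 3 0 0 = ⨆ i, estimates gsOrth A (sketchSize n d ε) (projSize n ε) ω i := by
  refine runFor_of_phases (ends_sizeProg (n := n) (d := d) (ε := ε) hn hε ?_ ?_ ?_)
    (fun s' h => (yields_drawProg (k := Nat.clog 2 n) h.2.2.1 h.2.1 h.2.2.2.2.2.2.1
      h.2.2.2.2.2.1).mono
      (Q' := fun ω s'' => (s''.nat 0 0 0 = n ∧ s''.nat 1 0 0 = d ∧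
        s''.nat 2 0 0 = 2 ^ Nat.clog 2 n ∧ s''.nat 3 0 0 = Nat.clog 2 n ∧
        s''.nat 4 0 0 = 2 ^ (Nat.clog 2 n - 1) ∧ s''.nat 13 0 0 = projSize n ε ∧
        s''.nat 14 0 0 = sketchSize n d ε ∧ s''.real 0 = entry A) ∧
        (∀ i : Fin (2 ^ Nat.clog 2 n), s''.nat 10 i 0 = if ω.1 i then 1 else 0) ∧
        (∀ t : Fin (sketchSize n d ε), s''.nat 11 t 0 = ω.2.1 t) ∧
        ∀ (j : Fin d) (t : Fin (projSize n ε)), s''.nat 12 j t = ω.2.2 j t) ?_)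
    (fun ω s' h => ends_computeProg hn A ω h.1.1 h.1.2.1 h.1.2.2.1 h.1.2.2.2.1 h.1.2.2.2.2.1
      h.1.2.2.2.2.2.1 h.1.2.2.2.2.2.2.1 h.2.1 h.2.2.1 h.2.2.2 h.1.2.2.2.2.2.2.2)
    le_rfl
  · simp
  · simp
  · simp
  · rintro ω s'' ⟨a, b, c, e, f⟩
    obtain ⟨h0, h1, h2, h3, h4, h13, h14, hr⟩ := h
    refine ⟨⟨?_, ?_, ?_, ?_, ?_, ?_, ?_, ?_⟩, a, b, c⟩
    · rw [e 0 (by norm_num) (by norm_num) (by norm_num) (by norm_num), h0]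
    · rw [e 1 (by norm_num) (by norm_num) (by norm_num) (by norm_num), h1]
    · rw [e 2 (by norm_num) (by norm_num) (by norm_num) (by norm_num), h2]
    · rw [e 3 (by norm_num) (by norm_num) (by norm_num) (by norm_num), h3]
    · rw [e 4 (by norm_num) (by norm_num) (by norm_num) (by norm_num), h4]
    · rw [e 13 (by norm_num) (by norm_num) (by norm_num) (by norm_num), h13]
    · rw [e 14 (by norm_num) (by norm_num) (by norm_num) (by norm_num), h14]
    · rw [f, hr]
      funext i j
      simp [entry]

theorem haltsWithin_leverageProg {n d : ℕ} {ε : ℝ} (hn : 2 ≤ n) (hε : 0 < ε)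
    (A : Matrix (Fin n) (Fin d) ℝ) :
    HaltsWithin (start leverageProg A ε) (runTime n d ε) := by
  obtain ⟨g, hg, -⟩ := exists_runFor_leverageProg hn hε A
  intro c hc
  rw [hg, PMF.support_map] at hc
  obtain ⟨ω, -, rfl⟩ := hc
  rfl

theorem map_output_leverageProg {n d : ℕ} {ε : ℝ} (hn : 2 ≤ n) (hε : 0 < ε)
    (A : Matrix (Fin n) (Fin d) ℝ) :
    (runFor (start leverageProg A ε) (runTime n d ε)).map (output n) =
      (estimatesLaw gsOrth A (sketchSize n d ε) (projSize n ε)).map fun l => (l, ⨆ i, l i) := by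
  obtain ⟨g, hg, hR⟩ := exists_runFor_leverageProg hn hε A
  rw [hg, estimatesLaw, PMF.map_comp, PMF.map_comp]
  congr 1
  funext ω
  exact Prod.ext (funext (hR ω).1) (hR ω).2

end Leverage

/-! ### The sizes, the running time and the accuracy -/

namespace Leverage

open RealRAM

theorem two_pow_clog_le {m : ℕ} (hm : 1 ≤ m) : 2 ^ Nat.clog 2 m ≤ 2 * m := by
  rcases hm.eq_or_lt with rfl | hm
  · simp
  · have h := Nat.pow_pred_clog_lt_self (b := 2) (by norm_num) (x := m) (by omega)
    have h' := Nat.clog_pos (b := 2) (by norm_num) hm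
    obtain ⟨k, hk⟩ : ∃ k, Nat.clog 2 m = k + 1 := ⟨Nat.clog 2 m - 1, by omega⟩
    rw [hk] at h ⊢
    simp only [Nat.pred_succ] at h
    rw [pow_succ]
    omega

theorem log_le_clog {m : ℕ} (hm : 1 ≤ m) : Real.log m ≤ Nat.clog 2 m * Real.log 2 := by
  have h : (m : ℝ) ≤ 2 ^ Nat.clog 2 m := by
    exact_mod_cast Nat.le_pow_clog (b := 2) (by norm_num) m
  have := Real.log_le_log (by exact_mod_cast hm) h
  rwa [Real.log_pow] at this

theorem clog_le_log {m : ℕ} (hm : 1 ≤ m) :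
    Nat.clog 2 m * Real.log 2 ≤ Real.log m + Real.log 2 := by
  have h : (2 : ℝ) ^ Nat.clog 2 m ≤ 2 * m := by exact_mod_cast two_pow_clog_le hm
  have := Real.log_le_log (by positivity) h
  have hm' : (m : ℝ) ≠ 0 := by positivity
  rw [Real.log_pow, Real.log_mul (by norm_num) hm'] at this
  linarith

section Sizes

variable {n d : ℕ} {ε : ℝ}

theorem four_le_inv_sq (hε : 0 < ε) (hε' : ε ≤ 1 / 2) : 4 ≤ 1 / ε ^ 2 := by
  rw [le_div_iff₀ (by positivity)]
  nlinarith

theorem ceil_inv_sq_le (hε : 0 < ε) (hε' : ε ≤ 1 / 2) :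
    (⌈1 / ε ^ 2⌉₊ : ℝ) ≤ 5 / 4 * (1 / ε ^ 2) := by
  have h := four_le_inv_sq hε hε'
  have := Nat.ceil_lt_add_one (show 0 ≤ 1 / ε ^ 2 by positivity)
  linarith

theorem clog_le_three_mul_log (hn : 2 ≤ n) : (Nat.clog 2 n : ℝ) ≤ 3 * Real.log n := by
  have h := clog_le_log (m := n) (by omega)
  have h2 : Real.log 2 ≤ Real.log n := Real.log_le_log (by norm_num) (by exact_mod_cast hn)
  have := Real.log_two_gt_d9
  nlinarith

theorem log_le_clog_two (hn : 2 ≤ n) : Real.log n ≤ Nat.clog 2 n := by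
  have h := log_le_clog (m := n) (by omega)
  have := Real.log_two_lt_d9
  have : (0 : ℝ) ≤ Nat.clog 2 n := by positivity
  nlinarith

theorem log_two_le_log (hn : 2 ≤ n) : Real.log 2 ≤ Real.log n :=
  Real.log_le_log (by norm_num) (by exact_mod_cast hn)

theorem one_le_baseSize (hd : 1 ≤ d) (hn : 2 ≤ n) (hε : 0 < ε) : 1 ≤ baseSize n d ε :=
  Nat.mul_pos hd (Nat.mul_pos (Nat.ceil_pos.2 (by positivity)) (Nat.clog_pos (by norm_num) hn))

/-- The product `d ε⁻² ln n` exceeds `e`. -/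
theorem one_le_log_base (hd : 1 ≤ d) (hn : 2 ≤ n) (hε : 0 < ε) (hε' : ε ≤ 1 / 2) :
    1 ≤ Real.log (d * Real.log n / ε ^ 2) := by
  rw [Real.le_log_iff_exp_le]
  · have h1 := Real.exp_one_lt_d9
    have h2 := Real.log_two_gt_d9
    have h3 := log_two_le_log hn
    have h4 := four_le_inv_sq hε hε'
    have h5 : (1 : ℝ) ≤ d := by exact_mod_cast hd
    calc Real.exp 1 ≤ 1 * 0.6931471803 * 4 := by linarith
      _ ≤ d * Real.log n * (1 / ε ^ 2) := by gcongr; linarith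
      _ = _ := by ring
  · have h2 := Real.log_two_gt_d9
    have h3 := log_two_le_log hn
    have : 0 < Real.log n := by linarith
    positivity

theorem le_baseSize (hn : 2 ≤ n) (hε : 0 < ε) :
    d * Real.log n / ε ^ 2 ≤ baseSize n d ε := by
  rw [baseSize]
  push_cast
  have h1 := log_le_clog_two hn
  have h2 : 0 ≤ Real.log n := Real.log_natCast_nonneg n
  calc d * Real.log n / ε ^ 2 = d * ((1 / ε ^ 2) * Real.log n) := by ring
    _ ≤ _ := by gcongr; exact Nat.le_ceil _

theorem baseSize_le (hn : 2 ≤ n) (hε : 0 < ε) (hε' : ε ≤ 1 / 2) :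
    (baseSize n d ε : ℝ) ≤ 4 * (d * Real.log n / ε ^ 2) := by
  rw [baseSize]
  push_cast
  have h1 := clog_le_three_mul_log hn
  have h2 : 0 ≤ Real.log n := Real.log_natCast_nonneg n
  have h3 := ceil_inv_sq_le hε hε'
  calc (d : ℝ) * (⌈1 / ε ^ 2⌉₊ * Nat.clog 2 n)
      ≤ d * (5 / 4 * (1 / ε ^ 2) * (3 * Real.log n)) := by gcongr
    _ = 15 / 4 * (d * Real.log n / ε ^ 2) := by ring
    _ ≤ 4 * (d * Real.log n / ε ^ 2) := by gcongr; norm_num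

theorem log_le_clog_baseSize (hd : 1 ≤ d) (hn : 2 ≤ n) (hε : 0 < ε) :
    Real.log (d * Real.log n / ε ^ 2) ≤ Nat.clog 2 (baseSize n d ε) := by
  have hZ : 0 < d * Real.log n / ε ^ 2 := by
    have h2 := Real.log_two_gt_d9
    have h3 := log_two_le_log hn
    have : 0 < Real.log n := by linarith
    positivity
  have h1 := Real.log_le_log hZ (le_baseSize (d := d) hn hε)
  have h2 := log_le_clog (one_le_baseSize hd hn hε)
  have := Real.log_two_lt_d9
  have : (0 : ℝ) ≤ Nat.clog 2 (baseSize n d ε) := by positivity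
  nlinarith

theorem clog_baseSize_le (hd : 1 ≤ d) (hn : 2 ≤ n) (hε : 0 < ε) (hε' : ε ≤ 1 / 2) :
    (Nat.clog 2 (baseSize n d ε) : ℝ) ≤ 5 * Real.log (d * Real.log n / ε ^ 2) := by
  have h0 := one_le_log_base hd hn hε hε'
  have hZ : d * Real.log n / ε ^ 2 ≠ 0 := by
    intro h
    rw [h, Real.log_zero] at h0
    linarith
  have hX : (0 : ℝ) < baseSize n d ε := by exact_mod_cast one_le_baseSize hd hn hε
  have h1 := Real.log_le_log hX (baseSize_le (d := d) hn hε hε')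
  rw [Real.log_mul (by norm_num) hZ, show (4 : ℝ) = 2 ^ 2 by norm_num, Real.log_pow] at h1
  have h2 := clog_le_log (one_le_baseSize hd hn hε)
  have := Real.log_two_gt_d9
  push_cast at h1
  nlinarith

theorem sketchSize_bounds (hd : 1 ≤ d) (hn : 2 ≤ n) (hε : 0 < ε) (hε' : ε ≤ 1 / 2) :
    d * Real.log n / ε ^ 2 * Real.log (d * Real.log n / ε ^ 2) ≤ sketchSize n d ε ∧
      (sketchSize n d ε : ℝ) ≤
        2 ^ 31 * (d * Real.log n / ε ^ 2 * Real.log (d * Real.log n / ε ^ 2)) := by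
  have h1 := one_le_log_base hd hn hε hε'
  have h2 := log_le_clog_baseSize hd hn hε
  have h3 := clog_baseSize_le hd hn hε hε'
  have h4 := le_baseSize (d := d) hn hε
  have h5 := baseSize_le (d := d) hn hε hε'
  have h0 : 0 ≤ d * Real.log n / ε ^ 2 := by
    have : 0 ≤ Real.log n := Real.log_natCast_nonneg n
    positivity
  have h : (sketchSize n d ε : ℝ) =
      2 ^ 26 * (Nat.clog 2 (baseSize n d ε) * baseSize n d ε) := by
    rw [sketchSize]
    norm_num
  rw [h]
  set Z := d * Real.log n / ε ^ 2
  constructor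
  · calc Z * Real.log Z ≤ baseSize n d ε * Nat.clog 2 (baseSize n d ε) := by gcongr
      _ ≤ 2 ^ 26 * (Nat.clog 2 (baseSize n d ε) * baseSize n d ε) := by
        have : (0 : ℝ) ≤ Nat.clog 2 (baseSize n d ε) * baseSize n d ε := by positivity
        linarith
  · calc (2 : ℝ) ^ 26 * (Nat.clog 2 (baseSize n d ε) * baseSize n d ε)
        ≤ 2 ^ 26 * (5 * Real.log Z * (4 * Z)) := by gcongr
      _ ≤ 2 ^ 31 * (Z * Real.log Z) := by
        have : 0 ≤ Z * Real.log Z := by positivity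
        linarith

theorem projSize_bounds (hn : 2 ≤ n) (hε : 0 < ε) (hε' : ε ≤ 1 / 2) :
    Real.log n / ε ^ 2 ≤ projSize n ε ∧ (projSize n ε : ℝ) ≤ 2 ^ 31 * (Real.log n / ε ^ 2) := by
  have h0 : 0 ≤ Real.log n / ε ^ 2 := by
    have : 0 ≤ Real.log n := Real.log_natCast_nonneg n
    positivity
  have h1 := le_baseSize (d := 1) hn hε
  have h2 := baseSize_le (d := 1) hn hε hε'
  have h : (projSize n ε : ℝ) = 2 ^ 22 * baseSize n 1 ε := by
    rw [projSize, baseSize, one_mul]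
    norm_num
  simp only [Nat.cast_one, one_mul] at h1 h2
  rw [h]
  constructor <;> linarith

end Sizes

section Time

variable {n d : ℕ} {ε : ℝ}

/-- The running time in terms of the discrete versions of `ε⁻²`, `ln n` and `ln (d ε⁻² ln n)`. -/
theorem runTime_le_nat (hd : 1 ≤ d) (hdn : d ≤ n) (hn : 2 ≤ n) (hε : 0 < ε) (hε' : ε ≤ 1 / 2) :
    runTime n d ε ≤ 2 ^ 36 * (n * d * ⌈1 / ε ^ 2⌉₊ * Nat.clog 2 n +
      d ^ 3 * ⌈1 / ε ^ 2⌉₊ * Nat.clog 2 n * Nat.clog 2 (baseSize n d ε)) := by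
  have hE : 1 ≤ ⌈1 / ε ^ 2⌉₊ := Nat.ceil_pos.2 (by positivity)
  have hN : 2 ^ Nat.clog 2 n ≤ 2 * n := two_pow_clog_le (by omega)
  have hM : 2 ^ (Nat.clog 2 n - 1) ≤ 2 * n :=
    (Nat.pow_le_pow_right (by norm_num) (Nat.sub_le _ 1)).trans hN
  have hK : 1 ≤ Nat.clog 2 n := Nat.clog_pos (by norm_num) hn
  have hL : 1 ≤ Nat.clog 2 (baseSize n d ε) := by
    exact_mod_cast (one_le_log_base hd hn hε hε').trans (log_le_clog_baseSize hd hn hε)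
  simp only [runTime, computeTime, gsStepTime, tableTime, drawProgTime, drawTime, sizeTime,
    sketchSize, projSize]
  generalize hLX : Nat.clog 2 (baseSize n d ε) = L at *
  rw [baseSize]
  generalize 2 ^ Nat.clog 2 n = N at *
  generalize 2 ^ (Nat.clog 2 n - 1) = M at *
  generalize Nat.clog 2 n = K at *
  generalize ⌈1 / ε ^ 2⌉₊ = E at *
  have hn1 : 1 ≤ n := by omega
  have hd2 : d ≤ d ^ 3 := Nat.le_self_pow (by norm_num) d
  have hd3 : d ^ 2 ≤ d ^ 3 := Nat.pow_le_pow_right hd (by norm_num)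
  have hd1 : 1 ≤ d ^ 3 := hd.trans hd2
  -- All monomials of the running time are bounded by one of the two terms.
  have x₁ : 1 * 1 * 1 * 1 ≤ n * d * E * K := by gcongr
  have x₂ : 1 * 1 * 1 * K ≤ n * d * E * K := by gcongr
  have x₃ : 1 * 1 * E * 1 ≤ n * d * E * K := by gcongr
  have x₄ : 1 * d * 1 * 1 ≤ n * d * E * K := by gcongr
  have x₅ : n * 1 * 1 * 1 ≤ n * d * E * K := by gcongr
  have x₆ : n * d * 1 * 1 ≤ n * d * E * K := by gcongr
  have x₇ : n * d * 1 * K ≤ n * d * E * K := by gcongr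
  have x₈ : n * 1 * 1 * K ≤ n * d * E * K := by gcongr
  have x₉ : 1 * d * E * K ≤ n * d * E * K := by gcongr
  have x₁₀ : d * d * E * K ≤ n * d * E * K := by gcongr
  have x₁₁ : n * 1 * E * K ≤ n * d * E * K := by gcongr
  have x₁₂ : 1 * 1 * E * K ≤ n * d * E * K := by gcongr
  have y₁ : 1 * 1 * 1 * L ≤ d ^ 3 * E * K * L := by gcongr
  have y₂ : d * E * K * L ≤ d ^ 3 * E * K * L := by gcongr
  have y₃ : d ^ 2 * E * K * L ≤ d ^ 3 * E * K * L := by gcongr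
  have y₄ : d ^ 3 * 1 * 1 * 1 ≤ d ^ 3 * E * K * L := by gcongr
  have y₅ : d ^ 2 * 1 * 1 * 1 ≤ d ^ 3 * E * K * L := by gcongr
  have z₁ : N * d ≤ 2 * n * d := by gcongr
  have z₂ : K * M ≤ K * (2 * n) := by gcongr
  have z₃ : K * M * d ≤ K * (2 * n) * d := by gcongr
  ring_nf at *
  linarith

theorem runTime_le (hd : 1 ≤ d) (hdn : d ≤ n) (hn : 2 ≤ n) (hε : 0 < ε) (hε' : ε ≤ 1 / 2)
    (hexp : (n : ℝ) ≤ Real.exp d) : (runTime n d ε : ℝ) ≤ 2 ^ 42 * timeBound n d ε := by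
  have hd' : (1 : ℝ) ≤ d := by exact_mod_cast hd
  have hlog : Real.log n ≤ d := by
    have := Real.log_le_log (by positivity) hexp
    rwa [Real.log_exp] at this
  have hν : 0 ≤ Real.log n := Real.log_natCast_nonneg n
  have hdε : 1 ≤ d / ε := by
    rw [le_div_iff₀ hε]; linarith
  have hlam : 0 ≤ Real.log (d / ε) := Real.log_nonneg hdε
  have hL : (Nat.clog 2 (baseSize n d ε) : ℝ) ≤ 10 * Real.log (d / ε) := by
    refine (clog_baseSize_le hd hn hε hε').trans ?_
    have h0 := one_le_log_base hd hn hε hε'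
    have hZ : 0 < d * Real.log n / ε ^ 2 := by
      have h2 := Real.log_two_gt_d9
      have h3 := log_two_le_log hn
      have : 0 < Real.log n := by linarith
      positivity
    have h1 : d * Real.log n / ε ^ 2 ≤ (d / ε) ^ 2 := by
      rw [div_pow, pow_two (d : ℝ)]
      gcongr
    have := Real.log_le_log hZ h1
    rw [Real.log_pow] at this
    push_cast at this
    linarith
  have hK := clog_le_three_mul_log hn
  have hE := ceil_inv_sq_le hε hε'
  have h := runTime_le_nat hd hdn hn hε hε'
  have h' : (runTime n d ε : ℝ) ≤ 2 ^ 36 * (n * d * ⌈1 / ε ^ 2⌉₊ * Nat.clog 2 n +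
      d ^ 3 * ⌈1 / ε ^ 2⌉₊ * Nat.clog 2 n * Nat.clog 2 (baseSize n d ε)) := by exact_mod_cast h
  refine h'.trans ?_
  have e : (0 : ℝ) ≤ 1 / ε ^ 2 := by positivity
  calc (2 : ℝ) ^ 36 * (n * d * ⌈1 / ε ^ 2⌉₊ * Nat.clog 2 n +
        d ^ 3 * ⌈1 / ε ^ 2⌉₊ * Nat.clog 2 n * Nat.clog 2 (baseSize n d ε))
      ≤ 2 ^ 36 * (n * d * (5 / 4 * (1 / ε ^ 2)) * (3 * Real.log n) +
        d ^ 3 * (5 / 4 * (1 / ε ^ 2)) * (3 * Real.log n) * (10 * Real.log (d / ε))) := by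
        gcongr
    _ ≤ 2 ^ 42 * timeBound n d ε := by
        have a : 0 ≤ n * d * Real.log (d / ε) := by positivity
        have b : 0 ≤ n * d * (1 / ε ^ 2) * Real.log n := by positivity
        have c : 0 ≤ d ^ 3 * (1 / ε ^ 2) * Real.log n * Real.log (d / ε) := by positivity
        rw [timeBound]
        nlinarith

end Time

section Accuracy

variable {n d : ℕ} {ε : ℝ}

theorem accuracy_leverageProg (hd : 1 ≤ d) (hdn : d ≤ n) (hn : 2 ≤ n) (hε : 0 < ε)
    (hε' : ε ≤ 1 / 2) {A : Matrix (Fin n) (Fin d) ℝ} (S : ThinSVD A) :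
    (8 / 10 : ℝ≥0∞) ≤
      ((estimatesLaw gsOrth A (sketchSize n d ε) (projSize n ε)).map
        fun l => (l, ⨆ i, l i)).toOuterMeasure
        {x | (∀ i, |S.score i - x.1 i| ≤ ε * S.score i) ∧
          |S.coherence - x.2| ≤ ε * S.coherence} := by
  classical
  set X := baseSize n d ε with hX
  set L := Nat.clog 2 X with hL
  have hX1 : 1 ≤ X := one_le_baseSize hd hn hε
  have hE1 : 1 ≤ ⌈1 / ε ^ 2⌉₊ := Nat.ceil_pos.2 (by positivity)
  have hK1 : 1 ≤ Nat.clog 2 n := Nat.clog_pos (by norm_num) hn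
  have hLr : 1 ≤ (L : ℝ) := (one_le_log_base hd hn hε hε').trans (log_le_clog_baseSize hd hn hε)
  have hL1 : 1 ≤ L := by exact_mod_cast hLr
  have hE : 1 ≤ ε ^ 2 * (⌈1 / ε ^ 2⌉₊ : ℝ) := by
    have := Nat.le_ceil (1 / ε ^ 2)
    rwa [div_le_iff₀' (by positivity)] at this
  have hdk : d ≤ 2 ^ 2 ^ Nat.clog 2 L :=
    calc d ≤ X := Nat.le_mul_of_pos_right d (Nat.mul_pos hE1 hK1)
      _ ≤ 2 ^ L := Nat.le_pow_clog (by norm_num) X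
      _ ≤ _ := Nat.pow_le_pow_right (by norm_num) (Nat.le_pow_clog (by norm_num) L)
  have hpow : (2 : ℝ) ^ Nat.clog 2 L ≤ 2 * L := by exact_mod_cast two_pow_clog_le hL1
  -- The exponent `2 ^ k` of the moment method is at least `log₂ d` and at most `2 * L`, where `L` is
  -- the logarithm in the sketch size.
  have key := probability_estimates (k := Nat.clog 2 L) (r₁ := sketchSize n d ε)
    (r₂ := projSize n ε) (ε := ε) isOrthogonalizer_gsOrth S hd hdn hn hε (by linarith) ?_ ?_ hdk ?_
    ?_
  · refine (le_toOuterMeasure_uniform _ key).trans ?_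
    rw [estimatesLaw, PMF.map_comp, PMF.toOuterMeasure_map_apply]
    refine MeasureTheory.OuterMeasure.mono _ fun ω hω => ?_
    exact ⟨hω, abs_iSup_sub_iSup_le (by omega) hε.le hω⟩
  · exact Nat.mul_pos (by norm_num) (Nat.mul_pos hL1 hX1)
  · exact Nat.mul_pos (by norm_num) (Nat.mul_pos hE1 hK1)
  · rw [sketchSize, ← hX, ← hL, hX, baseSize]
    push_cast
    have hp : (0 : ℝ) ≤ L * d * Nat.clog 2 n := by positivity
    calc 16 * (2 : ℝ) ^ Nat.clog 2 L * (12 * Nat.clog 2 n * d) * 1600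
        ≤ 16 * (2 * L) * (12 * Nat.clog 2 n * d) * 1600 := by gcongr
      _ ≤ 2 ^ 20 * (1 * (L * d * Nat.clog 2 n)) := by linarith
      _ ≤ 2 ^ 20 * ((ε ^ 2 * ⌈1 / ε ^ 2⌉₊) * (L * d * Nat.clog 2 n)) := by gcongr
      _ = _ := by ring
  · have h1 : 7 * (Nat.clog 2 n : ℝ) ≤ (ε / 8) ^ 2 * projSize n ε / 9216 := by
      rw [projSize]
      push_cast
      have hp : (0 : ℝ) ≤ Nat.clog 2 n := by positivity
      calc 7 * (Nat.clog 2 n : ℝ) ≤ 2 ^ 16 / 9216 * (1 * Nat.clog 2 n) := by linarith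
        _ ≤ 2 ^ 16 / 9216 * ((ε ^ 2 * ⌈1 / ε ^ 2⌉₊) * Nat.clog 2 n) := by gcongr
        _ = _ := by ring
    have h2 : (n : ℝ) ≤ Real.exp (Nat.clog 2 n) := by
      have h : (n : ℝ) ≤ 2 ^ Nat.clog 2 n := by
        exact_mod_cast Nat.le_pow_clog (b := 2) (by norm_num) n
      have he := Real.add_one_le_exp 1
      calc (n : ℝ) ≤ 2 ^ Nat.clog 2 n := h
        _ ≤ Real.exp 1 ^ Nat.clog 2 n := by gcongr; linarith
        _ = _ := by rw [← Real.exp_nat_mul, mul_one]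
    have h3 : Real.exp (-6) ≤ 1 / 40 := by
      have he := Real.exp_one_gt_d9
      rw [Real.exp_neg, show (6 : ℝ) = (6 : ℕ) * 1 by norm_num, Real.exp_nat_mul, ← one_div]
      refine one_div_le_one_div_of_le (by norm_num) ?_
      calc (40 : ℝ) ≤ 2 ^ 6 := by norm_num
        _ ≤ Real.exp 1 ^ 6 := by gcongr; linarith
    have hK1' : (1 : ℝ) ≤ Nat.clog 2 n := by exact_mod_cast hK1
    calc n * (2 * Real.exp (-((ε / 8) ^ 2 * projSize n ε / 9216)))
        ≤ Real.exp (Nat.clog 2 n) * (2 * Real.exp (-(7 * Nat.clog 2 n))) := by gcongr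
      _ = 2 * Real.exp (-(6 * Nat.clog 2 n)) := by
          rw [mul_left_comm, ← Real.exp_add]; congr 2; ring
      _ ≤ 2 * Real.exp (-6) := by gcongr; linarith
      _ ≤ 1 / 20 := by linarith

end Accuracy

end Leverage

/-! ### The running time for constant accuracy -/

namespace Leverage

open Filter Asymptotics

theorem tendsto_dim {n d : ℕ → ℕ} (hn : ∀ k, 2 ≤ n k)
    (h : (fun k => Real.log (n k)) =o[atTop] fun k => (d k : ℝ)) :
    Tendsto (fun k => (d k : ℝ)) atTop atTop := by
  have h1 : (fun _ : ℕ => (1 : ℝ)) =O[atTop] fun k => Real.log (n k) := by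
    refine IsBigO.of_bound 2 (Eventually.of_forall fun k => ?_)
    have h2 := log_two_le_log (hn k)
    have := Real.log_two_gt_d9
    rw [norm_one, Real.norm_of_nonneg (by linarith)]
    linarith
  simpa using (isLittleO_one_left_iff ℝ).1 (h1.trans_isLittleO h)

theorem isLittleO_timeBound {ε : ℝ} (hε : 0 < ε) {n d : ℕ → ℕ}
    (hn : ∀ k, 2 ≤ n k) (hdn : (fun k => (d k : ℝ) * Real.log (d k)) =o[atTop]
      fun k => (n k : ℝ) / Real.log (n k))
    (hnd : (fun k => Real.log (n k)) =o[atTop] fun k => (d k : ℝ)) :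
    (fun k => timeBound (n k) (d k) ε) =o[atTop] fun k => (n k : ℝ) * (d k : ℝ) ^ 2 := by
  have hd := tendsto_dim hn hnd
  have hlogd : (fun k => Real.log (d k / ε)) =O[atTop] fun k => Real.log (d k) := by
    refine IsBigO.of_bound 2 ?_
    filter_upwards [(Real.tendsto_log_atTop.comp hd).eventually_ge_atTop |Real.log ε|,
      hd.eventually_gt_atTop 0] with k hk hk'
    simp only [Function.comp_apply] at hk
    rw [Real.log_div hk'.ne' hε.ne', Real.norm_eq_abs, Real.norm_eq_abs]
    have h1 := abs_sub (Real.log (d k)) (Real.log ε)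
    have h2 := le_abs_self (Real.log (d k))
    linarith
  have hlogd' : (fun k => Real.log (d k / ε)) =o[atTop] fun k => (d k : ℝ) :=
    hlogd.trans_isLittleO (Real.isLittleO_log_id_atTop.comp_tendsto hd)
  have hn0 : ∀ k, Real.log (n k) ≠ 0 := fun k => by
    have h2 := log_two_le_log (hn k)
    have := Real.log_two_gt_d9
    linarith
  have hdn' : (fun k => (d k : ℝ) * Real.log (d k) * Real.log (n k)) =o[atTop]
      fun k => (n k : ℝ) :=
    (hdn.mul_isBigO (isBigO_refl (fun k => Real.log (n k)) atTop)).congr_right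
      fun k => div_mul_cancel₀ _ (hn0 k)
  have t₁ : (fun k => (n k : ℝ) * d k * Real.log (d k / ε)) =o[atTop]
      fun k => (n k : ℝ) * (d k : ℝ) ^ 2 :=
    ((isBigO_refl (fun k => (n k : ℝ) * d k) atTop).mul_isLittleO hlogd').congr_right
      fun k => by ring
  have t₂ : (fun k => (n k : ℝ) * d k * (1 / ε ^ 2) * Real.log (n k)) =o[atTop]
      fun k => (n k : ℝ) * (d k : ℝ) ^ 2 :=
    (((isBigO_refl (fun k => (n k : ℝ) * d k) atTop).mul_isLittleO hnd).const_mul_left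
      (1 / ε ^ 2)).congr (fun k => by ring) fun k => by ring
  have t₃ : (fun k => (d k : ℝ) ^ 3 * (1 / ε ^ 2) * Real.log (n k) * Real.log (d k / ε)) =o[atTop]
      fun k => (n k : ℝ) * (d k : ℝ) ^ 2 := by
    have h1 := (isBigO_refl (fun k => (1 / ε ^ 2) * ((d k : ℝ) ^ 3 * Real.log (n k))) atTop).mul
      hlogd
    have h2 := ((isBigO_refl (fun k => (d k : ℝ) ^ 2) atTop).mul_isLittleO hdn').const_mul_left
      (1 / ε ^ 2)
    refine (h1.congr_left fun k => by ring).trans_isLittleO (h2.congr (fun k => by ring)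
      fun k => by ring)
  exact (t₁.add t₂).add t₃

theorem isLittleO_runTime {ε : ℝ} (hε : 0 < ε) (hε' : ε ≤ 1 / 2) {n d : ℕ → ℕ}
    (h : ∀ k, 1 ≤ d k ∧ d k ≤ n k ∧ 2 ≤ n k)
    (hdn : (fun k => (d k : ℝ) * Real.log (d k)) =o[atTop]
      fun k => (n k : ℝ) / Real.log (n k))
    (hnd : (fun k => Real.log (n k)) =o[atTop] fun k => (d k : ℝ)) :
    (fun k => (runTime (n k) (d k) ε : ℝ)) =o[atTop] fun k => (n k : ℝ) * (d k : ℝ) ^ 2 := by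
  -- Eventually `ln n ≤ d`, so that `runTime_le` applies.
  refine IsBigO.trans_isLittleO (IsBigO.of_bound (2 ^ 42) ?_)
    (isLittleO_timeBound hε (fun k => (h k).2.2) hdn hnd)
  filter_upwards [hnd.bound one_pos] with k hk
  obtain ⟨h1, h2, h3⟩ := h k
  have hn : (0 : ℝ) < n k := by exact_mod_cast (by omega : 0 < n k)
  have hexp : (n k : ℝ) ≤ Real.exp (d k) := by
    rw [← Real.log_le_iff_le_exp hn]
    calc Real.log (n k) ≤ ‖Real.log (n k)‖ := le_abs_self _
      _ ≤ 1 * ‖(d k : ℝ)‖ := hk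
      _ = d k := by rw [one_mul, Real.norm_natCast]
  rw [Real.norm_natCast]
  refine (runTime_le h1 h2 h3 hε hε' hexp).trans ?_
  gcongr
  exact le_abs_self _

end Leverage

theorem theorem1 :
    ∃ (prog : RealRAM.Prog)
      (orth : (r d : ℕ) → Matrix (Fin r) (Fin d) ℝ → Matrix (Fin d) (Fin d) ℝ)
      (r₁ r₂ T : ℕ → ℕ → ℝ → ℕ) (c C : ℝ),
      Leverage.IsOrthogonalizer orth ∧ 0 < c ∧ 0 < C ∧
      (∀ (n d : ℕ) (ε : ℝ), 1 ≤ d → d ≤ n → 2 ≤ n → 0 < ε → ε ≤ 1 / 2 →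
        -- the sketch sizes
        (c * (d * Real.log n / ε ^ 2 * Real.log (d * Real.log n / ε ^ 2)) ≤ r₁ n d ε ∧
          (r₁ n d ε : ℝ) ≤ C * (d * Real.log n / ε ^ 2 * Real.log (d * Real.log n / ε ^ 2))) ∧
        (c * (Real.log n / ε ^ 2) ≤ r₂ n d ε ∧ (r₂ n d ε : ℝ) ≤ C * (Real.log n / ε ^ 2)) ∧
        -- the running time
        ((n : ℝ) ≤ Real.exp d → (T n d ε : ℝ) ≤ C * Leverage.timeBound n d ε) ∧
        ∀ A : Matrix (Fin n) (Fin d) ℝ, A.rank = d →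
          RealRAM.HaltsWithin (RealRAM.start prog A ε) (T n d ε) ∧
          -- the program returns the estimates of the algorithm and their maximum
          (RealRAM.runFor (RealRAM.start prog A ε) (T n d ε)).map (RealRAM.output n) =
            (Leverage.estimatesLaw orth A (r₁ n d ε) (r₂ n d ε)).map (fun l => (l, ⨆ i, l i)) ∧
          -- the accuracy of the returned values
          ∀ S : Leverage.ThinSVD A,
            (8 / 10 : ℝ≥0∞) ≤
              ((RealRAM.runFor (RealRAM.start prog A ε) (T n d ε)).map
                (RealRAM.output n)).toOuterMeasure
                {x | (∀ i, |S.score i - x.1 i| ≤ ε * S.score i) ∧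
                  |S.coherence - x.2| ≤ ε * S.coherence}) ∧
      -- for constant `ε` the running time is `o(n d²)`
      (∀ (ε : ℝ), 0 < ε → ε ≤ 1 / 2 → ∀ n d : ℕ → ℕ,
        (∀ k, 1 ≤ d k ∧ d k ≤ n k ∧ 2 ≤ n k) →
        (fun k => (d k : ℝ) * Real.log (d k)) =o[Filter.atTop]
          (fun k => (n k : ℝ) / Real.log (n k)) →
        (fun k => Real.log (n k)) =o[Filter.atTop] (fun k => (d k : ℝ)) →
        (fun k => (T (n k) (d k) ε : ℝ)) =o[Filter.atTop]
          (fun k => (n k : ℝ) * (d k : ℝ) ^ 2)) := by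
  refine ⟨Leverage.leverageProg, Leverage.gsOrth, Leverage.sketchSize,
    fun n _ ε => Leverage.projSize n ε, Leverage.runTime, 1, 2 ^ 42, Leverage.isOrthogonalizer_gsOrth, one_pos, by norm_num, ?_,
    fun ε hε hε' n d h => Leverage.isLittleO_runTime hε hε' h⟩
  intro n d ε hd hdn hn hε hε'
  obtain ⟨h₁, h₁'⟩ := Leverage.sketchSize_bounds hd hn hε hε'
  obtain ⟨h₂, h₂'⟩ := Leverage.projSize_bounds hn hε hε'
  have hp₁ := (Nat.cast_nonneg _).trans h₁'
  have hp₂ := (Nat.cast_nonneg _).trans h₂'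
  refine ⟨⟨by linarith, by linarith⟩, ⟨by linarith, by linarith⟩,
    Leverage.runTime_le hd hdn hn hε hε', fun A _ =>
    ⟨Leverage.haltsWithin_leverageProg hn hε A, Leverage.map_output_leverageProg hn hε A,
      fun S => ?_⟩⟩
  rw [Leverage.map_output_leverageProg hn hε A]
  exact Leverage.accuracy_leverageProg hd hdn hn hε hε' S
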